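/- Let $\mathfrak g=\mathfrak g(C)$ be the Kac–Moody algebra over $\mathbb C$ of an $l\times l$ generalized Cartan matrix $C$ (symmetrizable or not): given a realization $(\mathfrak h,\{\alpha_i\},\{\alpha_i^\vee\})$ of $C$ with $\dim\mathfrak h=2l-\operatorname{rank}C$, it is the Lie algebra generated by $\mathfrak h$ and $e_i,f_i$ $(1\le i\le l)$ with relations $[h,h']=0$, $[h,e_i]=\alpha_i(h)e_i$, $[h,f_i]=-\alpha_i(h)f_i$, $[e_i,f_j]=\delta_{ij}\alpha_i^\vee$, divided by its largest ideal meeting $\mathfrak h$ trivially. Put $\mathfrak g'=[\mathfrak g,\mathfrak g]$, $\mathfrak h'=\mathfrak g'\cap\mathfrak h$, let $\mathfrak h''\subseteq\mathfrak h$ be any subspace with $\mathfrak h=\mathfrak h'\oplus\mathfrak h''$, let $\Delta^+$ be the set of positive roots and $N^+=\bigoplus_{\alpha\in\Delta^+}\mathfrak g_\alpha$. Let $A$ be a finitely generated commutative associative unital $\mathbb C$-algebra, and let $\widetilde{\mathfrak g}=\mathfrak g'\otimes A\oplus\mathfrak h''$ be the Lie algebra with $[X\otimes a,Y\otimes b]=[X,Y]\otimes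 ab$, $[h,X\otimes a]=[h,X]\otimes a$ and $[h,h']=0$ for $X,Y\in\mathfrak g'$, $a,b\in A$, $h,h'\in\mathfrak h''$. Put $\widetilde{\mathfrak h}=\mathfrak h'\otimes A\oplus\mathfrak h''$, which contains $\mathfrak h=\mathfrak h'\otimes1\oplus\mathfrak h''$. Let $I$ be a cofinite ideal of $A$ (that is, $\dim_{\mathbb C} A/I<\infty$), and let $\psi:\widetilde{\mathfrak h}\to\mathbb C$ be a linear map such that $\psi|_{\mathfrak h'\otimes I}=0$ and such that $\lambda=\psi|_{\mathfrak h}$ is dominant integral, i.e. $\lambda(\alpha_i^\vee)\in\mathbb Z_{\ge0}$ for all $i$. Let $M(\psi)$ be the Verma module of $\widetilde{\mathfrak g}$ induced from the one-dimensional module of $N^+\otimes A\oplus\widetilde{\mathfrak h}$ on which $N^+\otimes A$ acts by $0$ and $\widetilde{\mathfrak h}$ acts by $\psi$, and let $v$ be its highest weight vector. For $\alpha=\sum_i m_i\alpha_i\in\Delta^+$ put $N_{\lambda,\alpha}=\sum_i m_i\lambda(\alpha_i^\vee)$. Let $M(\psi,I)$ be the quotient of $M(\psi)$ by the submodule generated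 by all $(X_{-\alpha}\otimes a)v$ with $\alpha\in\Delta^+$, $X_{-\alpha}\in\mathfrak g_{-\alpha}$, $a\in I^{N_{\lambda,\alpha}}$ (where $I^0=A$). A $\widetilde{\mathfrak g}$-module is called integrable if, as a module over $\mathfrak g=\mathfrak g'\otimes1\oplus\mathfrak h''$, it is $\mathfrak h$-diagonalizable and all $e_i,f_i$ act locally nilpotently. The Weyl module $W(\psi,I)$ is the maximal integrable quotient of $M(\psi,I)$, i.e. its quotient by the intersection of all submodules with integrable quotient. **Theorem.** Let $I$ and $J$ be coprime cofinite ideals of $A$, and let $\psi_1,\psi_2:\widetilde{\mathfrak h}\to\mathbb C$ be linear maps such that $\psi_1|_{\mathfrak h'\otimes I}=0$, $\psi_2|_{\mathfrak h'\otimes J}=0$, and $\psi_1|_{\mathfrak h}$ and $\psi_2|_{\mathfrak h}$ are dominant integral. Then $$W(\psi_1+\psi_2,\,I\cap J)\;\cong\;W(\psi_1,I)\otimes W(\psi_2,J)$$ as $\widetilde{\mathfrak g}$-modules. -/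

import Mathlib

open scoped TensorProduct

noncomputable section

namespace KacMoody

/-! ### Generalized Cartan matrices, realizations, and the Kac–Moody algebra -/

/-- A generalized Cartan matrix `cartan` of size `l`, together with a realization
`(H, {α_i}, {α_i^∨})` of it over `ℂ`: the simple roots `α_i ∈ H^*` and the simple coroots
`α_i^∨ ∈ H` are linearly independent, `α_j (α_i^∨) = a_{ij}`, and `dim H = 2 l - rank`. -/
structure Datum (l : ℕ) (H : Type*) [AddCommGroup H] [Module ℂ H] where
  /-- the generalized Cartan matrix -/
  cartan : Matrix (Fin l) (Fin l) ℤ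
  cartan_diag : ∀ i, cartan i i = 2
  cartan_nonpos : ∀ i j, i ≠ j → cartan i j ≤ 0
  cartan_zero : ∀ i j, cartan i j = 0 → cartan j i = 0
  /-- the simple roots -/
  root : Fin l → Module.Dual ℂ H
  /-- the simple coroots -/
  coroot : Fin l → H
  root_linearIndependent : LinearIndependent ℂ root
  coroot_linearIndependent : LinearIndependent ℂ coroot
  root_coroot : ∀ i j, root j (coroot i) = (cartan i j : ℂ)
  finiteDimensional : FiniteDimensional ℂ H
  finrank_add_rank :
    Module.finrank ℂ H + (cartan.map (fun z : ℤ => (z : ℂ))).rank = 2 * l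

/-- Generators: the elements of `H` and the Chevalley generators `e_i`, `f_i`. -/
inductive Gen (l : ℕ) (H : Type*) where
  | h : H → Gen l H
  | e : Fin l → Gen l H
  | f : Fin l → Gen l H

variable {l : ℕ} {H : Type*} [AddCommGroup H] [Module ℂ H] (D : Datum l H)

/-- The free Lie algebra on the generators. -/
abbrev Free (l : ℕ) (H : Type*) := FreeLieAlgebra ℂ (Gen l H)

/-- The generator attached to `x ∈ H`, in the free Lie algebra. -/
abbrev Free.h (l : ℕ) {H : Type*} (x : H) : Free l H := FreeLieAlgebra.of ℂ (Gen.h x)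

/-- The generator `e_i` in the free Lie algebra. -/
abbrev Free.e {l : ℕ} (H : Type*) (i : Fin l) : Free l H := FreeLieAlgebra.of ℂ (Gen.e i)

/-- The generator `f_i` in the free Lie algebra. -/
abbrev Free.f {l : ℕ} (H : Type*) (i : Fin l) : Free l H := FreeLieAlgebra.of ℂ (Gen.f i)

/-- The relators: linearity in `H`, `[h, h'] = 0`, `[h, e_i] = α_i(h) e_i`,
`[h, f_i] = -α_i(h) f_i`, `[e_i, f_i] = α_i^∨`, and `[e_i, f_j] = 0` for `i ≠ j`. -/
inductive Relator : Free l H → Prop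
  | add (x y : H) : Relator (Free.h l (x + y) - Free.h l x - Free.h l y)
  | smul (c : ℂ) (x : H) : Relator (Free.h l (c • x) - c • Free.h l x)
  | hh (x y : H) : Relator ⁅Free.h l x, Free.h l y⁆
  | he (x : H) (i : Fin l) :
      Relator (⁅Free.h l x, Free.e H i⁆ - D.root i x • Free.e H i)
  | hf (x : H) (i : Fin l) :
      Relator (⁅Free.h l x, Free.f H i⁆ + D.root i x • Free.f H i)
  | ef (i : Fin l) : Relator (⁅Free.e H i, Free.f H i⁆ - Free.h l (D.coroot i))
  | ef_ne (i j : Fin l) (hij : i ≠ j) : Relator ⁅Free.e H i, Free.f H j⁆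

/-- The auxiliary Lie algebra: generators modulo the relators. -/
abbrev Aux := Free l H ⧸ LieSubmodule.lieSpan ℂ (Free l H) {x | Relator D x}

/-- The quotient map onto the auxiliary Lie algebra. -/
abbrev Aux.mk (x : Free l H) : Aux D := LieSubmodule.Quotient.mk x

/-- The image of `H` in the auxiliary Lie algebra. -/
def Aux.cartan : Submodule ℂ (Aux D) :=
  Submodule.span ℂ (Set.range fun x : H => Aux.mk D (Free.h l x))

/-- The largest ideal of the auxiliary Lie algebra that meets the image of `H` trivially. -/
def Aux.radical : LieIdeal ℂ (Aux D) :=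
  sSup {J : LieIdeal ℂ (Aux D) | J.toSubmodule ⊓ Aux.cartan D = ⊥}

/-- The Kac–Moody algebra `𝔤`. -/
abbrev Alg := Aux D ⧸ Aux.radical D

/-- The image in `𝔤` of an element of the free Lie algebra. -/
def mk (x : Free l H) : Alg D := LieSubmodule.Quotient.mk (Aux.mk D x)

/-- The image in `𝔤` of `x ∈ H`. -/
def hElt (x : H) : Alg D := mk D (Free.h l x)

/-- The Chevalley generator `e_i`. -/
def eElt (i : Fin l) : Alg D := mk D (Free.e H i)

/-- The Chevalley generator `f_i`. -/
def fElt (i : Fin l) : Alg D := mk D (Free.f H i)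

theorem mk_relator {x : Free l H} (hx : Relator D x) : mk D x = 0 := by
  have h : Aux.mk D x = 0 :=
    (LieSubmodule.Quotient.mk_eq_zero' ..).2 (LieSubmodule.subset_lieSpan hx)
  unfold mk
  rw [h]
  rfl

theorem mk_add (x y : Free l H) : mk D (x + y) = mk D x + mk D y := rfl
theorem mk_sub (x y : Free l H) : mk D (x - y) = mk D x - mk D y := rfl
theorem mk_smul (c : ℂ) (x : Free l H) : mk D (c • x) = c • mk D x := rfl
theorem mk_lie (x y : Free l H) : mk D ⁅x, y⁆ = ⁅mk D x, mk D y⁆ := rfl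

theorem hElt_add (x y : H) : hElt D (x + y) = hElt D x + hElt D y := by
  have h := mk_relator D (Relator.add (D := D) x y)
  rw [mk_sub, mk_sub, sub_sub, sub_eq_zero] at h
  exact h

theorem hElt_smul (c : ℂ) (x : H) : hElt D (c • x) = c • hElt D x := by
  have h := mk_relator D (Relator.smul (D := D) c x)
  rw [mk_sub, mk_smul, sub_eq_zero] at h
  exact h

theorem hElt_lie_hElt (x y : H) : ⁅hElt D x, hElt D y⁆ = 0 := by
  have h := mk_relator D (Relator.hh (D := D) x y)
  rwa [mk_lie] at h

theorem hElt_lie_eElt (x : H) (i : Fin l) : ⁅hElt D x, eElt D i⁆ = D.root i x • eElt D i := by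
  have h := mk_relator D (Relator.he (D := D) x i)
  rw [mk_sub, mk_smul, mk_lie, sub_eq_zero] at h
  exact h

theorem hElt_lie_fElt (x : H) (i : Fin l) :
    ⁅hElt D x, fElt D i⁆ = -(D.root i x • fElt D i) := by
  have h := mk_relator D (Relator.hf (D := D) x i)
  rw [mk_add, mk_smul, mk_lie] at h
  exact eq_neg_of_add_eq_zero_left h

theorem eElt_lie_fElt (i : Fin l) : ⁅eElt D i, fElt D i⁆ = hElt D (D.coroot i) := by
  have h := mk_relator D (Relator.ef (D := D) i)
  rw [mk_sub, mk_lie, sub_eq_zero] at h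
  exact h

/-- The canonical linear map `H → 𝔤`. -/
def hMap : H →ₗ[ℂ] Alg D where
  toFun := hElt D
  map_add' := hElt_add D
  map_smul' := hElt_smul D

/-- The Cartan subalgebra `𝔥 ⊆ 𝔤`. -/
def cartan : Submodule ℂ (Alg D) := LinearMap.range (hMap D)

/-- The derived algebra `𝔤' = [𝔤, 𝔤]`. -/
abbrev derived : LieIdeal ℂ (Alg D) := ⁅(⊤ : LieIdeal ℂ (Alg D)), (⊤ : LieIdeal ℂ (Alg D))⁆

theorem lie_mem_derived (x y : Alg D) : ⁅x, y⁆ ∈ derived D :=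
  LieSubmodule.lie_mem_lie (LieSubmodule.mem_top x) (LieSubmodule.mem_top y)

theorem eElt_mem_derived (i : Fin l) : eElt D i ∈ derived D := by
  have h : eElt D i = (2⁻¹ : ℂ) • ⁅hElt D (D.coroot i), eElt D i⁆ := by
    rw [hElt_lie_eElt, D.root_coroot, D.cartan_diag, smul_smul]
    norm_num
  rw [h]
  exact (derived D).smul_mem _ (lie_mem_derived D _ _)

theorem fElt_mem_derived (i : Fin l) : fElt D i ∈ derived D := by
  have h : fElt D i = (-2⁻¹ : ℂ) • ⁅hElt D (D.coroot i), fElt D i⁆ := by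
    rw [hElt_lie_fElt, D.root_coroot, D.cartan_diag, smul_neg, smul_smul, ← neg_smul]
    norm_num
  rw [h]
  exact (derived D).smul_mem _ (lie_mem_derived D _ _)

/-- `𝔥' = 𝔤' ∩ 𝔥`. -/
def cartanDerived : Submodule ℂ (Alg D) := (derived D).toSubmodule ⊓ cartan D

theorem coroot_mem_cartanDerived (i : Fin l) : hElt D (D.coroot i) ∈ cartanDerived D := by
  refine ⟨?_, ⟨D.coroot i, rfl⟩⟩
  rw [← eElt_lie_fElt]
  exact lie_mem_derived D _ _

/-- `e_i` as an element of `𝔤'`. -/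
def e' (i : Fin l) : derived D := ⟨eElt D i, eElt_mem_derived D i⟩

/-- `f_i` as an element of `𝔤'`. -/
def f' (i : Fin l) : derived D := ⟨fElt D i, fElt_mem_derived D i⟩

/-- The simple coroot `α_i^∨` as an element of `𝔥'`. -/
def coroot' (i : Fin l) : cartanDerived D := ⟨hElt D (D.coroot i), coroot_mem_cartanDerived D i⟩

/-- The root space `𝔤_μ` for `μ ∈ 𝔥^*`. -/
def rootSpace (μ : Module.Dual ℂ H) : Submodule ℂ (Alg D) where
  carrier := {x | ∀ h : H, ⁅hElt D h, x⁆ = μ h • x}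
  zero_mem' := fun h => by simp
  add_mem' := fun {x y} hx hy h => by rw [lie_add, hx h, hy h, smul_add]
  smul_mem' := fun c x hx h => by rw [lie_smul, hx h, smul_comm]

/-- The element `∑ m_i α_i` of the positive cone `Q_+` of the root lattice. -/
def weight (m : Fin l → ℕ) : Module.Dual ℂ H := ∑ i, m i • D.root i

/-- `∑ m_i α_i` is a positive root. -/
def IsPosRoot (m : Fin l → ℕ) : Prop := m ≠ 0 ∧ rootSpace D (weight D m) ≠ ⊥

/-- `N^+`, the sum of the positive root spaces. -/
def nPlus : Submodule ℂ (Alg D) :=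
  ⨆ (m : Fin l → ℕ) (_ : IsPosRoot D m), rootSpace D (weight D m)

/-! ### The Lie algebra `𝔤' ⊗ A ⊕ 𝔥''` -/

/-- A vector subspace `𝔥''` of `𝔥` with `𝔥' ⊕ 𝔥'' = 𝔥`. -/
structure Complement where
  /-- the subspace `𝔥''` -/
  space : Submodule ℂ (Alg D)
  inf_eq : cartanDerived D ⊓ space = ⊥
  sup_eq : cartanDerived D ⊔ space = cartan D

variable {D}

theorem lie_eq_zero_of_mem_cartan {x y : Alg D} (hx : x ∈ cartan D) (hy : y ∈ cartan D) :
    ⁅x, y⁆ = 0 := by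
  obtain ⟨a, rfl⟩ := hx
  obtain ⟨b, rfl⟩ := hy
  exact hElt_lie_hElt D a b

/-- `𝔥''` as a (commutative) Lie subalgebra of `𝔤`. -/
def Complement.subalgebra (C : Complement D) : LieSubalgebra ℂ (Alg D) :=
  { C.space with
    lie_mem' := by
      intro x y hx hy
      have hle : C.space ≤ cartan D := C.sup_eq ▸ le_sup_right
      have h0 : ⁅x, y⁆ = 0 := lie_eq_zero_of_mem_cartan (hle hx) (hle hy)
      rw [h0]
      exact C.space.zero_mem }

variable (D) in
/-- The derivation `a ⊗ x ↦ a ⊗ [h, x]` of `A ⊗ 𝔤'` attached to `h ∈ 𝔤`. -/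
def loopDerivation (A : Type*) [CommRing A] [Algebra ℂ A] (h : Alg D) :
    LieDerivation ℂ (A ⊗[ℂ] derived D) (A ⊗[ℂ] derived D) where
  toLinearMap := (LieModule.toEnd ℂ (Alg D) (derived D) h).lTensor A
  leibniz' := by
    intro u v
    induction u using TensorProduct.induction_on with
    | zero => simp
    | add u₁ u₂ h₁ h₂ =>
      simp only [add_lie, map_add, lie_add, h₁, h₂]
      abel
    | tmul a x =>
      induction v using TensorProduct.induction_on with
      | zero => simp
      | add v₁ v₂ h₁ h₂ =>
        simp only [add_lie, map_add, lie_add, h₁, h₂]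
        abel
      | tmul b y =>
        have key : ⁅h, ⁅x, y⁆⁆ = ⁅x, ⁅h, y⁆⁆ - ⁅y, ⁅h, x⁆⁆ := by
          apply Subtype.ext
          change ⁅h, ⁅(x : Alg D), (y : Alg D)⁆⁆ =
            ⁅(x : Alg D), ⁅h, (y : Alg D)⁆⁆ - ⁅(y : Alg D), ⁅h, (x : Alg D)⁆⁆
          rw [leibniz_lie, ← lie_skew (y : Alg D)]
          abel
        simp only [LieAlgebra.ExtendScalars.bracket_tmul, LinearMap.lTensor_tmul,
          LieModule.toEnd_apply_apply]
        rw [key, TensorProduct.tmul_sub, mul_comm b a]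

/-- The action of `𝔥''` on `A ⊗ 𝔤'` by derivations. -/
def Complement.action (C : Complement D) (A : Type*) [CommRing A] [Algebra ℂ A] :
    C.subalgebra →ₗ⁅ℂ⁆ LieDerivation ℂ (A ⊗[ℂ] derived D) (A ⊗[ℂ] derived D) where
  toFun h := loopDerivation D A (h : Alg D)
  map_add' := by
    intro x y
    ext u
    change (LieModule.toEnd ℂ (Alg D) (derived D) _).lTensor A u =
      (LieModule.toEnd ℂ (Alg D) (derived D) _).lTensor A u +
      (LieModule.toEnd ℂ (Alg D) (derived D) _).lTensor A u
    rw [← LinearMap.add_apply, ← LinearMap.lTensor_add, ← map_add]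
    rfl
  map_smul' := by
    intro c x
    ext u
    change (LieModule.toEnd ℂ (Alg D) (derived D) _).lTensor A u =
      c • (LieModule.toEnd ℂ (Alg D) (derived D) _).lTensor A u
    rw [← LinearMap.smul_apply, ← LinearMap.lTensor_smul, ← map_smul]
    rfl
  map_lie' := by
    intro x y
    ext u
    rw [LieDerivation.commutator_apply]
    change (LieModule.toEnd ℂ (Alg D) (derived D) _).lTensor A u =
      (LieModule.toEnd ℂ (Alg D) (derived D) _).lTensor A
        ((LieModule.toEnd ℂ (Alg D) (derived D) _).lTensor A u) -
      (LieModule.toEnd ℂ (Alg D) (derived D) _).lTensor A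
        ((LieModule.toEnd ℂ (Alg D) (derived D) _).lTensor A u)
    rw [← LinearMap.comp_apply, ← LinearMap.comp_apply, ← LinearMap.sub_apply,
      ← LinearMap.lTensor_comp, ← LinearMap.lTensor_comp, ← LinearMap.lTensor_sub]
    congr 2
    ext z
    exact congrArg Subtype.val (lie_lie (x : Alg D) (y : Alg D) z)

/-- The Lie algebra `𝔤' ⊗ A ⊕ 𝔥''` (with the tensor factors written in the order `A ⊗ 𝔤'`):
`[a ⊗ x, b ⊗ y] = ab ⊗ [x, y]`, `[h, a ⊗ x] = a ⊗ [h, x]`, `[h, h'] = 0`. -/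
abbrev Loop (C : Complement D) (A : Type*) [CommRing A] [Algebra ℂ A] :=
  LieAlgebra.SemiDirectSum (A ⊗[ℂ] derived D) C.subalgebra (C.action A)

/-- `𝔥' ⊗ A ⊕ 𝔥''`. -/
abbrev LoopCartan (C : Complement D) (A : Type*) [CommRing A] [Algebra ℂ A] :=
  (A ⊗[ℂ] cartanDerived D) × C.subalgebra

section Modules

variable (C : Complement D) (A : Type*) [CommRing A] [Algebra ℂ A]

/-- The element `x ⊗ a` of `𝔤' ⊗ A`, inside `𝔤' ⊗ A ⊕ 𝔥''`. -/
def Loop.of (a : A) (x : derived D) : Loop C A :=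
  LieAlgebra.SemiDirectSum.inl (C.action A) (a ⊗ₜ[ℂ] x)

/-- The inclusion of `𝔥' ⊗ A ⊕ 𝔥''` in `𝔤' ⊗ A ⊕ 𝔥''`. -/
def loopCartanIncl (t : LoopCartan C A) : Loop C A :=
  LieAlgebra.SemiDirectSum.inl (C.action A)
      ((Submodule.inclusion (inf_le_left : cartanDerived D ≤ (derived D).toSubmodule)).lTensor A
        t.1) +
    LieAlgebra.SemiDirectSum.inr (C.action A) t.2

/-- The inclusion of `𝔥 = 𝔥' ⊕ 𝔥''` in `𝔥' ⊗ A ⊕ 𝔥''`, `(x, y) ↦ x ⊗ 1 + y`. -/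
def cartanToLoopCartan : (cartanDerived D × C.subalgebra) →ₗ[ℂ] LoopCartan C A :=
  LinearMap.prodMap (TensorProduct.mk ℂ A (cartanDerived D) 1) LinearMap.id

variable {C A}

/-- The restriction `λ` to `𝔥 = 𝔥' ⊕ 𝔥''` of a linear form on `𝔥' ⊗ A ⊕ 𝔥''`. -/
def restrict (ψ : LoopCartan C A →ₗ[ℂ] ℂ) : (cartanDerived D × C.subalgebra) →ₗ[ℂ] ℂ :=
  ψ ∘ₗ cartanToLoopCartan C A

/-- The number `λ(α_i^∨)`, where `λ` is the restriction of `ψ` to `𝔥`. -/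
def corootValue (ψ : LoopCartan C A →ₗ[ℂ] ℂ) (i : Fin l) : ℂ := restrict ψ (coroot' D i, 0)

/-- The restriction of `ψ` to `𝔥` is dominant integral. -/
def IsDominantIntegral (ψ : LoopCartan C A →ₗ[ℂ] ℂ) : Prop :=
  ∀ i, ∃ n : ℕ, corootValue ψ i = n

/-- `ψ` vanishes on `𝔥' ⊗ I`. -/
def VanishesOn (ψ : LoopCartan C A →ₗ[ℂ] ℂ) (I : Ideal A) : Prop :=
  ∀ a ∈ I, ∀ x : cartanDerived D, ψ (a ⊗ₜ[ℂ] x, 0) = 0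

/-- The left ideal of `U(𝔤' ⊗ A ⊕ 𝔥'')` generated by `N^+ ⊗ A` and by the elements `h - ψ(h)`
for `h ∈ 𝔥' ⊗ A ⊕ 𝔥''`. -/
def vermaIdeal (ψ : LoopCartan C A →ₗ[ℂ] ℂ) :
    Submodule (UniversalEnvelopingAlgebra ℂ (Loop C A)) (UniversalEnvelopingAlgebra ℂ (Loop C A)) :=
  Submodule.span _
    ({u | ∃ (a : A) (x : derived D), (x : Alg D) ∈ nPlus D ∧
        u = UniversalEnvelopingAlgebra.ι ℂ (Loop.of C A a x)} ∪
      {u | ∃ t : LoopCartan C A,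
        u = UniversalEnvelopingAlgebra.ι ℂ (loopCartanIncl C A t) -
          algebraMap ℂ (UniversalEnvelopingAlgebra ℂ (Loop C A)) (ψ t)})

/-- The Verma module `M(ψ)`: the module over `𝔤' ⊗ A ⊕ 𝔥''` induced from the one-dimensional
module of `N^+ ⊗ A ⊕ (𝔥' ⊗ A ⊕ 𝔥'')` given by `ψ`, that is, the quotient of the enveloping algebra
by the left ideal generated by `N^+ ⊗ A` and the elements `h - ψ(h)`. -/
def Verma (ψ : LoopCartan C A →ₗ[ℂ] ℂ) : Type _ :=
  UniversalEnvelopingAlgebra ℂ (Loop C A) ⧸ vermaIdeal ψ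

instance (ψ : LoopCartan C A →ₗ[ℂ] ℂ) : AddCommGroup (Verma ψ) :=
  inferInstanceAs (AddCommGroup (UniversalEnvelopingAlgebra ℂ (Loop C A) ⧸ vermaIdeal ψ))

instance (ψ : LoopCartan C A →ₗ[ℂ] ℂ) : Module (UniversalEnvelopingAlgebra ℂ (Loop C A)) (Verma ψ) :=
  inferInstanceAs (Module (UniversalEnvelopingAlgebra ℂ (Loop C A))
    (UniversalEnvelopingAlgebra ℂ (Loop C A) ⧸ vermaIdeal ψ))

instance (ψ : LoopCartan C A →ₗ[ℂ] ℂ) : Module ℂ (Verma ψ) :=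
  inferInstanceAs (Module ℂ (UniversalEnvelopingAlgebra ℂ (Loop C A) ⧸ vermaIdeal ψ))

instance (ψ : LoopCartan C A →ₗ[ℂ] ℂ) :
    IsScalarTower ℂ (UniversalEnvelopingAlgebra ℂ (Loop C A)) (Verma ψ) :=
  inferInstanceAs (IsScalarTower ℂ (UniversalEnvelopingAlgebra ℂ (Loop C A))
    (UniversalEnvelopingAlgebra ℂ (Loop C A) ⧸ vermaIdeal ψ))

instance (ψ : LoopCartan C A →ₗ[ℂ] ℂ) : LieRingModule (Loop C A) (Verma ψ) where
  bracket x w := UniversalEnvelopingAlgebra.ι ℂ x • w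
  add_lie x y w := by
    change UniversalEnvelopingAlgebra.ι ℂ (x + y) • w = _ • w + _ • w
    rw [map_add, add_smul]
  lie_add x w w' := smul_add _ _ _
  leibniz_lie x y w := by
    change UniversalEnvelopingAlgebra.ι ℂ x • UniversalEnvelopingAlgebra.ι ℂ y • w =
      UniversalEnvelopingAlgebra.ι ℂ ⁅x, y⁆ • w +
        UniversalEnvelopingAlgebra.ι ℂ y • UniversalEnvelopingAlgebra.ι ℂ x • w
    let _ : LieRing (UniversalEnvelopingAlgebra ℂ (Loop C A)) := LieRing.ofAssociativeRing
    have h : UniversalEnvelopingAlgebra.ι ℂ ⁅x, y⁆ =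
        UniversalEnvelopingAlgebra.ι ℂ x * UniversalEnvelopingAlgebra.ι ℂ y -
          UniversalEnvelopingAlgebra.ι ℂ y * UniversalEnvelopingAlgebra.ι ℂ x :=
      (UniversalEnvelopingAlgebra.ι ℂ).map_lie x y
    rw [h, sub_smul, mul_smul, mul_smul]
    abel

theorem Verma.lie_def (ψ : LoopCartan C A →ₗ[ℂ] ℂ) (x : Loop C A) (w : Verma ψ) :
    ⁅x, w⁆ = UniversalEnvelopingAlgebra.ι ℂ x • w := rfl

instance (ψ : LoopCartan C A →ₗ[ℂ] ℂ) : LieModule ℂ (Loop C A) (Verma ψ) where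
  smul_lie c x w := by
    rw [Verma.lie_def, Verma.lie_def, map_smul, smul_assoc]
  lie_smul c x w := by
    rw [Verma.lie_def, Verma.lie_def, ← algebraMap_smul (UniversalEnvelopingAlgebra ℂ (Loop C A)) c w,
      ← algebraMap_smul (UniversalEnvelopingAlgebra ℂ (Loop C A)) c
        (UniversalEnvelopingAlgebra.ι ℂ x • w), smul_smul, smul_smul, Algebra.commutes]

/-- The highest weight vector `v` of `M(ψ)`. -/
def Verma.vec (ψ : LoopCartan C A →ₗ[ℂ] ℂ) : Verma ψ :=
  Submodule.Quotient.mk (p := vermaIdeal ψ) 1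

/-- The submodule of `M(ψ)` generated by the vectors `(X_{-α} ⊗ a) v`, where `α = ∑ m_i α_i` is a
positive root, `X_{-α} ∈ 𝔤_{-α}`, and `a ∈ I ^ N` for the natural number
`N = ∑ m_i λ(α_i^∨)`. -/
def relSubmodule (ψ : LoopCartan C A →ₗ[ℂ] ℂ) (I : Ideal A) :
    LieSubmodule ℂ (Loop C A) (Verma ψ) :=
  LieSubmodule.lieSpan ℂ (Loop C A)
    {w | ∃ (m : Fin l → ℕ) (N : ℕ) (x : derived D) (a : A),
      IsPosRoot D m ∧ (x : Alg D) ∈ rootSpace D (-weight D m) ∧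
      (N : ℂ) = ∑ i, (m i : ℂ) * corootValue ψ i ∧ a ∈ I ^ N ∧
      w = ⁅Loop.of C A a x, Verma.vec ψ⁆}

/-- The highest weight module `M(ψ, I)`. -/
abbrev M (ψ : LoopCartan C A →ₗ[ℂ] ℂ) (I : Ideal A) := Verma ψ ⧸ relSubmodule ψ I

variable (C A) in
/-- A module over `𝔤' ⊗ A ⊕ 𝔥''` is integrable if, as a module over
`𝔤 = 𝔤' ⊗ 1 + 𝔥''`, it is `𝔥`-diagonalizable (it is the sum of its weight spaces) and the Chevalley
generators `e_i`, `f_i` act locally nilpotently. -/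
def IsIntegrable (V : Type*) [AddCommGroup V] [Module ℂ V] [LieRingModule (Loop C A) V]
    [LieModule ℂ (Loop C A) V] : Prop :=
  Submodule.span ℂ {w : V | ∃ μ : Module.Dual ℂ (cartanDerived D × C.subalgebra),
      ∀ h, ⁅loopCartanIncl C A (cartanToLoopCartan C A h), w⁆ = μ h • w} = ⊤ ∧
  ∀ (i : Fin l) (w : V),
    (∃ k : ℕ, (LieModule.toEnd ℂ (Loop C A) V (Loop.of C A 1 (e' D i)) ^ k) w = 0) ∧
    (∃ k : ℕ, (LieModule.toEnd ℂ (Loop C A) V (Loop.of C A 1 (f' D i)) ^ k) w = 0)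

/-- The intersection of all submodules of `M(ψ, I)` with integrable quotient. -/
def weylKernel (ψ : LoopCartan C A →ₗ[ℂ] ℂ) (I : Ideal A) :
    LieSubmodule ℂ (Loop C A) (M ψ I) :=
  sInf {N | IsIntegrable C A (M ψ I ⧸ N)}

/-- The Weyl module `W(ψ, I)`, the maximal integrable quotient of `M(ψ, I)`. -/
abbrev Weyl (ψ : LoopCartan C A →ₗ[ℂ] ℂ) (I : Ideal A) := M ψ I ⧸ weylKernel ψ I

end Modules

end KacMoody

end

/-!
The idea is to describe a Weyl module without reference to the ideal, and then to split the module
on the left-hand side by an idempotent.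

*The universal property.* In an integrable module, a highest weight vector `v` on which `𝔥' ⊗ I`
vanishes satisfies the defining relations of `M(ψ, I)` automatically. For a simple root, `sl₂`-theory
gives `f_i ^ (n + 1) v = 0` with `n = λ(α_i^∨)`, and applying operators `e_i ⊗ a` and `h_i ⊗ a` with
`a ∈ I` to this product collapses it to `(f_i ⊗ c) v` for any given `c ∈ I ^ n`
(`IsCurrentAction.exists_collapse`). A root vector of degree `-∑ m_i α_i` is a combination of brackets
of the `f_i` with these multiplicities, so the general relation follows
(`IsHighestWeight.lie_eq_zero_of_mem_pow`). Conversely, a module generated by a highest weight vector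
on which the `f_i` are nilpotent is integrable, since the Serre relations make the `e_i` and `f_i`
locally ad-nilpotent. Therefore `W(ψ, I)` maps to every representation with a highest weight vector
of weight `ψ` on which the `f_i` are nilpotent (`Weyl.exists_lift`).

*The splitting.* Every vector of `W = W(ψ₁ + ψ₂, I ∩ J)` is killed by `x ⊗ (I ∩ J) ^ N` for large `N`,
so `𝔤' ⊗ A` acts through the completion of `A` along `I ∩ J`, which is the product of the completions
along `I` and `J`. Let `ε = lim ε_N` be the idempotent that is `1` on the first factor and `0` on the
second one. Then `x ⊗ a ↦ x ⊗ ε a` and `x ⊗ a ↦ x ⊗ (1 - ε) a` define commuting actions of `𝔤' ⊗ A` on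
`W` (`limitAction`). The action of `𝔥''` has to be split as well: `h ∈ 𝔥''` should act on the first
part by an operator `d` with `[d, x ⊗ a] = [h, x] ⊗ ε a`. It is obtained from the universal property
of `W`, applied to the deformation of `W` over the dual numbers by the derivation
`x ⊗ a ↦ [h, x] ⊗ ε a` (`HasLift.exists_isPartialDerivation`). In this way `W` carries two commuting
actions of `𝔤' ⊗ A ⊕ 𝔥''` with sum the original one, for which its generator has the weights `ψ₁` and
`ψ₂` respectively (`IsPartialDerivation.half`, `IsPartialDerivation.coHalf`).

*The isomorphism.* The universal properties of `W(ψ₁, I)` and `W(ψ₂, J)`, applied to these two actions,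
give a homomorphism `W(ψ₁, I) ⊗ W(ψ₂, J) → W`, and the universal property of `W` gives one in the
opposite direction. Both match the generators, and the tensor product is generated by the tensor
product of the generators (`lieSpan_tmul_eq_top`), so the two are inverse to each other
(`nonempty_equiv_tensor`).
-/

namespace KacMoody

/-! ### Lie algebras generated by Chevalley generators -/

section Chevalley

variable {l : ℕ} {H : Type*} [AddCommGroup H] [Module ℂ H]

/-- A Lie algebra generated by a linear image of `H` and elements `e_i`, `f_i` that satisfy the
defining relations of the auxiliary Lie algebra. The definition is symmetric under the exchange
of `e` and `f` together with `h ↦ -h`; see `ChevalleySystem.symm`. -/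
structure ChevalleySystem (D : Datum l H) (L : Type*) [LieRing L] [LieAlgebra ℂ L] where
  /-- the image of `H` -/
  h : H →ₗ[ℂ] L
  /-- the raising generators -/
  e : Fin l → L
  /-- the lowering generators -/
  f : Fin l → L
  lie_h_h : ∀ x y, ⁅h x, h y⁆ = 0
  lie_h_e : ∀ x i, ⁅h x, e i⁆ = D.root i x • e i
  lie_h_f : ∀ x i, ⁅h x, f i⁆ = -(D.root i x • f i)
  lie_e_f : ∀ i, ⁅e i, f i⁆ = h (D.coroot i)
  lie_e_f_ne : ∀ i j, i ≠ j → ⁅e i, f j⁆ = 0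
  lieSpan_eq_top :
    LieSubalgebra.lieSpan ℂ L (Set.range h ∪ (Set.range e ∪ Set.range f)) = ⊤

variable {D : Datum l H} {L : Type*} [LieRing L] [LieAlgebra ℂ L]

/-- The left-normed brackets `[f_{i_1}, [f_{i_2}, … [f_{i_r}, y] … ]]`, recorded with the degree
obtained from a degree of `y` by counting the indices. -/
inductive IsDescendant (f : Fin l → L) (y : L) (n : Fin l → ℕ) : (Fin l → ℕ) → L → Prop
  | base : IsDescendant f y n n y
  | step {m : Fin l → ℕ} {x : L} (i : Fin l) (hx : IsDescendant f y n m x) :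
      IsDescendant f y n (Pi.single i 1 + m) ⁅f i, x⁆

/-- The span of all left-normed brackets of the `f_i`. -/
def leftNormed (f : Fin l → L) : Submodule ℂ L :=
  Submodule.span ℂ {x | ∃ i m, IsDescendant f (f i) (Pi.single i 1) m x}

omit [LieAlgebra ℂ L] in
theorem IsDescendant.degree_ne_zero {f : Fin l → L} {y : L} {n m : Fin l → ℕ} {x : L}
    (hx : IsDescendant f y n m x) (hn : n ≠ 0) : m ≠ 0 := by
  cases hx with
  | base => exact hn
  | step i _ =>
    intro h
    have := congrFun h i
    simp at this

theorem weight_single (i : Fin l) : weight D (Pi.single i 1) = D.root i := by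
  simp [weight, Pi.single_apply, ite_smul]

theorem weight_add (m m' : Fin l → ℕ) : weight D (m + m') = weight D m + weight D m' := by
  simp [weight, add_smul, Finset.sum_add_distrib]

theorem weight_injective : Function.Injective (weight D) := by
  intro m m' h
  have hi := Fintype.linearIndependent_iff.1 D.root_linearIndependent
    (fun i => (m i : ℂ) - (m' i : ℂ)) (by
      simpa [weight, sub_smul, Finset.sum_sub_distrib, sub_eq_zero, Nat.cast_smul_eq_nsmul] using h)
  funext i
  exact_mod_cast sub_eq_zero.1 (hi i)

theorem weight_zero : weight D 0 = 0 := by simp [weight]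

theorem weight_ne_zero {m : Fin l → ℕ} (hm : m ≠ 0) : weight D m ≠ 0 := fun h =>
  hm (weight_injective (h.trans weight_zero.symm))

theorem neg_weight_ne_weight {m m' : Fin l → ℕ} (hm : m ≠ 0) : -weight D m ≠ weight D m' := by
  intro h
  have h0 : m' + m = 0 := weight_injective (D := D) (by
    rw [weight_add, weight_zero, ← h, neg_add_cancel])
  exact hm (add_eq_zero.1 h0).2

namespace ChevalleySystem

variable (T : ChevalleySystem D L)

/-- The Chevalley involution, at the level of generators. -/
def symm : ChevalleySystem D L where
  h := -T.h
  e := T.f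
  f := T.e
  lie_h_h x y := by simp [T.lie_h_h]
  lie_h_e x i := by simp [T.lie_h_f]
  lie_h_f x i := by simp [T.lie_h_e]
  lie_e_f i := by rw [← lie_skew, T.lie_e_f]; rfl
  lie_e_f_ne i j hij := by rw [← lie_skew, T.lie_e_f_ne j i hij.symm, neg_zero]
  lieSpan_eq_top := by
    rw [← T.lieSpan_eq_top, Set.union_comm (Set.range T.f)]
    congr 2
    ext x
    constructor
    · rintro ⟨y, rfl⟩
      exact ⟨-y, by simp⟩
    · rintro ⟨y, rfl⟩
      exact ⟨-y, by simp⟩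

/-- The simultaneous eigenspace of `H` of weight `μ`. -/
def wtSpace (μ : Module.Dual ℂ H) : Submodule ℂ L where
  carrier := {x | ∀ y : H, ⁅T.h y, x⁆ = μ y • x}
  zero_mem' := fun y => by simp
  add_mem' := fun {x x'} hx hx' y => by rw [lie_add, hx y, hx' y, smul_add]
  smul_mem' := fun c x hx y => by rw [lie_smul, hx y, smul_comm]

theorem mem_wtSpace {μ : Module.Dual ℂ H} {x : L} :
    x ∈ T.wtSpace μ ↔ ∀ y : H, ⁅T.h y, x⁆ = μ y • x := Iff.rfl

theorem lie_mem_wtSpace {μ ν : Module.Dual ℂ H} {x y : L} (hx : x ∈ T.wtSpace μ)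
    (hy : y ∈ T.wtSpace ν) : ⁅x, y⁆ ∈ T.wtSpace (μ + ν) := by
  intro z
  rw [leibniz_lie, hx z, hy z, smul_lie, lie_smul, ← add_smul]
  rfl

theorem e_mem_wtSpace (i : Fin l) : T.e i ∈ T.wtSpace (D.root i) := fun y => T.lie_h_e y i

theorem f_mem_wtSpace (i : Fin l) : T.f i ∈ T.wtSpace (-D.root i) := fun y => by
  rw [T.lie_h_f]; simp

theorem h_mem_wtSpace (x : H) : T.h x ∈ T.wtSpace 0 := fun y => by simp [T.lie_h_h]

theorem symm_wtSpace (μ : Module.Dual ℂ H) : T.symm.wtSpace μ = T.wtSpace (-μ) := by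
  ext x
  simp only [mem_wtSpace, symm, LinearMap.neg_apply, neg_lie, neg_smul]
  exact forall_congr' fun y => neg_eq_iff_eq_neg

theorem iSupIndep_wtSpace : iSupIndep T.wtSpace := by
  have hcomm : ∀ x y : H, Commute (LieAlgebra.ad ℂ L (T.h x)) (LieAlgebra.ad ℂ L (T.h y)) := by
    intro x y
    ext z
    simpa [T.lie_h_h] using leibniz_lie (T.h x) (T.h y) z
  have h := Module.End.independent_iInf_maxGenEigenspace_of_forall_mapsTo
    (fun x : H => LieAlgebra.ad ℂ L (T.h x))
    (fun x y φ => Module.End.mapsTo_maxGenEigenspace_of_comm (hcomm y x) φ)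
  have h' := h.comp (f := fun μ : Module.Dual ℂ H => (μ : H → ℂ)) DFunLike.coe_injective
  refine h'.mono fun μ x hx => ?_
  simp only [Function.comp, Submodule.mem_iInf]
  intro y
  rw [Module.End.mem_maxGenEigenspace]
  refine ⟨1, ?_⟩
  simp [hx y]

theorem descendant_mem_wtSpace {y : L} {n m : Fin l → ℕ} {x : L}
    (hx : IsDescendant T.f y n m x) (hy : y ∈ T.wtSpace (-weight D n)) :
    x ∈ T.wtSpace (-weight D m) := by
  induction hx with
  | base => exact hy
  | step i _ ih =>
    rw [weight_add, weight_single, neg_add]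
    exact T.lie_mem_wtSpace (T.f_mem_wtSpace i) ih

theorem f_descendant_mem_wtSpace {i : Fin l} {m : Fin l → ℕ} {x : L}
    (hx : IsDescendant T.f (T.f i) (Pi.single i 1) m x) : x ∈ T.wtSpace (-weight D m) :=
  T.descendant_mem_wtSpace hx (by rw [weight_single]; exact T.f_mem_wtSpace i)

/-- A subspace stable under the adjoint action of the generators is stable under the adjoint action
of the whole Lie algebra. -/
theorem lie_mem_of_generators {M : Type*} [AddCommGroup M] [Module ℂ M] [LieRingModule L M]
    [LieModule ℂ L M] (S : Submodule ℂ M)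
    (hh : ∀ y, ∀ x ∈ S, ⁅T.h y, x⁆ ∈ S) (he : ∀ i, ∀ x ∈ S, ⁅T.e i, x⁆ ∈ S)
    (hf : ∀ i, ∀ x ∈ S, ⁅T.f i, x⁆ ∈ S) (y : L) : ∀ x ∈ S, ⁅y, x⁆ ∈ S := by
  have hy : y ∈ LieSubalgebra.lieSpan ℂ L (Set.range T.h ∪ (Set.range T.e ∪ Set.range T.f)) := by
    rw [T.lieSpan_eq_top]; trivial
  induction hy using LieSubalgebra.lieSpan_induction with
  | mem y hy =>
    rcases hy with ⟨z, rfl⟩ | ⟨i, rfl⟩ | ⟨i, rfl⟩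
    · exact hh z
    · exact he i
    · exact hf i
  | zero => intro x _; simp
  | smul c y _ hy => intro x hx; rw [smul_lie]; exact S.smul_mem _ (hy x hx)
  | add y z _ _ hy hz => intro x hx; rw [add_lie]; exact S.add_mem (hy x hx) (hz x hx)
  | lie y z _ _ hy hz =>
    intro x hx
    rw [lie_lie]
    exact S.sub_mem (hy _ (hz x hx)) (hz _ (hy x hx))

theorem lie_mem_leftNormed (i : Fin l) {x : L} (hx : x ∈ leftNormed T.f) :
    ⁅T.f i, x⁆ ∈ leftNormed T.f := by
  induction hx using Submodule.span_induction with
  | mem x hx =>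
    obtain ⟨j, m, hx⟩ := hx
    exact Submodule.subset_span ⟨j, _, hx.step i⟩
  | zero => simp
  | add x y _ _ hx hy => rw [lie_add]; exact Submodule.add_mem _ hx hy
  | smul c x _ hx => rw [lie_smul]; exact Submodule.smul_mem _ _ hx

theorem h_lie_mem_leftNormed (y : H) {x : L} (hx : x ∈ leftNormed T.f) :
    ⁅T.h y, x⁆ ∈ leftNormed T.f := by
  induction hx using Submodule.span_induction with
  | mem x hx =>
    obtain ⟨j, m, hx⟩ := hx
    rw [T.f_descendant_mem_wtSpace hx y]
    exact Submodule.smul_mem _ _ (Submodule.subset_span ⟨j, m, hx⟩)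
  | zero => simp
  | add x y _ _ hx hy => rw [lie_add]; exact Submodule.add_mem _ hx hy
  | smul c x _ hx => rw [lie_smul]; exact Submodule.smul_mem _ _ hx

theorem f_mem_leftNormed (i : Fin l) : T.f i ∈ leftNormed T.f :=
  Submodule.subset_span ⟨i, _, .base⟩

theorem f_lie_h_mem_leftNormed (i : Fin l) (y : H) : ⁅T.f i, T.h y⁆ ∈ leftNormed T.f := by
  rw [← lie_skew, T.lie_h_f, neg_neg]
  exact Submodule.smul_mem _ _ (T.f_mem_leftNormed i)

theorem e_lie_mem_leftNormed (i : Fin l) {x : L} (hx : x ∈ leftNormed T.f) :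
    ⁅T.e i, x⁆ ∈ leftNormed T.f ⊔ LinearMap.range T.h := by
  induction hx using Submodule.span_induction with
  | mem x hx =>
    obtain ⟨j, m, hx⟩ := hx
    have key : ∀ j, ⁅T.e i, T.f j⁆ ∈ LinearMap.range T.h := by
      intro j
      by_cases hij : i = j
      · subst hij
        exact ⟨_, (T.lie_e_f i).symm⟩
      · rw [T.lie_e_f_ne i j hij]
        exact Submodule.zero_mem _
    induction hx with
    | base => exact Submodule.mem_sup_right (key j)
    | @step m x k hx ih =>
      rw [leibniz_lie]
      refine Submodule.add_mem _ (Submodule.mem_sup_left ?_) (Submodule.mem_sup_left ?_)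
      · obtain ⟨z, hz⟩ := key k
        rw [← hz]
        exact T.h_lie_mem_leftNormed z (Submodule.subset_span ⟨j, m, hx⟩)
      · obtain ⟨u, hu, v, ⟨w, rfl⟩, huv⟩ := Submodule.mem_sup.1 ih
        rw [← huv, lie_add]
        exact Submodule.add_mem _ (T.lie_mem_leftNormed k hu) (T.f_lie_h_mem_leftNormed k w)
  | zero => simp
  | add x y _ _ hx hy => rw [lie_add]; exact Submodule.add_mem _ hx hy
  | smul c x _ hx => rw [lie_smul]; exact Submodule.smul_mem _ _ hx

/-- The triangular decomposition, without directness of the sum. -/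
theorem leftNormed_sup_eq_top :
    leftNormed T.f ⊔ LinearMap.range T.h ⊔ leftNormed T.e = ⊤ := by
  set S := leftNormed T.f ⊔ LinearMap.range T.h ⊔ leftNormed T.e with hS
  have h1 : leftNormed T.f ≤ S := le_sup_left.trans le_sup_left
  have h2 : LinearMap.range T.h ≤ S := le_sup_right.trans le_sup_left
  have h3 : leftNormed T.e ≤ S := le_sup_right
  have hsymm : LinearMap.range T.symm.h ≤ LinearMap.range T.h := by
    rintro _ ⟨y, rfl⟩
    exact ⟨-y, by simp [symm]⟩
  have dec : ∀ x ∈ S, ∃ a ∈ leftNormed T.f, ∃ b : H, ∃ c ∈ leftNormed T.e,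
      x = a + T.h b + c := by
    intro x hx
    obtain ⟨y, hy, c, hc, rfl⟩ := Submodule.mem_sup.1 hx
    obtain ⟨a, ha, _, ⟨b, rfl⟩, rfl⟩ := Submodule.mem_sup.1 hy
    exact ⟨a, ha, b, c, hc, rfl⟩
  have hall : ∀ y : L, ∀ x ∈ S, ⁅y, x⁆ ∈ S := by
    intro y
    refine T.lie_mem_of_generators S ?_ ?_ ?_ y
    · intro y x hx
      obtain ⟨a, ha, b, c, hc, rfl⟩ := dec x hx
      have hc' := T.symm.h_lie_mem_leftNormed (-y) hc
      simp only [symm, LinearMap.neg_apply, map_neg, neg_neg] at hc'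
      rw [lie_add, lie_add, T.lie_h_h, add_zero]
      exact S.add_mem (h1 (T.h_lie_mem_leftNormed y ha)) (h3 hc')
    · intro i x hx
      obtain ⟨a, ha, b, c, hc, rfl⟩ := dec x hx
      rw [lie_add, lie_add]
      refine S.add_mem (S.add_mem (sup_le h1 h2 (T.e_lie_mem_leftNormed i ha)) (h3 ?_))
        (h3 (T.symm.lie_mem_leftNormed i hc))
      have := T.symm.f_lie_h_mem_leftNormed i (-b)
      simpa [symm] using this
    · intro i x hx
      obtain ⟨a, ha, b, c, hc, rfl⟩ := dec x hx
      rw [lie_add, lie_add]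
      exact S.add_mem (S.add_mem (h1 (T.lie_mem_leftNormed i ha))
        (h1 (T.f_lie_h_mem_leftNormed i b)))
        (sup_le h3 (hsymm.trans h2) (T.symm.e_lie_mem_leftNormed i hc))
  have hsub : LieSubalgebra.lieSpan ℂ L (Set.range T.h ∪ (Set.range T.e ∪ Set.range T.f)) ≤
      ({ S with lie_mem' := fun {x y} _ hy => hall x y hy } : LieSubalgebra ℂ L) := by
    rw [LieSubalgebra.lieSpan_le]
    rintro _ (⟨y, rfl⟩ | ⟨i, rfl⟩ | ⟨i, rfl⟩)
    · exact h2 ⟨y, rfl⟩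
    · exact h3 (T.symm.f_mem_leftNormed i)
    · exact h1 (T.f_mem_leftNormed i)
  rw [T.lieSpan_eq_top] at hsub
  exact eq_top_iff.2 fun x _ => hsub (LieSubalgebra.mem_top x)

/-- A root space for a negative root is spanned by the left-normed brackets of the right degree. -/
theorem wtSpace_neg_weight_le {m : Fin l → ℕ} (hm : m ≠ 0) :
    T.wtSpace (-weight D m) ≤
      Submodule.span ℂ {x | ∃ i, IsDescendant T.f (T.f i) (Pi.single i 1) m x} := by
  set P := Submodule.span ℂ {x | ∃ i, IsDescendant T.f (T.f i) (Pi.single i 1) m x}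
  -- the sum of all weight spaces other than the one under consideration
  set Q := ⨆ (ν : Module.Dual ℂ H) (_ : ν ≠ -weight D m), T.wtSpace ν
  have hQ : ∀ {ν x}, ν ≠ -weight D m → x ∈ T.wtSpace ν → x ∈ Q := fun hν hx =>
    (le_iSup₂_of_le (f := fun ν (_ : ν ≠ -weight D m) => T.wtSpace ν) _ hν le_rfl) hx
  have hPQ : P ⊔ Q = ⊤ := by
    rw [eq_top_iff, ← T.leftNormed_sup_eq_top]
    refine sup_le (sup_le ?_ ?_) ?_
    · refine Submodule.span_le.2 ?_
      rintro x ⟨i, m', hx⟩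
      by_cases h : m' = m
      · subst h
        exact Submodule.mem_sup_left (Submodule.subset_span ⟨i, hx⟩)
      · refine Submodule.mem_sup_right (hQ (fun h' => h ?_) (T.f_descendant_mem_wtSpace hx))
        exact weight_injective (neg_injective h')
    · rintro _ ⟨y, rfl⟩
      refine Submodule.mem_sup_right (hQ (fun h => ?_) (T.h_mem_wtSpace y))
      exact weight_ne_zero (D := D) hm (neg_eq_zero.1 h.symm)
    · refine Submodule.span_le.2 ?_
      rintro x ⟨i, m', hx⟩
      have := T.symm.f_descendant_mem_wtSpace hx
      rw [symm_wtSpace, neg_neg] at this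
      exact Submodule.mem_sup_right (hQ (neg_weight_ne_weight hm).symm this)
  have hP : P ≤ T.wtSpace (-weight D m) := Submodule.span_le.2 (by
    rintro x ⟨i, hx⟩
    exact T.f_descendant_mem_wtSpace hx)
  intro x hx
  obtain ⟨p, hp, q, hq, rfl⟩ := Submodule.mem_sup.1 (hPQ ▸ Submodule.mem_top : x ∈ P ⊔ Q)
  have hq' : q ∈ T.wtSpace (-weight D m) := by
    have := Submodule.sub_mem _ hx (hP hp)
    rwa [add_sub_cancel_left] at this
  have := Submodule.disjoint_def.1 (T.iSupIndep_wtSpace (-weight D m)) q hq' hq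
  rw [this, add_zero]
  exact hp

/-- The ideal generated by a vector of negative weight that is killed by all `e_i` meets the image
of `H` trivially. -/
theorem exists_ideal_of_lie_e_eq_zero {y : L} {n : Fin l → ℕ} (hn : n ≠ 0)
    (hy : y ∈ T.wtSpace (-weight D n)) (he : ∀ i, ⁅T.e i, y⁆ = 0) :
    ∃ J : LieIdeal ℂ L, y ∈ J ∧ J.toSubmodule ⊓ LinearMap.range T.h = ⊥ := by
  set S := Submodule.span ℂ {x | ∃ m, IsDescendant T.f y n m x}
  have hmem : ∀ {m x}, IsDescendant T.f y n m x → x ∈ S := fun hx =>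
    Submodule.subset_span ⟨_, hx⟩
  have ind : ∀ z : L, (∀ m x, IsDescendant T.f y n m x → ⁅z, x⁆ ∈ S) → ∀ x ∈ S, ⁅z, x⁆ ∈ S := by
    intro z hz x hx
    induction hx using Submodule.span_induction with
    | mem x hx => exact hz _ _ hx.choose_spec
    | zero => simp
    | add x y _ _ hx hy => rw [lie_add]; exact S.add_mem hx hy
    | smul c x _ hx => rw [lie_smul]; exact S.smul_mem _ hx
  have hf : ∀ i, ∀ x ∈ S, ⁅T.f i, x⁆ ∈ S := fun i => ind _ fun m x hx => hmem (hx.step i)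
  have hh : ∀ z, ∀ x ∈ S, ⁅T.h z, x⁆ ∈ S := fun z => ind _ fun m x hx => by
    rw [T.descendant_mem_wtSpace hx hy z]
    exact S.smul_mem _ (hmem hx)
  have hE : ∀ i, ∀ x ∈ S, ⁅T.e i, x⁆ ∈ S := fun i => ind _ fun m x hx => by
    induction hx with
    | base => rw [he]; exact S.zero_mem
    | @step m x k hx ih =>
      rw [leibniz_lie]
      refine S.add_mem ?_ (hf k _ ih)
      by_cases hik : i = k
      · subst hik
        rw [T.lie_e_f]
        exact hh _ _ (hmem hx)
      · rw [T.lie_e_f_ne i k hik, zero_lie]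
        exact S.zero_mem
  refine ⟨{ S with lie_mem := fun {z x} hx => T.lie_mem_of_generators S hh hE hf z x hx },
    hmem .base, ?_⟩
  change S ⊓ LinearMap.range T.h = ⊥
  rw [eq_bot_iff]
  rintro x ⟨hx, ⟨z, rfl⟩⟩
  have hS : S ≤ ⨆ (ν : Module.Dual ℂ H) (_ : ν ≠ 0), T.wtSpace ν := by
    refine Submodule.span_le.2 ?_
    rintro x ⟨m, hx⟩
    exact (le_iSup₂_of_le (f := fun ν (_ : ν ≠ 0) => T.wtSpace ν) _
      (neg_ne_zero.2 (weight_ne_zero (hx.degree_ne_zero hn))) le_rfl)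
      (T.descendant_mem_wtSpace hx hy)
  exact Submodule.disjoint_def.1 (T.iSupIndep_wtSpace 0) _ (T.h_mem_wtSpace z) (hS hx)

end ChevalleySystem

/-- The standard computation in `sl₂`: `e f^(n+1) v = (n+1)(μ-n) f^n v` for a vector `v` of weight
`μ` killed by `e`. -/
theorem lie_e_toEnd_f_pow_succ {M : Type*} [AddCommGroup M] [Module ℂ M] [LieRingModule L M]
    [LieModule ℂ L M] {e f h : L} (hef : ⁅e, f⁆ = h) (hhf : ⁅h, f⁆ = (-2 : ℂ) • f)
    {v : M} {μ : ℂ} (hv : ⁅h, v⁆ = μ • v) (he : ⁅e, v⁆ = 0) (n : ℕ) :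
    ⁅e, (LieModule.toEnd ℂ L M f ^ (n + 1)) v⁆ =
      ((n + 1) * (μ - n)) • (LieModule.toEnd ℂ L M f ^ n) v := by
  have hh : ∀ n : ℕ, ⁅h, (LieModule.toEnd ℂ L M f ^ n) v⁆ =
      (μ - 2 * n) • (LieModule.toEnd ℂ L M f ^ n) v := by
    intro n
    induction n with
    | zero => simpa using hv
    | succ n ih =>
      rw [pow_succ', Module.End.mul_apply, LieModule.toEnd_apply_apply, leibniz_lie, ih, hhf,
        smul_lie, lie_smul, ← add_smul]
      congr 1
      push_cast
      ring
  induction n with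
  | zero => simp [leibniz_lie e, hef, he, hv]
  | succ n ih =>
    rw [pow_succ', Module.End.mul_apply, LieModule.toEnd_apply_apply, leibniz_lie, hef, ih, hh,
      lie_smul, ← LieModule.toEnd_apply_apply ℂ L M f, ← Module.End.mul_apply, ← pow_succ',
      ← add_smul]
    congr 1
    push_cast
    ring

end Chevalley

/-! ### Serre relations and the derived algebra -/

section Serre

variable {l : ℕ} {H : Type*} [AddCommGroup H] [Module ℂ H]
variable {D : Datum l H} {L : Type*} [LieRing L] [LieAlgebra ℂ L]

open LieModule in
theorem toEnd_pow_comm_of_lie_eq_zero {M : Type*} [AddCommGroup M] [Module ℂ M]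
    [LieRingModule L M] [LieModule ℂ L M] {x y : L} (h : ⁅x, y⁆ = 0) (n : ℕ) (m : M) :
    ⁅x, (toEnd ℂ L M y ^ n) m⁆ = (toEnd ℂ L M y ^ n) ⁅x, m⁆ := by
  induction n with
  | zero => rfl
  | succ n ih =>
    rw [pow_succ', Module.End.mul_apply, Module.End.mul_apply, toEnd_apply_apply, leibniz_lie, h,
      zero_lie, zero_add, ih, toEnd_apply_apply]

namespace ChevalleySystem

open LieModule

variable (T : ChevalleySystem D L)

/-- The left-hand side of a Serre relation is killed by all raising generators. -/
theorem lie_e_serre {i j : Fin l} (hij : i ≠ j) {n : ℕ} (hn : D.cartan i j = -(n : ℤ))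
    (k : Fin l) : ⁅T.e k, (toEnd ℂ L L (T.f i) ^ (n + 1)) (T.f j)⁆ = 0 := by
  by_cases hki : k = i
  · subst hki
    have h := lie_e_toEnd_f_pow_succ (M := L) (T.lie_e_f k) (h := T.h (D.coroot k))
      (v := T.f j) (μ := n) ?_ ?_ (T.lie_e_f_ne k j hij) n
    · rw [h]
      simp
    · rw [T.lie_h_f, D.root_coroot, D.cartan_diag]
      simp
    · rw [T.lie_h_f, D.root_coroot, hn]
      simp
  · rw [toEnd_pow_comm_of_lie_eq_zero (T.lie_e_f_ne k i hki)]
    by_cases hkj : k = j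
    · subst hkj
      have h1 : ⁅T.f i, T.h (D.coroot k)⁆ = (D.cartan k i : ℂ) • T.f i := by
        rw [← lie_skew, T.lie_h_f, neg_neg, D.root_coroot]
      rw [T.lie_e_f, pow_succ, Module.End.mul_apply, toEnd_apply_apply, h1]
      cases n with
      | zero =>
        have h0 : D.cartan k i = 0 := D.cartan_zero _ _ (by simpa using hn)
        simp [h0]
      | succ n =>
        rw [pow_succ, Module.End.mul_apply, toEnd_apply_apply, lie_smul, lie_self, smul_zero,
          map_zero]
    · rw [T.lie_e_f_ne k j hkj, map_zero]

theorem serre_mem_wtSpace (i j : Fin l) (n : ℕ) :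
    (toEnd ℂ L L (T.f i) ^ n) (T.f j) ∈
      T.wtSpace (-weight D (n • Pi.single i 1 + Pi.single j 1)) := by
  induction n with
  | zero => simpa [weight_single] using T.f_mem_wtSpace j
  | succ n ih =>
    rw [pow_succ', Module.End.mul_apply, toEnd_apply_apply, succ_nsmul', add_assoc, weight_add,
      weight_single, neg_add]
    exact T.lie_mem_wtSpace (T.f_mem_wtSpace i) ih

/-- The Serre relations hold modulo an ideal that meets the image of `H` trivially. -/
theorem exists_ideal_serre {i j : Fin l} (hij : i ≠ j) {n : ℕ} (hn : D.cartan i j = -(n : ℤ)) :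
    ∃ J : LieIdeal ℂ L, (toEnd ℂ L L (T.f i) ^ (n + 1)) (T.f j) ∈ J ∧
      J.toSubmodule ⊓ LinearMap.range T.h = ⊥ := by
  refine T.exists_ideal_of_lie_e_eq_zero ?_ (T.serre_mem_wtSpace i j (n + 1))
    (T.lie_e_serre hij hn)
  intro h
  have := congrFun h j
  simp at this

theorem exists_cartan_eq_neg {i j : Fin l} (hij : i ≠ j) : ∃ n : ℕ, D.cartan i j = -(n : ℤ) :=
  ⟨(-D.cartan i j).toNat, by have := D.cartan_nonpos i j hij; omega⟩

/-- The Serre relations imply that each `f_i` is locally ad-nilpotent. -/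
theorem engel_f_eq_top (i : Fin l)
    (hS : ∀ j, i ≠ j → ∃ n, (toEnd ℂ L L (T.f i) ^ n) (T.f j) = 0) :
    LieSubalgebra.engel ℂ (T.f i) = ⊤ := by
  have hh : ∀ y, T.h y ∈ LieSubalgebra.engel ℂ (T.f i) := by
    intro y
    rw [LieSubalgebra.mem_engel_iff]
    refine ⟨2, ?_⟩
    rw [pow_two, Module.End.mul_apply, LieAlgebra.ad_apply, LieAlgebra.ad_apply,
      ← lie_skew (T.f i) (T.h y), T.lie_h_f, neg_neg, lie_smul, lie_self, smul_zero]
  rw [eq_top_iff, ← T.lieSpan_eq_top, LieSubalgebra.lieSpan_le]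
  rintro _ (⟨y, rfl⟩ | ⟨j, rfl⟩ | ⟨j, rfl⟩)
  · exact hh y
  · rw [SetLike.mem_coe, LieSubalgebra.mem_engel_iff]
    by_cases hij : j = i
    · subst hij
      obtain ⟨n, hn⟩ := (LieSubalgebra.mem_engel_iff ℂ _ _).1 (hh (D.coroot j))
      refine ⟨n + 1, ?_⟩
      rw [pow_succ, Module.End.mul_apply, LieAlgebra.ad_apply, ← lie_skew, T.lie_e_f, map_neg, hn,
        neg_zero]
    · exact ⟨1, by rw [pow_one, LieAlgebra.ad_apply, ← lie_skew, T.lie_e_f_ne j i hij, neg_zero]⟩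
  · rw [SetLike.mem_coe]
    by_cases hij : i = j
    · subst hij
      exact LieSubalgebra.self_mem_engel _ _
    · rw [LieSubalgebra.mem_engel_iff]
      exact hS j hij

/-- The image of a Chevalley system under a surjective homomorphism. -/
def map {L' : Type*} [LieRing L'] [LieAlgebra ℂ L'] (π : L →ₗ⁅ℂ⁆ L')
    (hπ : Function.Surjective π) : ChevalleySystem D L' where
  h := (π : L →ₗ[ℂ] L') ∘ₗ T.h
  e i := π (T.e i)
  f i := π (T.f i)
  lie_h_h x y := by simp [← LieHom.map_lie, T.lie_h_h]
  lie_h_e x i := by simp [← LieHom.map_lie, T.lie_h_e]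
  lie_h_f x i := by simp [← LieHom.map_lie, T.lie_h_f]
  lie_e_f i := by simp [← LieHom.map_lie, T.lie_e_f]
  lie_e_f_ne i j hij := by simp [← LieHom.map_lie, T.lie_e_f_ne i j hij]
  lieSpan_eq_top := by
    set K := LieSubalgebra.lieSpan ℂ L' (Set.range ((π : L →ₗ[ℂ] L') ∘ₗ T.h) ∪
      (Set.range (fun i => π (T.e i)) ∪ Set.range fun i => π (T.f i))) with hK
    have h : LieSubalgebra.lieSpan ℂ L (Set.range T.h ∪ (Set.range T.e ∪ Set.range T.f)) ≤
        K.comap π := by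
      rw [LieSubalgebra.lieSpan_le]
      rintro _ (⟨y, rfl⟩ | ⟨i, rfl⟩ | ⟨i, rfl⟩)
      · exact LieSubalgebra.subset_lieSpan (Or.inl ⟨y, rfl⟩)
      · exact LieSubalgebra.subset_lieSpan (Or.inr (Or.inl ⟨i, rfl⟩))
      · exact LieSubalgebra.subset_lieSpan (Or.inr (Or.inr ⟨i, rfl⟩))
    rw [T.lieSpan_eq_top] at h
    rw [eq_top_iff]
    intro y _
    obtain ⟨x, rfl⟩ := hπ y
    exact h (LieSubalgebra.mem_top x)

end ChevalleySystem

theorem FreeLieAlgebra.lieSpan_range_of (X : Type*) :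
    LieSubalgebra.lieSpan ℂ (FreeLieAlgebra ℂ X) (Set.range (FreeLieAlgebra.of ℂ)) = ⊤ := by
  set K := LieSubalgebra.lieSpan ℂ (FreeLieAlgebra ℂ X) (Set.range (FreeLieAlgebra.of ℂ))
  let g : FreeLieAlgebra ℂ X →ₗ⁅ℂ⁆ K := FreeLieAlgebra.lift ℂ fun x =>
    ⟨FreeLieAlgebra.of ℂ x, LieSubalgebra.subset_lieSpan ⟨x, rfl⟩⟩
  have h : K.incl.comp g = LieHom.id := by
    refine FreeLieAlgebra.hom_ext fun x => ?_
    simp [g]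
  rw [eq_top_iff]
  intro y _
  have := LieHom.congr_fun h y
  rw [LieHom.id_apply] at this
  rw [← this]
  exact (g y).2

/-- The projection of a Lie algebra onto its quotient by an ideal. -/
def quotientHom (J : LieIdeal ℂ L) : L →ₗ⁅ℂ⁆ L ⧸ J where
  toFun := LieSubmodule.Quotient.mk
  map_add' _ _ := rfl
  map_smul' _ _ := rfl
  map_lie' := rfl

theorem quotientHom_surjective (J : LieIdeal ℂ L) : Function.Surjective (quotientHom J) :=
  LieSubmodule.Quotient.surjective_mk' J

theorem Aux.mk_relator {x : Free l H} (hx : Relator D x) : Aux.mk D x = 0 :=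
  (LieSubmodule.Quotient.mk_eq_zero' ..).2 (LieSubmodule.subset_lieSpan hx)

variable (D) in
/-- The auxiliary Lie algebra with its generators. -/
noncomputable def auxSystem : ChevalleySystem D (Aux D) where
  h :=
    { toFun := fun x => Aux.mk D (Free.h l x)
      map_add' := fun x y => by
        have h := Aux.mk_relator (Relator.add (D := D) x y)
        rw [sub_sub] at h
        exact sub_eq_zero.1 h
      map_smul' := fun c x => sub_eq_zero.1 (Aux.mk_relator (Relator.smul (D := D) c x)) }
  e i := Aux.mk D (Free.e H i)
  f i := Aux.mk D (Free.f H i)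
  lie_h_h x y := Aux.mk_relator (Relator.hh (D := D) x y)
  lie_h_e x i := sub_eq_zero.1 (Aux.mk_relator (Relator.he (D := D) x i))
  lie_h_f x i := eq_neg_of_add_eq_zero_left (Aux.mk_relator (Relator.hf (D := D) x i))
  lie_e_f i := sub_eq_zero.1 (Aux.mk_relator (Relator.ef (D := D) i))
  lie_e_f_ne i j hij := Aux.mk_relator (Relator.ef_ne (D := D) i j hij)
  lieSpan_eq_top := by
    set K := LieSubalgebra.lieSpan ℂ (Aux D) _
    have h : LieSubalgebra.lieSpan ℂ (Free l H) (Set.range (FreeLieAlgebra.of ℂ)) ≤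
        K.comap (quotientHom _) := by
      rw [LieSubalgebra.lieSpan_le]
      rintro _ ⟨y | i | i, rfl⟩
      · exact LieSubalgebra.subset_lieSpan (Or.inl ⟨y, rfl⟩)
      · exact LieSubalgebra.subset_lieSpan (Or.inr (Or.inl ⟨i, rfl⟩))
      · exact LieSubalgebra.subset_lieSpan (Or.inr (Or.inr ⟨i, rfl⟩))
    rw [FreeLieAlgebra.lieSpan_range_of] at h
    rw [eq_top_iff]
    intro y _
    obtain ⟨x, rfl⟩ := quotientHom_surjective _ y
    exact h (LieSubalgebra.mem_top x)

variable (D) in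
/-- The Kac–Moody algebra with its generators. -/
noncomputable def algSystem : ChevalleySystem D (Alg D) :=
  (auxSystem D).map (quotientHom _) (quotientHom_surjective _)

theorem mem_radical_of_ideal {J : LieIdeal ℂ (Aux D)}
    (hJ : J.toSubmodule ⊓ LinearMap.range (auxSystem D).h = ⊥) : J ≤ Aux.radical D := by
  refine le_sSup ?_
  have h : Aux.cartan D = LinearMap.range (auxSystem D).h := by
    unfold Aux.cartan
    exact Submodule.span_eq (LinearMap.range (auxSystem D).h)
  change J.toSubmodule ⊓ Aux.cartan D = ⊥
  rw [h, hJ]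

theorem quotientHom_toEnd_pow (J : LieIdeal ℂ L) (x y : L) (n : ℕ) :
    quotientHom J ((LieModule.toEnd ℂ L L x ^ n) y) =
      (LieModule.toEnd ℂ (L ⧸ J) (L ⧸ J) (quotientHom J x) ^ n) (quotientHom J y) := by
  induction n with
  | zero => rfl
  | succ n ih =>
    rw [pow_succ', pow_succ', Module.End.mul_apply, Module.End.mul_apply,
      LieModule.toEnd_apply_apply, LieModule.toEnd_apply_apply, LieHom.map_lie, ih]

theorem engel_fElt (i : Fin l) : LieSubalgebra.engel ℂ (fElt D i) = ⊤ := by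
  refine (algSystem D).engel_f_eq_top i fun j hij => ?_
  obtain ⟨n, hn⟩ := ChevalleySystem.exists_cartan_eq_neg (D := D) hij
  obtain ⟨J, hJ, hJ'⟩ := (auxSystem D).exists_ideal_serre hij hn
  refine ⟨n + 1, ?_⟩
  have := (LieSubmodule.Quotient.mk_eq_zero' ..).2 (mem_radical_of_ideal hJ' hJ)
  exact (quotientHom_toEnd_pow _ _ _ _).symm.trans this

theorem engel_eElt (i : Fin l) : LieSubalgebra.engel ℂ (eElt D i) = ⊤ := by
  refine (algSystem D).symm.engel_f_eq_top i fun j hij => ?_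
  obtain ⟨n, hn⟩ := ChevalleySystem.exists_cartan_eq_neg (D := D) hij
  obtain ⟨J, hJ, hJ'⟩ := (auxSystem D).symm.exists_ideal_serre hij hn
  refine ⟨n + 1, ?_⟩
  have hr : LinearMap.range (auxSystem D).symm.h = LinearMap.range (auxSystem D).h :=
    LinearMap.range_neg _
  have := (LieSubmodule.Quotient.mk_eq_zero' ..).2 (mem_radical_of_ideal (hr ▸ hJ') hJ)
  exact (quotientHom_toEnd_pow _ _ _ _).symm.trans this

variable (D) in
/-- `𝔤'` is generated by the `e_i` and `f_i`: the subalgebra `K` that they generate is an ideal with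
`K + 𝔥 = 𝔤`, and `𝔥` is commutative. -/
theorem lieSpan_e_f_eq_derived :
    LieSubalgebra.lieSpan ℂ (Alg D) (Set.range (eElt D) ∪ Set.range (fElt D)) =
      LieIdeal.toLieSubalgebra ℂ (Alg D) (derived D) := by
  set K := LieSubalgebra.lieSpan ℂ (Alg D) (Set.range (eElt D) ∪ Set.range (fElt D)) with hK
  have he : ∀ i, eElt D i ∈ K := fun i => LieSubalgebra.subset_lieSpan (Or.inl ⟨i, rfl⟩)
  have hf : ∀ i, fElt D i ∈ K := fun i => LieSubalgebra.subset_lieSpan (Or.inr ⟨i, rfl⟩)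
  have hh : ∀ y, ∀ x ∈ K, ⁅hElt D y, x⁆ ∈ K := by
    intro y x hx
    rw [hK] at hx
    induction hx using LieSubalgebra.lieSpan_induction with
    | mem x hx =>
      rcases hx with ⟨i, rfl⟩ | ⟨i, rfl⟩
      · rw [hElt_lie_eElt]; exact K.smul_mem _ (he i)
      · rw [hElt_lie_fElt]; exact neg_mem (K.smul_mem _ (hf i))
    | zero => simp
    | smul c x _ hx => rw [lie_smul]; exact K.smul_mem _ hx
    | add x y _ _ hx hy => rw [lie_add]; exact add_mem hx hy
    | lie x z hx' hz' hx hz =>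
      rw [leibniz_lie]
      exact add_mem (K.lie_mem hx hz') (K.lie_mem hx' hz)
  have hI : ∀ y : Alg D, ∀ x ∈ K, ⁅y, x⁆ ∈ K := fun y =>
    (algSystem D).lie_mem_of_generators K.toSubmodule hh (fun i x hx => K.lie_mem (he i) hx)
      (fun i x hx => K.lie_mem (hf i) hx) y
  -- `K` and the image of `H` together span the whole algebra
  have hsup : K.toSubmodule ⊔ cartan D = ⊤ := by
    set S := K.toSubmodule ⊔ cartan D
    have hS : ∀ x ∈ S, ∃ k ∈ K, ∃ z, x = k + hElt D z := by
      intro x hx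
      obtain ⟨k, hk, _, ⟨z, rfl⟩, rfl⟩ := Submodule.mem_sup.1 hx
      exact ⟨k, hk, z, rfl⟩
    let S' : LieSubalgebra ℂ (Alg D) :=
      { S with
        lie_mem' := by
          intro x y hx hy
          obtain ⟨k, hk, z, rfl⟩ := hS x hx
          obtain ⟨k', hk', z', rfl⟩ := hS y hy
          refine Submodule.mem_sup_left ?_
          rw [lie_add, add_lie _ _ (hElt D z'), hElt_lie_hElt, add_zero, ← lie_skew k]
          exact add_mem (hI _ _ hk') (neg_mem (hI _ _ hk)) }
    have h : (⊤ : LieSubalgebra ℂ (Alg D)) ≤ S' := by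
      rw [← (algSystem D).lieSpan_eq_top, LieSubalgebra.lieSpan_le]
      rintro _ (⟨y, rfl⟩ | ⟨i, rfl⟩ | ⟨i, rfl⟩)
      · exact Submodule.mem_sup_right ⟨y, rfl⟩
      · exact Submodule.mem_sup_left (he i)
      · exact Submodule.mem_sup_left (hf i)
    exact eq_top_iff.2 fun x _ => h (LieSubalgebra.mem_top x)
  refine le_antisymm ?_ ?_
  · rw [LieSubalgebra.lieSpan_le]
    rintro _ (⟨i, rfl⟩ | ⟨i, rfl⟩)
    · exact eElt_mem_derived D i
    · exact fElt_mem_derived D i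
  · let KI : LieIdeal ℂ (Alg D) := { K.toSubmodule with lie_mem := fun {y x} hx => hI y x hx }
    have : derived D ≤ KI := by
      refine (LieSubmodule.lie_le_iff _ _ _).2 fun x _ y _ => ?_
      obtain ⟨k, hk, _, ⟨z, rfl⟩, rfl⟩ :=
        Submodule.mem_sup.1 (hsup ▸ Submodule.mem_top : x ∈ K.toSubmodule ⊔ cartan D)
      obtain ⟨k', hk', _, ⟨z', rfl⟩, rfl⟩ :=
        Submodule.mem_sup.1 (hsup ▸ Submodule.mem_top : y ∈ K.toSubmodule ⊔ cartan D)
      change ⁅k + hElt D z, k' + hElt D z'⁆ ∈ K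
      rw [lie_add, add_lie _ _ (hElt D z'), hElt_lie_hElt, add_zero, ← lie_skew k]
      exact add_mem (hI _ _ hk') (neg_mem (hI _ _ hk))
    exact this

/-- Induction principle for `𝔤'`, which is generated by the `e_i` and `f_i`. -/
theorem derived_induction {p : derived D → Prop} (he : ∀ i, p (e' D i)) (hf : ∀ i, p (f' D i))
    (zero : p 0) (add : ∀ x y, p x → p y → p (x + y)) (smul : ∀ (c : ℂ) x, p x → p (c • x))
    (lie : ∀ x y, p x → p y → p ⁅x, y⁆) (x : derived D) : p x := by
  have key : ∀ y : Alg D, y ∈ LieSubalgebra.lieSpan ℂ (Alg D)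
      (Set.range (eElt D) ∪ Set.range (fElt D)) → ∃ h : y ∈ derived D, p ⟨y, h⟩ := by
    intro y hy
    induction hy using LieSubalgebra.lieSpan_induction with
    | mem y hy =>
      rcases hy with ⟨i, rfl⟩ | ⟨i, rfl⟩
      · exact ⟨_, he i⟩
      · exact ⟨_, hf i⟩
    | zero => exact ⟨zero_mem _, zero⟩
    | smul c y _ hy => exact ⟨_, smul c _ hy.choose_spec⟩
    | add y z _ _ hy hz => exact ⟨_, add _ _ hy.choose_spec hz.choose_spec⟩
    | lie y z _ _ hy hz => exact ⟨_, lie _ _ hy.choose_spec hz.choose_spec⟩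
  obtain ⟨_, h⟩ := key x (by rw [lieSpan_e_f_eq_derived]; exact x.2)
  exact h

end Serre

/-! ### Actions of the current algebra of `sl₂` -/

section Current

variable {A : Type*} [CommRing A] [Algebra ℂ A] {V : Type*} [AddCommGroup V] [Module ℂ V]

/-- The part of the relations of `sl₂ ⊗ A` on a vector space that involves the lowering operators:
`E a`, `F a`, `K a` stand for the actions of `e ⊗ a`, `f ⊗ a`, `h ⊗ a`. -/
structure IsCurrentAction (E F K : A →ₗ[ℂ] Module.End ℂ V) : Prop where
  e_f : ∀ a b w, E a (F b w) = F b (E a w) + K (a * b) w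
  h_f : ∀ a b w, K a (F b w) = F b (K a w) - (2 : ℂ) • F (a * b) w
  f_f : ∀ a b w, F a (F b w) = F b (F a w)

namespace IsCurrentAction

variable {E F K : A →ₗ[ℂ] Module.End ℂ V}

/-- If an operator `G` kills all products of `j` lowering operators applied to `u`, it also kills
those with a factor `h ⊗ c` inserted. -/
theorem apply_insert_eq_zero (hc : IsCurrentAction E F K) {u : V} {c : A} {χ : ℂ}
    (hu : K c u = χ • u) {G : Module.End ℂ V} {j : ℕ}
    (hG : ∀ L : List A, L.length = j → G ((L.map F).prod u) = 0) (L L₀ : List A)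
    (hL : L₀.length + L.length = j) : G ((L₀.map F).prod (K c ((L.map F).prod u))) = 0 := by
  induction L generalizing L₀ with
  | nil => simp [hu, hG L₀ (by simpa using hL)]
  | cons b L ih =>
    have h1 := ih (L₀ ++ [b]) (by simp at hL ⊢; omega)
    have h2 := hG (L₀ ++ (c * b) :: L) (by simp at hL ⊢; omega)
    simp only [List.map_append, List.map_cons, List.map_nil, List.prod_append, List.prod_cons,
      List.prod_nil, mul_one, Module.End.mul_apply] at h1 h2 ⊢
    rw [hc.h_f, map_sub, map_sub, map_smul, map_smul, h1, h2, smul_zero, sub_zero]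

theorem f_pow_comm (hc : IsCurrentAction E F K) (a b : A) (r : ℕ) (w : V) :
    F a ((F b ^ r) w) = (F b ^ r) (F a w) := by
  have h : Commute (F a) (F b) := LinearMap.ext fun w => hc.f_f a b w
  exact LinearMap.congr_fun (h.pow_right r).eq w

theorem h_f_pow (hc : IsCurrentAction E F K) (c : A) (r : ℕ) (w : V) :
    K c ((F 1 ^ (r + 1)) w) =
      (F 1 ^ (r + 1)) (K c w) - (2 * ((r : ℂ) + 1)) • (F 1 ^ r) (F c w) := by
  induction r with
  | zero => simp [hc.h_f]
  | succ r ih =>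
    have e : ∀ n w, F 1 ((F 1 ^ n) w) = (F 1 ^ (n + 1)) w := fun n w => by
      rw [pow_succ', Module.End.mul_apply]
    rw [← e, hc.h_f, ih, map_sub, map_smul, mul_one, e, e, hc.f_pow_comm c, sub_sub, ← add_smul]
    congr 2
    push_cast
    ring

/-- If `(f ⊗ 1)^k` kills a weight vector then so do all products of `k` operators `f ⊗ b`.
The operators `h ⊗ c` polarize: the product with factors `b_1, …, b_j, 1, …, 1` is obtained from
those with fewer factors different from `1`. -/
theorem prod_eq_zero (hc : IsCurrentAction E F K) {u : V} {χ : A → ℂ} (hu : ∀ c, K c u = χ c • u)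
    {k : ℕ} (hk : (F 1 ^ k) u = 0) (L : List A) (hL : L.length = k) : (L.map F).prod u = 0 := by
  have claim : ∀ j r, j + r = k → ∀ L : List A, L.length = j →
      (F 1 ^ r) ((L.map F).prod u) = 0 := by
    intro j
    induction j with
    | zero =>
      intro r hr L hL
      obtain rfl := List.length_eq_zero_iff.1 hL
      obtain rfl : r = k := by omega
      simpa using hk
    | succ j ih =>
      intro r hr L hL
      obtain ⟨c, L, rfl⟩ := List.exists_cons_of_length_eq_add_one hL
      have hL' : L.length = j := by simpa using hL
      have h0 := ih (r + 1) (by omega)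
      have h1 := hc.h_f_pow c r ((L.map F).prod u)
      have h2 := hc.apply_insert_eq_zero (hu c) h0 L [] (by simpa using hL')
      simp only [List.map_nil, List.prod_nil, Module.End.one_apply] at h2
      rw [h0 L hL', map_zero, h2, zero_sub, eq_comm, neg_eq_zero, smul_eq_zero] at h1
      rw [List.map_cons, List.prod_cons, Module.End.mul_apply]
      refine h1.resolve_left ?_
      have : ((r : ℂ) + 1) ≠ 0 := Nat.cast_add_one_ne_zero r
      simp [this]
  simpa using claim k 0 (by omega) L hL

/-- Raising operators `e ⊗ a` with `a ∈ I` collapse a product of lowering operators to a single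
one: if `h ⊗ I` kills the highest weight vector `u`, then for `α ∈ I ^ m` some operator `T` sends
`(f ⊗ b_0) ⋯ (f ⊗ b_m) u` to `(f ⊗ α b_0 ⋯ b_m) u`. -/
theorem exists_collapse (hc : IsCurrentAction E F K) {u : V} {χ : A → ℂ} {I : Ideal A}
    (he : ∀ a, E a u = 0) (hu : ∀ c, K c u = χ c • u) (hI : ∀ c ∈ I, χ c = 0) (m : ℕ) :
    ∀ α ∈ I ^ m, ∃ T : Module.End ℂ V, ∀ L : List A, L.length = m + 1 →
      T ((L.map F).prod u) = F (α * L.prod) u := by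
  induction m with
  | zero =>
    intro α _
    -- `[h ⊗ α, f ⊗ b] = -2 f ⊗ α b`
    refine ⟨(-2⁻¹ : ℂ) • (K α - χ α • 1), fun L hL => ?_⟩
    obtain ⟨b, rfl⟩ := List.length_eq_one_iff.1 (by simpa using hL)
    simp [hc.h_f, hu, smul_smul]
  | succ m ih =>
    intro α hα
    rw [pow_succ] at hα
    induction hα using Submodule.mul_induction_on' with
    | add x _ y _ hx hy =>
      obtain ⟨T, hT⟩ := hx
      obtain ⟨T', hT'⟩ := hy
      exact ⟨T + T', fun L hL => by simp [hT L hL, hT' L hL, add_mul]⟩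
    | mem_mul_mem β hβ a ha =>
      obtain ⟨T, hT⟩ := ih β hβ
      have h1 : ∀ c ∈ I, ∀ L L₀ : List A, L₀.length + L.length = m + 1 →
          T ((L₀.map F).prod (K c ((L.map F).prod u))) =
            (-2 * (L.length : ℂ)) • F (β * (c * (L₀.prod * L.prod))) u := by
        intro c hcI L
        induction L with
        | nil => intro L₀ _; simp [hu, hI c hcI]
        | cons b L ih =>
          intro L₀ hL
          have h1 := ih (L₀ ++ [b]) (by simp at hL ⊢; omega)
          have h2 := hT (L₀ ++ (c * b) :: L) (by simp at hL ⊢; omega)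
          simp only [List.map_append, List.map_cons, List.map_nil, List.prod_append,
            List.prod_cons, List.prod_nil, mul_one, Module.End.mul_apply, List.length_cons]
            at h1 h2 ⊢
          rw [hc.h_f, map_sub, map_sub, map_smul, map_smul, h1, h2,
            show c * (L₀.prod * b * L.prod) = c * (L₀.prod * (b * L.prod)) by ring,
            show L₀.prod * (c * b * L.prod) = c * (L₀.prod * (b * L.prod)) by ring, ← sub_smul]
          congr 1
          push_cast
          ring
      have h2 : ∀ L L₀ : List A, L₀.length + L.length = m + 2 →
          T ((L₀.map F).prod (E a ((L.map F).prod u))) =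
            (-((L.length : ℂ) * (L.length - 1))) • F (β * (a * (L₀.prod * L.prod))) u := by
        intro L
        induction L with
        | nil => intro L₀ _; simp [he]
        | cons b L ih =>
          intro L₀ hL
          have h3 := ih (L₀ ++ [b]) (by simp at hL ⊢; omega)
          have h4 := h1 (a * b) (I.mul_mem_right b ha) L L₀ (by simp at hL ⊢; omega)
          simp only [List.map_append, List.map_cons, List.map_nil, List.prod_append,
            List.prod_cons, List.prod_nil, mul_one, Module.End.mul_apply, List.length_cons]
            at h3 h4 ⊢
          rw [hc.e_f, map_add, map_add, h3, h4,
            show a * (L₀.prod * b * L.prod) = a * (L₀.prod * (b * L.prod)) by ring,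
            show a * b * (L₀.prod * L.prod) = a * (L₀.prod * (b * L.prod)) by ring, ← add_smul]
          congr 1
          push_cast
          ring
      have hne : -(((m : ℂ) + 1 + 1) * (m + 1)) ≠ 0 := by
        have h1 : (m : ℂ) + 1 ≠ 0 := Nat.cast_add_one_ne_zero m
        have h2 : (m : ℂ) + 1 + 1 ≠ 0 := by
          have := Nat.cast_add_one_ne_zero (R := ℂ) (m + 1)
          rwa [Nat.cast_add, Nat.cast_one] at this
        exact neg_ne_zero.2 (mul_ne_zero h2 h1)
      refine ⟨(-(((m : ℂ) + 1 + 1) * (m + 1)))⁻¹ • (T ∘ₗ E a), fun L hL => ?_⟩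
      have h3 := h2 L [] (by simpa using hL)
      simp only [List.map_nil, List.prod_nil, Module.End.one_apply, one_mul, hL] at h3
      rw [LinearMap.smul_apply, LinearMap.comp_apply, h3, smul_smul, mul_assoc]
      push_cast
      rw [show (m : ℂ) + 1 + 1 - 1 = m + 1 by ring, inv_mul_cancel₀ hne, one_smul]

/-- If `u` is a highest weight vector with `(f ⊗ 1)^(n+1) u = 0` on which `h ⊗ I` vanishes, then
`f ⊗ I ^ n` kills `u`. -/
theorem f_apply_eq_zero (hc : IsCurrentAction E F K) {u : V} {χ : A → ℂ} {I : Ideal A}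
    (he : ∀ a, E a u = 0) (hu : ∀ c, K c u = χ c • u) (hI : ∀ c ∈ I, χ c = 0) {n : ℕ}
    (hn : (F 1 ^ (n + 1)) u = 0) {a : A} (ha : a ∈ I ^ n) : F a u = 0 := by
  obtain ⟨T, hT⟩ := hc.exists_collapse he hu hI n a ha
  have := hT (List.replicate (n + 1) 1) (by simp)
  simpa [hn] using this.symm

end IsCurrentAction

end Current

/-! ### Highest weight vectors and integrability -/

section HighestWeight

open LieAlgebra LieModule

variable {l : ℕ} {H : Type*} [AddCommGroup H] [Module ℂ H] {D : Datum l H} {C : Complement D}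
variable {A : Type*} [CommRing A] [Algebra ℂ A]

variable (C A) in
/-- The linear map `a ↦ x ⊗ a`. -/
noncomputable def loopOf (x : derived D) : A →ₗ[ℂ] Loop C A :=
  (SemiDirectSum.inl (C.action A) : A ⊗[ℂ] derived D →ₗ[ℂ] Loop C A) ∘ₗ
    (TensorProduct.mk ℂ A (derived D)).flip x

theorem loopOf_apply (x : derived D) (a : A) : loopOf C A x a = Loop.of C A a x := rfl

theorem Loop.of_add (a : A) (x y : derived D) :
    Loop.of C A a (x + y) = Loop.of C A a x + Loop.of C A a y := by
  simp only [Loop.of, TensorProduct.tmul_add, map_add]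

theorem Loop.of_smul (a : A) (c : ℂ) (x : derived D) :
    Loop.of C A a (c • x) = c • Loop.of C A a x := by
  simp only [Loop.of, TensorProduct.tmul_smul, map_smul]

theorem Loop.of_zero (a : A) : Loop.of C A a (0 : derived D) = 0 := by
  simp only [Loop.of, TensorProduct.tmul_zero, map_zero]

theorem lie_of_of (a b : A) (x y : derived D) :
    ⁅Loop.of C A a x, Loop.of C A b y⁆ = Loop.of C A (a * b) ⁅x, y⁆ := by
  rw [Loop.of, Loop.of, ← LieHom.map_lie]
  rfl

theorem lie_inr_inl (h : C.subalgebra) (z : A ⊗[ℂ] derived D) :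
    ⁅SemiDirectSum.inr (C.action A) h, SemiDirectSum.inl (C.action A) z⁆ =
      SemiDirectSum.inl (C.action A) (C.action A h z) := by
  ext <;> simp

theorem lie_inr_inr (h h' : C.subalgebra) :
    ⁅SemiDirectSum.inr (C.action A) h, SemiDirectSum.inr (C.action A) h'⁆ = 0 := by
  have hle : C.space ≤ cartan D := C.sup_eq ▸ le_sup_right
  have : ⁅h, h'⁆ = 0 := Subtype.ext (lie_eq_zero_of_mem_cartan (hle h.2) (hle h'.2))
  rw [← LieHom.map_lie, this, map_zero]

theorem lie_inr_of (h : C.subalgebra) (a : A) (x : derived D) :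
    ⁅SemiDirectSum.inr (C.action A) h, Loop.of C A a x⁆ = Loop.of C A a ⁅(h : Alg D), x⁆ :=
  lie_inr_inl h _

theorem inl_add_inr (y : Loop C A) :
    SemiDirectSum.inl (C.action A) y.left + SemiDirectSum.inr (C.action A) y.right = y := by
  ext <;> simp

theorem loop_induction {p : Loop C A → Prop} (of : ∀ a x, p (Loop.of C A a x))
    (inr : ∀ h, p (SemiDirectSum.inr (C.action A) h)) (add : ∀ y z, p y → p z → p (y + z))
    (y : Loop C A) : p y := by
  rw [← inl_add_inr y]
  refine add _ _ ?_ (inr _)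
  induction y.left using TensorProduct.induction_on with
  | zero =>
    have := of 0 0
    rwa [Loop.of, TensorProduct.zero_tmul] at this
  | tmul a x => exact of a x
  | add u v hu hv => rw [map_add]; exact add _ _ hu hv

/-- The element of `𝔥` corresponding to a pair in `𝔥' × 𝔥''`. -/
noncomputable def cartanSum (C : Complement D) : (cartanDerived D × C.subalgebra) →ₗ[ℂ] cartan D where
  toFun h := ⟨(h.1 : Alg D) + h.2, (cartan D).add_mem h.1.2.2
    ((C.sup_eq ▸ le_sup_right : C.space ≤ cartan D) h.2.2)⟩
  map_add' x y := Subtype.ext (by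
    change ((x.1 : Alg D) + y.1) + ((x.2 : Alg D) + y.2) = (x.1 + x.2) + (y.1 + y.2)
    abel)
  map_smul' c x := Subtype.ext (smul_add c (x.1 : Alg D) (x.2 : Alg D)).symm

variable (D) in
/-- The inclusion of `𝔥'` in `𝔤'`. -/
noncomputable def cartanIncl : cartanDerived D →ₗ[ℂ] derived D where
  toFun x := ⟨x, x.2.1⟩
  map_add' _ _ := rfl
  map_smul' _ _ := rfl

theorem loopCartanIncl_eq (t : LoopCartan C A) :
    loopCartanIncl C A t = SemiDirectSum.inl (C.action A) ((cartanIncl D).lTensor A t.1) +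
      SemiDirectSum.inr (C.action A) t.2 := rfl

theorem loopCartanIncl_tmul (a : A) (x : cartanDerived D) :
    loopCartanIncl C A (a ⊗ₜ[ℂ] x, 0) = Loop.of C A a (cartanIncl D x) := by
  rw [loopCartanIncl_eq, map_zero, add_zero, LinearMap.lTensor_tmul]
  rfl

theorem loopCartanIncl_inr (h : C.subalgebra) :
    loopCartanIncl C A (0, h) = SemiDirectSum.inr (C.action A) h := by
  rw [loopCartanIncl_eq, map_zero, map_zero, zero_add]

theorem loopCartanIncl_add (s t : LoopCartan C A) :
    loopCartanIncl C A (s + t) = loopCartanIncl C A s + loopCartanIncl C A t := by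
  simp only [loopCartanIncl_eq, Prod.fst_add, Prod.snd_add, map_add]
  abel

theorem loopCartanIncl_cartan (h : cartanDerived D × C.subalgebra) :
    loopCartanIncl C A (cartanToLoopCartan C A h) =
      Loop.of C A 1 (cartanIncl D h.1) + SemiDirectSum.inr (C.action A) h.2 := by
  rw [← loopCartanIncl_tmul, ← loopCartanIncl_inr, ← loopCartanIncl_add]
  simp [cartanToLoopCartan]

theorem lie_cartan_of (h : cartanDerived D × C.subalgebra) (a : A) (x : derived D) :
    ⁅loopCartanIncl C A (cartanToLoopCartan C A h), Loop.of C A a x⁆ =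
      Loop.of C A a ⁅(cartanSum C h : Alg D), x⁆ := by
  rw [loopCartanIncl_cartan, add_lie, lie_inr_of, lie_of_of, one_mul, ← Loop.of_add]
  congr 1
  exact Subtype.ext (add_lie _ _ _).symm

theorem lie_cartan_inr (h : cartanDerived D × C.subalgebra) (h' : C.subalgebra) :
    ⁅loopCartanIncl C A (cartanToLoopCartan C A h), SemiDirectSum.inr (C.action A) h'⁆ = 0 := by
  have hle : C.space ≤ cartan D := C.sup_eq ▸ le_sup_right
  have h0 : ⁅(h' : Alg D), cartanIncl D h.1⁆ = 0 :=
    Subtype.ext (lie_eq_zero_of_mem_cartan (hle h'.2) h.1.2.2)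
  rw [loopCartanIncl_cartan, add_lie, lie_inr_inr, add_zero, ← lie_skew, lie_inr_of, h0,
    Loop.of_zero, neg_zero]

variable (D) in
/-- `𝔤'` is spanned by eigenvectors for `𝔥`. -/
theorem span_weight_derived (C : Complement D) (x : derived D) :
    x ∈ Submodule.span ℂ {x : derived D | ∃ μ : Module.Dual ℂ (cartanDerived D × C.subalgebra),
      ∀ h, ⁅(cartanSum C h : Alg D), x⁆ = μ h • x} := by
  set S := Submodule.span ℂ {x : derived D | ∃ μ : Module.Dual ℂ (cartanDerived D × C.subalgebra),
      ∀ h, ⁅(cartanSum C h : Alg D), x⁆ = μ h • x}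
  -- a linear section of `H → 𝔥` turns linear forms on `H` into linear forms on `𝔥`
  obtain ⟨s, hs⟩ := (hMap D).rangeRestrict.exists_rightInverse_of_surjective
    (LinearMap.range_eq_top.2 (hMap D).surjective_rangeRestrict)
  have hs' : ∀ h : cartan D, (h : Alg D) = hElt D (s h) := fun h =>
    (congrArg Subtype.val (LinearMap.congr_fun hs h)).symm
  induction x using derived_induction with
  | he i =>
    refine Submodule.subset_span ⟨D.root i ∘ₗ s ∘ₗ cartanSum C, fun h => Subtype.ext ?_⟩
    change ⁅(cartanSum C h : Alg D), eElt D i⁆ = _ • eElt D i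
    rw [hs', hElt_lie_eElt]
    rfl
  | hf i =>
    refine Submodule.subset_span ⟨-D.root i ∘ₗ s ∘ₗ cartanSum C, fun h => Subtype.ext ?_⟩
    change ⁅(cartanSum C h : Alg D), fElt D i⁆ = _ • fElt D i
    rw [hs', hElt_lie_fElt, ← neg_smul]
    rfl
  | zero => exact S.zero_mem
  | add x y hx hy => exact S.add_mem hx hy
  | smul c x hx => exact S.smul_mem c hx
  | lie x y hx hy =>
    induction hx using Submodule.span_induction with
    | mem x hx =>
      obtain ⟨μ, hμ⟩ := hx
      induction hy using Submodule.span_induction with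
      | mem y hy =>
        obtain ⟨ν, hν⟩ := hy
        refine Submodule.subset_span ⟨μ + ν, fun h => Subtype.ext ?_⟩
        have h1 : ⁅(cartanSum C h : Alg D), (x : Alg D)⁆ = μ h • (x : Alg D) :=
          congrArg Subtype.val (hμ h)
        have h2 : ⁅(cartanSum C h : Alg D), (y : Alg D)⁆ = ν h • (y : Alg D) :=
          congrArg Subtype.val (hν h)
        change ⁅(cartanSum C h : Alg D), ⁅(x : Alg D), (y : Alg D)⁆⁆ =
          (μ h + ν h) • ⁅(x : Alg D), (y : Alg D)⁆
        rw [leibniz_lie, h1, h2, smul_lie, lie_smul, add_smul]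
      | zero => rw [lie_zero]; exact S.zero_mem
      | add y z _ _ hy hz => rw [lie_add]; exact S.add_mem hy hz
      | smul c y _ hy => rw [lie_smul]; exact S.smul_mem c hy
    | zero => rw [zero_lie]; exact S.zero_mem
    | add x z _ _ hx hz => rw [add_lie]; exact S.add_mem hx hz
    | smul c x _ hx => rw [smul_lie]; exact S.smul_mem c hx

/-- Local ad-nilpotency passes from `x ∈ 𝔤'` to `x ⊗ 1`, also on `𝔥''` when `x` is a root vector. -/
theorem engel_of_eq_top {x : derived D} (hx : LieSubalgebra.engel ℂ (x : Alg D) = ⊤)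
    (hw : ∀ h ∈ cartan D, ∃ c : ℂ, ⁅h, (x : Alg D)⁆ = c • (x : Alg D)) :
    LieSubalgebra.engel ℂ (Loop.of C A 1 x) = ⊤ := by
  have hle : C.space ≤ cartan D := C.sup_eq ▸ le_sup_right
  rw [eq_top_iff]
  intro y _
  induction y using loop_induction with
  | of a y =>
    obtain ⟨n, hn⟩ := (LieSubalgebra.mem_engel_iff ℂ (x : Alg D) (y : Alg D)).1
      (hx ▸ LieSubalgebra.mem_top _)
    rw [LieSubalgebra.mem_engel_iff]
    refine ⟨n, ?_⟩
    have key : ∀ n : ℕ, ∃ z : derived D, (z : Alg D) = (ad ℂ (Alg D) (x : Alg D) ^ n) y ∧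
        (ad ℂ (Loop C A) (Loop.of C A 1 x) ^ n) (Loop.of C A a y) = Loop.of C A a z := by
      intro n
      induction n with
      | zero => exact ⟨y, rfl, rfl⟩
      | succ n ih =>
        obtain ⟨z, hz, hz'⟩ := ih
        refine ⟨⁅x, z⁆, ?_, ?_⟩
        · rw [pow_succ', Module.End.mul_apply, ← hz]
          rfl
        · rw [pow_succ', Module.End.mul_apply, hz', ad_apply, lie_of_of, one_mul]
    obtain ⟨z, hz, hz'⟩ := key n
    have : z = 0 := Subtype.ext (hz.trans hn)
    rw [hz', this, Loop.of_zero]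
  | inr h =>
    rw [LieSubalgebra.mem_engel_iff]
    refine ⟨2, ?_⟩
    obtain ⟨c, hc⟩ := hw h (hle h.2)
    have hc' : ⁅(h : Alg D), x⁆ = c • x := Subtype.ext hc
    rw [pow_two, Module.End.mul_apply, ad_apply, ad_apply, ← lie_skew _ (SemiDirectSum.inr _ h),
      lie_inr_of, hc', Loop.of_smul, lie_neg, lie_smul, lie_self, smul_zero, neg_zero]
  | add y z hy hz => exact add_mem (hy trivial) (hz trivial)

theorem engel_of_e' (i : Fin l) : LieSubalgebra.engel ℂ (Loop.of C A 1 (e' D i)) = ⊤ :=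
  engel_of_eq_top (engel_eElt i) (by
    rintro _ ⟨y, rfl⟩
    exact ⟨_, hElt_lie_eElt D y i⟩)

theorem engel_of_f' (i : Fin l) : LieSubalgebra.engel ℂ (Loop.of C A 1 (f' D i)) = ⊤ :=
  engel_of_eq_top (engel_fElt i) (by
    rintro _ ⟨y, rfl⟩
    exact ⟨-D.root i y, by rw [neg_smul]; exact hElt_lie_fElt D y i⟩)

theorem eElt_mem_nPlus (i : Fin l) : eElt D i ∈ nPlus D := by
  by_cases h0 : eElt D i = 0
  · rw [h0]
    exact Submodule.zero_mem _
  have h1 : eElt D i ∈ rootSpace D (weight D (Pi.single i 1)) := by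
    rw [weight_single]
    exact (algSystem D).e_mem_wtSpace i
  refine (le_iSup₂_of_le (f := fun m (_ : IsPosRoot D m) => rootSpace D (weight D m))
    (Pi.single i 1) ⟨?_, fun h => h0 ?_⟩ le_rfl) h1
  · intro h
    simpa using congrFun h i
  · rw [h] at h1
    exact h1

/-- The simple coroot `α_i^∨` as an element of `𝔤'`. -/
noncomputable def h' (D : Datum l H) (i : Fin l) : derived D := cartanIncl D (coroot' D i)

theorem lie_e'_f' (i : Fin l) : ⁅e' D i, f' D i⁆ = h' D i := Subtype.ext (eElt_lie_fElt D i)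

theorem lie_h'_f' (i : Fin l) : ⁅h' D i, f' D i⁆ = (-2 : ℂ) • f' D i := by
  refine Subtype.ext ?_
  change ⁅hElt D (D.coroot i), fElt D i⁆ = (-2 : ℂ) • fElt D i
  rw [hElt_lie_fElt, D.root_coroot, D.cartan_diag, ← neg_smul]
  norm_num

section Module

variable {V : Type*} [AddCommGroup V] [Module ℂ V] [LieRingModule (Loop C A) V]

/-- A vector killed by `N⁺ ⊗ A` on which `𝔥' ⊗ A ⊕ 𝔥''` acts by `ψ`. -/
structure IsHighestWeight (ψ : LoopCartan C A →ₗ[ℂ] ℂ) (v : V) : Prop where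
  nPlus : ∀ (a : A) (x : derived D), (x : Alg D) ∈ nPlus D → ⁅Loop.of C A a x, v⁆ = 0
  cartan : ∀ t, ⁅loopCartanIncl C A t, v⁆ = ψ t • v

namespace IsHighestWeight

variable {ψ : LoopCartan C A →ₗ[ℂ] ℂ} {v : V}

theorem lie_e' (hv : IsHighestWeight ψ v) (i : Fin l) (a : A) : ⁅Loop.of C A a (e' D i), v⁆ = 0 :=
  hv.nPlus a _ (eElt_mem_nPlus i)

theorem lie_h' (hv : IsHighestWeight ψ v) (i : Fin l) (a : A) :
    ⁅Loop.of C A a (h' D i), v⁆ = ψ (a ⊗ₜ[ℂ] coroot' D i, 0) • v := by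
  rw [← hv.cartan, loopCartanIncl_tmul]
  rfl

theorem lie_inr (hv : IsHighestWeight ψ v) (h : C.subalgebra) :
    ⁅SemiDirectSum.inr (C.action A) h, v⁆ = ψ (0, h) • v := by
  rw [← hv.cartan, loopCartanIncl_inr]

end IsHighestWeight

variable [LieModule ℂ (Loop C A) V]

variable (C A V) in
/-- The action of `x ⊗ a` on a module, as a linear function of `a`. -/
noncomputable def current (x : derived D) : A →ₗ[ℂ] Module.End ℂ V :=
  (toEnd ℂ (Loop C A) V : Loop C A →ₗ[ℂ] Module.End ℂ V) ∘ₗ loopOf C A x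

theorem current_apply (x : derived D) (a : A) (w : V) :
    current C A V x a w = ⁅Loop.of C A a x, w⁆ := rfl

theorem isCurrentAction (i : Fin l) :
    IsCurrentAction (current C A V (e' D i)) (current C A V (f' D i)) (current C A V (h' D i)) where
  e_f a b w := by
    simp only [current_apply]
    rw [leibniz_lie, lie_of_of, lie_e'_f', add_comm]
  h_f a b w := by
    simp only [current_apply]
    rw [leibniz_lie, lie_of_of, lie_h'_f', Loop.of_smul, smul_lie, neg_smul, add_comm,
      ← sub_eq_add_neg]
  f_f a b w := by
    simp only [current_apply]
    rw [leibniz_lie, lie_of_of, lie_self, Loop.of_zero, zero_lie, zero_add]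

namespace IsHighestWeight

variable {ψ : LoopCartan C A →ₗ[ℂ] ℂ} {v : V}

theorem corootValue_eq (ψ : LoopCartan C A →ₗ[ℂ] ℂ) (i : Fin l) :
    corootValue ψ i = ψ ((1 : A) ⊗ₜ[ℂ] coroot' D i, 0) := by
  simp [corootValue, restrict, cartanToLoopCartan]

/-- A highest weight vector on which `f_i` is nilpotent satisfies `f_i^(n+1) v = 0` with
`n = λ(α_i^∨)`. -/
theorem f_pow_eq_zero (hv : IsHighestWeight ψ v) {i : Fin l} {n : ℕ} (hn : corootValue ψ i = n)
    (hk : ∃ k, (toEnd ℂ (Loop C A) V (Loop.of C A 1 (f' D i)) ^ k) v = 0) :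
    (toEnd ℂ (Loop C A) V (Loop.of C A 1 (f' D i)) ^ (n + 1)) v = 0 := by
  classical
  have hk0 := Nat.find_spec hk
  have hmin := fun m => Nat.find_min hk (m := m)
  generalize Nat.find hk = k at hk0 hmin
  cases k with
  | zero =>
    rw [pow_zero, Module.End.one_apply] at hk0
    rw [hk0, map_zero]
  | succ p =>
    have h1 := lie_e_toEnd_f_pow_succ (M := V) (e := Loop.of C A 1 (e' D i))
      (f := Loop.of C A 1 (f' D i)) (h := Loop.of C A 1 (h' D i)) (v := v) (μ := n)
      (by rw [lie_of_of, lie_e'_f', one_mul])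
      (by rw [lie_of_of, lie_h'_f', one_mul, Loop.of_smul])
      (by rw [hv.lie_h', ← hn, corootValue_eq]) (hv.lie_e' i 1) p
    rw [hk0, lie_zero, eq_comm, smul_eq_zero, mul_eq_zero] at h1
    have h2 : (n : ℂ) - p = 0 := (h1.resolve_right (hmin p (by omega))).resolve_left
      (Nat.cast_add_one_ne_zero p)
    have h3 : n = p := by exact_mod_cast sub_eq_zero.1 h2
    rw [h3, hk0]

theorem lie_f'_eq_zero (hv : IsHighestWeight ψ v) {I : Ideal A} (hψ : VanishesOn ψ I) {i : Fin l}
    {n : ℕ} (hk : (toEnd ℂ (Loop C A) V (Loop.of C A 1 (f' D i)) ^ (n + 1)) v = 0) {a : A}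
    (ha : a ∈ I ^ n) : ⁅Loop.of C A a (f' D i), v⁆ = 0 :=
  (isCurrentAction (V := V) i).f_apply_eq_zero (χ := fun c => ψ (c ⊗ₜ[ℂ] coroot' D i, 0))
    (hv.lie_e' i) (hv.lie_h' i) (fun c hc => hψ c hc _) hk ha

/-- The defining relations of `M(ψ, I)` hold for every highest weight vector on which the `f_i` are
nilpotent: for simple roots by the collapsing argument, and in general by writing
a root vector of degree `∑ m_i α_i` as a combination of brackets of the `f_i`. -/
theorem lie_eq_zero_of_mem_pow (hv : IsHighestWeight ψ v) {I : Ideal A} (hψ : VanishesOn ψ I)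
    {n : Fin l → ℕ}
    (hk : ∀ i, (toEnd ℂ (Loop C A) V (Loop.of C A 1 (f' D i)) ^ (n i + 1)) v = 0)
    {m : Fin l → ℕ} (hm : m ≠ 0) {x : derived D} (hx : (x : Alg D) ∈ rootSpace D (-weight D m))
    {a : A} (ha : a ∈ I ^ (∑ i, m i * n i)) : ⁅Loop.of C A a x, v⁆ = 0 := by
  have hsimple : ∀ i, ∀ a ∈ I ^ n i, ⁅Loop.of C A a (f' D i), v⁆ = 0 := fun i a ha =>
    hv.lie_f'_eq_zero hψ (hk i) ha
  have hdesc : ∀ (j : Fin l) (m : Fin l → ℕ) (y : Alg D),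
      IsDescendant (fElt D) (fElt D j) (Pi.single j 1) m y →
      ∃ hy : y ∈ derived D, ∀ a ∈ I ^ (∑ i, m i * n i), ⁅Loop.of C A a ⟨y, hy⟩, v⁆ = 0 := by
    intro j m y hy
    induction hy with
    | base =>
      refine ⟨fElt_mem_derived D j, fun a ha => hsimple j a ?_⟩
      simpa [Pi.single_apply] using ha
    | @step m y i _ ih =>
      obtain ⟨hy, ih⟩ := ih
      refine ⟨lie_mem_derived D _ _, fun a ha => ?_⟩
      have hs : ∑ k, (Pi.single i 1 + m : Fin l → ℕ) k * n k = n i + ∑ k, m k * n k := by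
        simp [add_mul, Finset.sum_add_distrib, Pi.single_apply]
      rw [hs, pow_add] at ha
      have hb : (⟨⁅fElt D i, y⁆, lie_mem_derived D _ _⟩ : derived D) = ⁅f' D i, ⟨y, hy⟩⁆ := rfl
      rw [hb]
      induction ha using Submodule.mul_induction_on' with
      | mem_mul_mem b hb c hc =>
        rw [← lie_of_of, lie_lie, ih c hc, hsimple i b hb, lie_zero, lie_zero, sub_zero]
      | add b _ c _ hb hc =>
        rw [← loopOf_apply, map_add, add_lie, loopOf_apply, loopOf_apply, hb, hc, add_zero]
  have hx' := (algSystem D).wtSpace_neg_weight_le hm hx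
  have hspan : ∀ y ∈ Submodule.span ℂ {y | ∃ j, IsDescendant (fElt D) (fElt D j)
      (Pi.single j 1) m y}, ∃ hy : y ∈ derived D, ⁅Loop.of C A a ⟨y, hy⟩, v⁆ = 0 := by
    intro y hy
    induction hy using Submodule.span_induction with
    | mem y hy =>
      obtain ⟨j, hy⟩ := hy
      obtain ⟨hy', h⟩ := hdesc j m y hy
      exact ⟨hy', h a ha⟩
    | zero => exact ⟨zero_mem _, by
        rw [show (⟨0, zero_mem _⟩ : derived D) = 0 from rfl, Loop.of_zero, zero_lie]⟩
    | add y z _ _ hy hz =>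
      obtain ⟨hy, hy'⟩ := hy
      obtain ⟨hz, hz'⟩ := hz
      refine ⟨add_mem hy hz, ?_⟩
      rw [show (⟨y + z, add_mem hy hz⟩ : derived D) = ⟨y, hy⟩ + ⟨z, hz⟩ from rfl, Loop.of_add,
        add_lie, hy', hz', add_zero]
    | smul c y _ hy =>
      obtain ⟨hy, hy'⟩ := hy
      refine ⟨(derived D).smul_mem c hy, ?_⟩
      rw [show (⟨c • y, (derived D).smul_mem c hy⟩ : derived D) = c • ⟨y, hy⟩ from rfl,
        Loop.of_smul, smul_lie, hy', smul_zero]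
  exact (hspan x hx').2

/-- A module generated by a highest weight vector on which the `f_i` are nilpotent is integrable,
because the `e_i` and `f_i` are locally ad-nilpotent. -/
theorem isIntegrable (hv : IsHighestWeight ψ v) (hgen : LieSubmodule.lieSpan ℂ (Loop C A) {v} = ⊤)
    (hk : ∀ i, ∃ k, (toEnd ℂ (Loop C A) V (Loop.of C A 1 (f' D i)) ^ k) v = 0) :
    IsIntegrable C A V := by
  constructor
  · set S := Submodule.span ℂ {w : V | ∃ μ : Module.Dual ℂ (cartanDerived D × C.subalgebra),
      ∀ h, ⁅loopCartanIncl C A (cartanToLoopCartan C A h), w⁆ = μ h • w}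
    have hS : ∀ y : Loop C A, ∀ w ∈ S, ⁅y, w⁆ ∈ S := by
      intro y
      induction y using loop_induction with
      | of a x =>
        have hx := span_weight_derived D C x
        induction hx using Submodule.span_induction with
        | mem x hx =>
          intro w hw
          obtain ⟨μ, hμ⟩ := hx
          induction hw using Submodule.span_induction with
          | mem w hw =>
            obtain ⟨ν, hν⟩ := hw
            refine Submodule.subset_span ⟨μ + ν, fun h => ?_⟩
            rw [leibniz_lie, lie_cartan_of, hμ, hν, Loop.of_smul, smul_lie, lie_smul, ← add_smul]
            rfl
          | zero => rw [lie_zero]; exact S.zero_mem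
          | add w w' _ _ h h' => rw [lie_add]; exact S.add_mem h h'
          | smul c w _ h => rw [lie_smul]; exact S.smul_mem c h
        | zero => intro w _; rw [Loop.of_zero, zero_lie]; exact S.zero_mem
        | add x y _ _ hx hy =>
          intro w hw; rw [Loop.of_add, add_lie]; exact S.add_mem (hx w hw) (hy w hw)
        | smul c x _ hx => intro w hw; rw [Loop.of_smul, smul_lie]; exact S.smul_mem c (hx w hw)
      | inr h =>
        intro w hw
        induction hw using Submodule.span_induction with
        | mem w hw =>
          obtain ⟨ν, hν⟩ := hw
          refine Submodule.subset_span ⟨ν, fun h' => ?_⟩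
          rw [leibniz_lie, lie_cartan_inr, zero_lie, zero_add, hν, lie_smul]
        | zero => rw [lie_zero]; exact S.zero_mem
        | add w w' _ _ h h' => rw [lie_add]; exact S.add_mem h h'
        | smul c w _ h => rw [lie_smul]; exact S.smul_mem c h
      | add y z hy hz => intro w hw; rw [add_lie]; exact S.add_mem (hy w hw) (hz w hw)
    have hle : LieSubmodule.lieSpan ℂ (Loop C A) {v} ≤
        ({ S with lie_mem := fun {y w} hw => hS y w hw } : LieSubmodule ℂ (Loop C A) V) := by
      rw [LieSubmodule.lieSpan_le, Set.singleton_subset_iff]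
      exact Submodule.subset_span ⟨ψ ∘ₗ cartanToLoopCartan C A, fun h => hv.cartan _⟩
    rw [hgen] at hle
    exact eq_top_iff.2 fun w _ => hle (LieSubmodule.mem_top w)
  · have key : ∀ y : Loop C A, LieSubalgebra.engel ℂ y = ⊤ →
        (∃ k, (toEnd ℂ (Loop C A) V y ^ k) v = 0) →
        ∀ w, ∃ k, (toEnd ℂ (Loop C A) V y ^ k) w = 0 := by
      intro y hy hyv
      have hmem : ∀ w, w ∈ (toEnd ℂ (Loop C A) V y).maxGenEigenspace 0 ↔
          ∃ k, (toEnd ℂ (Loop C A) V y ^ k) w = 0 := fun w => by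
        rw [Module.End.mem_maxGenEigenspace]; simp
      have hle : LieSubmodule.lieSpan ℂ (Loop C A) {v} ≤
          ({ (toEnd ℂ (Loop C A) V y).maxGenEigenspace 0 with
            lie_mem := fun {z w} hw => by
              have hz : z ∈ (toEnd ℂ (Loop C A) (Loop C A) y).maxGenEigenspace 0 :=
                (hy ▸ LieSubalgebra.mem_top z : z ∈ LieSubalgebra.engel ℂ y)
              have := lie_mem_maxGenEigenspace_toEnd hz hw
              rwa [add_zero] at this } : LieSubmodule ℂ (Loop C A) V) := by
        rw [LieSubmodule.lieSpan_le, Set.singleton_subset_iff]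
        exact (hmem v).2 hyv
      rw [hgen] at hle
      exact fun w => (hmem w).1 (hle (LieSubmodule.mem_top w))
    exact fun i w => ⟨key _ (engel_of_e' i) ⟨1, by rw [pow_one]; exact hv.lie_e' i 1⟩ w,
      key _ (engel_of_f' i) (hk i) w⟩

end IsHighestWeight

end Module

end HighestWeight

/-! ### The universal property of the Weyl module -/

section Universal

open LieAlgebra LieModule

variable {l : ℕ} {H : Type*} [AddCommGroup H] [Module ℂ H] {D : Datum l H} {C : Complement D}
variable {A : Type*} [CommRing A] [Algebra ℂ A]

section Hom

variable {L : Type*} [LieRing L] {V W : Type*} [AddCommGroup V] [Module ℂ V] [LieRingModule L V]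
  [AddCommGroup W] [Module ℂ W] [LieRingModule L W]

theorem lieSpan_map_eq_top {g : V →ₗ⁅ℂ, L⁆ W} (hg : Function.Surjective g) {v : V}
    (hv : LieSubmodule.lieSpan ℂ L {v} = ⊤) : LieSubmodule.lieSpan ℂ L {g v} = ⊤ := by
  have h : LieSubmodule.lieSpan ℂ L {v} ≤ (LieSubmodule.lieSpan ℂ L {g v}).comap g := by
    rw [LieSubmodule.lieSpan_le, Set.singleton_subset_iff]
    exact LieSubmodule.subset_lieSpan (Set.mem_singleton _)
  rw [hv] at h
  rw [eq_top_iff]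
  intro w _
  obtain ⟨x, rfl⟩ := hg w
  exact h (LieSubmodule.mem_top x)

/-- A property of vectors that defines a submodule holds everywhere if it holds for a generator. -/
theorem cyclic_induction {v : V} (hv : LieSubmodule.lieSpan ℂ L {v} = ⊤) {p : V → Prop} (mem : p v)
    (zero : p 0) (add : ∀ x y, p x → p y → p (x + y)) (smul : ∀ (c : ℂ) x, p x → p (c • x))
    (lie : ∀ (y : L) x, p x → p ⁅y, x⁆) (w : V) : p w := by
  have hw : w ∈ LieSubmodule.lieSpan ℂ L {v} := hv ▸ LieSubmodule.mem_top w
  induction hw using LieSubmodule.lieSpan_induction with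
  | mem x hx => exact hx ▸ mem
  | zero => exact zero
  | add x y _ _ hx hy => exact add x y hx hy
  | smul c x _ hx => exact smul c x hx
  | lie y x _ hx => exact lie y x hx

variable [LieAlgebra ℂ L] [LieModule ℂ L V] [LieModule ℂ L W]

theorem map_toEnd_pow (g : V →ₗ⁅ℂ, L⁆ W) (y : L) (k : ℕ) (v : V) :
    g ((toEnd ℂ L V y ^ k) v) = (toEnd ℂ L W y ^ k) (g v) := by
  induction k with
  | zero => rfl
  | succ k ih =>
    rw [pow_succ', pow_succ', Module.End.mul_apply, Module.End.mul_apply, toEnd_apply_apply,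
      toEnd_apply_apply, LieModuleHom.map_lie, ih]

end Hom

theorem IsHighestWeight.map {V W : Type*} [AddCommGroup V] [Module ℂ V]
    [LieRingModule (Loop C A) V] [LieModule ℂ (Loop C A) V] [AddCommGroup W] [Module ℂ W]
    [LieRingModule (Loop C A) W] [LieModule ℂ (Loop C A) W] {ψ : LoopCartan C A →ₗ[ℂ] ℂ} {v : V}
    (hv : IsHighestWeight ψ v) (g : V →ₗ⁅ℂ, Loop C A⁆ W) : IsHighestWeight ψ (g v) where
  nPlus a x hx := by rw [← LieModuleHom.map_lie, hv.nPlus a x hx, map_zero]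
  cartan t := by rw [← LieModuleHom.map_lie, hv.cartan, map_smul]

section Verma

variable (ψ : LoopCartan C A →ₗ[ℂ] ℂ)

theorem Verma.smul_vec (u : UniversalEnvelopingAlgebra ℂ (Loop C A)) :
    u • Verma.vec ψ = Submodule.Quotient.mk (p := vermaIdeal ψ) u := by
  change Submodule.Quotient.mk (p := vermaIdeal ψ) (u • 1) = _
  rw [smul_eq_mul, mul_one]

theorem Verma.isHighestWeight_vec : IsHighestWeight ψ (Verma.vec ψ) where
  nPlus a x hx := by
    rw [Verma.lie_def, Verma.smul_vec]
    exact (Submodule.Quotient.mk_eq_zero _).2 (Submodule.subset_span (Or.inl ⟨a, x, hx, rfl⟩))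
  cartan t := by
    rw [Verma.lie_def, ← algebraMap_smul (UniversalEnvelopingAlgebra ℂ (Loop C A)) (ψ t),
      ← sub_eq_zero, ← sub_smul, Verma.smul_vec]
    exact (Submodule.Quotient.mk_eq_zero _).2 (Submodule.subset_span (Or.inr ⟨t, rfl⟩))

attribute [local instance 100] LieRing.ofAssociativeRing in
theorem Verma.lieSpan_vec : LieSubmodule.lieSpan ℂ (Loop C A) {Verma.vec ψ} = ⊤ := by
  set N := LieSubmodule.lieSpan ℂ (Loop C A) {Verma.vec ψ}
  let S : Subalgebra ℂ (UniversalEnvelopingAlgebra ℂ (Loop C A)) :=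
    { carrier := {u | ∀ w ∈ N, u • w ∈ N}
      mul_mem' := fun {u u'} hu hu' w hw => by
        rw [mul_smul]
        exact hu _ (hu' w hw)
      add_mem' := fun {u u'} hu hu' w hw => by
        rw [add_smul]
        exact N.add_mem (hu w hw) (hu' w hw)
      algebraMap_mem' := fun c w hw => by
        rw [algebraMap_smul]
        exact N.smul_mem c hw }
  have hι : ∀ x, UniversalEnvelopingAlgebra.ι ℂ x ∈ S := fun x w hw => N.lie_mem hw
  -- the canonical map factors through `S`, so that `S` is the whole enveloping algebra
  let g : Loop C A →ₗ⁅ℂ⁆ S :=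
    { toFun := fun x => ⟨UniversalEnvelopingAlgebra.ι ℂ x, hι x⟩
      map_add' := fun x y => Subtype.ext (map_add _ x y)
      map_smul' := fun c x => Subtype.ext (map_smul _ c x)
      map_lie' := fun {x y} => Subtype.ext ((UniversalEnvelopingAlgebra.ι ℂ).map_lie x y) }
  have hg : S.val.comp (UniversalEnvelopingAlgebra.lift ℂ g) = AlgHom.id ℂ _ := by
    refine UniversalEnvelopingAlgebra.hom_ext ℂ (LieHom.ext fun x => ?_)
    change ((UniversalEnvelopingAlgebra.lift ℂ g (UniversalEnvelopingAlgebra.ι ℂ x) : S) :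
      UniversalEnvelopingAlgebra ℂ (Loop C A)) = UniversalEnvelopingAlgebra.ι ℂ x
    rw [UniversalEnvelopingAlgebra.lift_ι_apply]
    rfl
  rw [eq_top_iff]
  intro w _
  obtain ⟨u, rfl⟩ := Submodule.Quotient.mk_surjective (vermaIdeal ψ) w
  have hu : u ∈ S := by
    have := DFunLike.congr_fun hg u
    rw [AlgHom.id_apply] at this
    rw [← this]
    exact (UniversalEnvelopingAlgebra.lift ℂ g u).2
  have := hu _ (LieSubmodule.subset_lieSpan (Set.mem_singleton (Verma.vec ψ)))
  rwa [Verma.smul_vec] at this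

attribute [local instance 100] LieRing.ofAssociativeRing in
/-- The universal property of the Verma module. The target is a vector space with a representation
`σ` rather than a Lie module, since one space will carry several actions. -/
theorem Verma.exists_lift {V : Type*} [AddCommGroup V] [Module ℂ V]
    (σ : Loop C A →ₗ[ℂ] Module.End ℂ V)
    (hσ : ∀ x y w, σ ⁅x, y⁆ w = σ x (σ y w) - σ y (σ x w)) {u : V}
    (hN : ∀ (a : A) (x : derived D), (x : Alg D) ∈ nPlus D → σ (Loop.of C A a x) u = 0)
    (hC : ∀ t, σ (loopCartanIncl C A t) u = ψ t • u) :
    ∃ Φ : Verma ψ →ₗ[ℂ] V, Φ (Verma.vec ψ) = u ∧ ∀ x w, Φ ⁅x, w⁆ = σ x (Φ w) := by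
  let σ' : Loop C A →ₗ⁅ℂ⁆ Module.End ℂ V :=
    { σ with map_lie' := fun {x y} => LinearMap.ext fun w => hσ x y w }
  let g := UniversalEnvelopingAlgebra.lift ℂ σ'
  have hg : ∀ x, g (UniversalEnvelopingAlgebra.ι ℂ x) = σ x := fun x =>
    UniversalEnvelopingAlgebra.lift_ι_apply ℂ σ' x
  let _ : Module (UniversalEnvelopingAlgebra ℂ (Loop C A)) V := Module.compHom V g.toRingHom
  have hsmul : ∀ r (w : V), r • w = g r w := fun _ _ => rfl
  have hle : vermaIdeal ψ ≤ LinearMap.ker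
      (LinearMap.toSpanSingleton (UniversalEnvelopingAlgebra ℂ (Loop C A)) V u) := by
    refine Submodule.span_le.2 ?_
    rintro _ (⟨a, x, hx, rfl⟩ | ⟨t, rfl⟩)
    · rw [SetLike.mem_coe, LinearMap.mem_ker, LinearMap.toSpanSingleton_apply, hsmul, hg, hN a x hx]
    · rw [SetLike.mem_coe, LinearMap.mem_ker, LinearMap.toSpanSingleton_apply, hsmul, map_sub, hg,
        AlgHom.commutes, LinearMap.sub_apply, hC, Module.algebraMap_end_apply, sub_self]
  let Ψ : Verma ψ →ₗ[UniversalEnvelopingAlgebra ℂ (Loop C A)] V := (vermaIdeal ψ).liftQ _ hle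
  refine ⟨{ toFun := Ψ, map_add' := map_add Ψ, map_smul' := fun c w => ?_ }, ?_, fun x w => ?_⟩
  · rw [← algebraMap_smul (UniversalEnvelopingAlgebra ℂ (Loop C A)) c w, map_smul, hsmul,
      AlgHom.commutes, Module.algebraMap_end_apply]
    rfl
  · change (1 : UniversalEnvelopingAlgebra ℂ (Loop C A)) • u = u
    exact one_smul _ u
  · change Ψ (UniversalEnvelopingAlgebra.ι ℂ x • w) = σ x (Ψ w)
    rw [map_smul, hsmul, hg]

end Verma

variable (ψ : LoopCartan C A →ₗ[ℂ] ℂ) (I : Ideal A)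

/-- The generating vector of `M(ψ, I)`. -/
noncomputable def M.vec : M ψ I := LieSubmodule.Quotient.mk' (relSubmodule ψ I) (Verma.vec ψ)

/-- The generating vector of the Weyl module. -/
noncomputable def Weyl.vec : Weyl ψ I := LieSubmodule.Quotient.mk' (weylKernel ψ I) (M.vec ψ I)

theorem M.lieSpan_vec : LieSubmodule.lieSpan ℂ (Loop C A) {M.vec ψ I} = ⊤ :=
  lieSpan_map_eq_top (LieSubmodule.Quotient.surjective_mk' _) (Verma.lieSpan_vec ψ)

theorem M.isHighestWeight_vec : IsHighestWeight ψ (M.vec ψ I) :=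
  (Verma.isHighestWeight_vec ψ).map _

theorem Weyl.lieSpan_vec : LieSubmodule.lieSpan ℂ (Loop C A) {Weyl.vec ψ I} = ⊤ :=
  lieSpan_map_eq_top (LieSubmodule.Quotient.surjective_mk' _) (M.lieSpan_vec ψ I)

theorem Weyl.isHighestWeight_vec : IsHighestWeight ψ (Weyl.vec ψ I) :=
  (M.isHighestWeight_vec ψ I).map _

variable {ψ}

/-- In every integrable quotient of `M(ψ, I)` the exponent `λ(α_i^∨) + 1` suffices to kill the
generator by `f_i`, so it does so in the Weyl module. -/
theorem Weyl.f_pow_eq_zero {i : Fin l} {n : ℕ} (hn : corootValue ψ i = n) :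
    (toEnd ℂ (Loop C A) (Weyl ψ I) (Loop.of C A 1 (f' D i)) ^ (n + 1)) (Weyl.vec ψ I) = 0 := by
  rw [Weyl.vec, ← map_toEnd_pow, LieSubmodule.Quotient.mk_eq_zero, weylKernel,
    ← SetLike.mem_coe, LieSubmodule.coe_sInf, Set.mem_iInter₂]
  intro N hN
  rw [SetLike.mem_coe]
  rw [← LieSubmodule.Quotient.mk_eq_zero, map_toEnd_pow]
  exact ((M.isHighestWeight_vec ψ I).map _).f_pow_eq_zero hn (hN.2 i _).2

theorem Weyl.exists_f_pow_eq_zero (hd : IsDominantIntegral ψ) (i : Fin l) :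
    ∃ k, (toEnd ℂ (Loop C A) (Weyl ψ I) (Loop.of C A 1 (f' D i)) ^ k) (Weyl.vec ψ I) = 0 :=
  (hd i).elim fun _ hn => ⟨_, Weyl.f_pow_eq_zero I hn⟩

variable {I}

/-- The universal property of the Weyl module: it maps to every representation with a highest weight
vector of weight `ψ` on which the `f_i` are nilpotent. Neither the ideal `I` nor integrability of
the target enters. -/
theorem Weyl.exists_lift (hψ : VanishesOn ψ I) (hd : IsDominantIntegral ψ) {V : Type*}
    [AddCommGroup V] [Module ℂ V] (σ : Loop C A →ₗ[ℂ] Module.End ℂ V)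
    (hσ : ∀ x y w, σ ⁅x, y⁆ w = σ x (σ y w) - σ y (σ x w)) {u : V}
    (hN : ∀ (a : A) (x : derived D), (x : Alg D) ∈ nPlus D → σ (Loop.of C A a x) u = 0)
    (hC : ∀ t, σ (loopCartanIncl C A t) u = ψ t • u)
    (hf : ∀ i, ∃ k, (σ (Loop.of C A 1 (f' D i)) ^ k) u = 0) :
    ∃ Φ : Weyl ψ I →ₗ[ℂ] V, Φ (Weyl.vec ψ I) = u ∧ ∀ x w, Φ ⁅x, w⁆ = σ x (Φ w) := by
  obtain ⟨Φ, hΦ, hΦ'⟩ := Verma.exists_lift ψ σ hσ hN hC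
  have hpow : ∀ y k w, Φ ((toEnd ℂ (Loop C A) (Verma ψ) y ^ k) w) = (σ y ^ k) (Φ w) := by
    intro y k w
    induction k with
    | zero => rfl
    | succ k ih =>
      rw [pow_succ', pow_succ', Module.End.mul_apply, Module.End.mul_apply, toEnd_apply_apply, hΦ',
        ih]
  let K : LieSubmodule ℂ (Loop C A) (Verma ψ) :=
    { LinearMap.ker Φ with
      lie_mem := fun {y w} hw => by
        change Φ ⁅y, w⁆ = 0
        rw [hΦ', show Φ w = 0 from hw, map_zero] }
  choose n hn using hd
  have hfK : ∀ i, ∃ k, (toEnd ℂ (Loop C A) (Verma ψ) (Loop.of C A 1 (f' D i)) ^ k)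
      (Verma.vec ψ) ∈ K := fun i => by
    obtain ⟨k, hk⟩ := hf i
    refine ⟨k, ?_⟩
    change Φ _ = 0
    rw [hpow, hΦ, hk]
  have hrel : relSubmodule ψ I ≤ K := by
    rw [relSubmodule, LieSubmodule.lieSpan_le]
    rintro _ ⟨m, N, x, a, hm, hx, hNm, ha, rfl⟩
    have hq := (Verma.isHighestWeight_vec ψ).map (LieSubmodule.Quotient.mk' K)
    have hN' : N = ∑ i, m i * n i := by
      simp only [hn] at hNm
      exact_mod_cast hNm
    have := hq.lie_eq_zero_of_mem_pow hψ (n := n) (fun i => hq.f_pow_eq_zero (hn i) (by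
      obtain ⟨k, hk⟩ := hfK i
      exact ⟨k, by rwa [← map_toEnd_pow, LieSubmodule.Quotient.mk_eq_zero]⟩)) hm.1 hx (hN' ▸ ha)
    rwa [← LieModuleHom.map_lie, LieSubmodule.Quotient.mk_eq_zero] at this
  let Φ₁ : M ψ I →ₗ[ℂ] V := (relSubmodule ψ I).toSubmodule.liftQ Φ hrel
  have hΦ₁ : ∀ x w, Φ₁ ⁅x, w⁆ = σ x (Φ₁ w) := by
    intro x w
    obtain ⟨w, rfl⟩ := LieSubmodule.Quotient.surjective_mk' _ w
    exact hΦ' x w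
  let K₁ : LieSubmodule ℂ (Loop C A) (M ψ I) :=
    { LinearMap.ker Φ₁ with
      lie_mem := fun {y w} hw => by
        change Φ₁ ⁅y, w⁆ = 0
        rw [hΦ₁, show Φ₁ w = 0 from hw, map_zero] }
  have hK₁ : IsIntegrable C A (M ψ I ⧸ K₁) := by
    refine ((M.isHighestWeight_vec ψ I).map (LieSubmodule.Quotient.mk' K₁)).isIntegrable
      (lieSpan_map_eq_top (LieSubmodule.Quotient.surjective_mk' _) (M.lieSpan_vec ψ I)) fun i => ?_
    obtain ⟨k, hk⟩ := hfK i
    refine ⟨k, ?_⟩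
    rw [← map_toEnd_pow, LieSubmodule.Quotient.mk_eq_zero, M.vec, ← map_toEnd_pow]
    exact hk
  have hle : weylKernel ψ I ≤ K₁ := sInf_le hK₁
  refine ⟨(weylKernel ψ I).toSubmodule.liftQ Φ₁ hle, hΦ, fun x w => ?_⟩
  obtain ⟨w, rfl⟩ := LieSubmodule.Quotient.surjective_mk' _ w
  exact hΦ₁ x w

end Universal

/-! ### Splitting a module along coprime ideals -/

section Ideals

variable {A : Type*} [CommRing A]

/-- A Cauchy sequence for the `K`-adic topology, with a prescribed rate of convergence. -/
def IsAdicCauchy (K : Ideal A) (ε : ℕ → A) : Prop :=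
  ∀ n N M, n ≤ N → n ≤ M → ε N - ε M ∈ K ^ n

theorem inf_pow_mem {I J : Ideal A} (hIJ : IsCoprime I J) {n : ℕ} {a : A} (hI : a ∈ I ^ n)
    (hJ : a ∈ J ^ n) : a ∈ (I ⊓ J) ^ n := by
  rw [← Ideal.mul_eq_inf_of_isCoprime hIJ, mul_pow, Ideal.mul_eq_inf_of_isCoprime hIJ.pow]
  exact ⟨hI, hJ⟩

/-- A sequence that converges to `1` for the `I`-adic and to `0` for the `J`-adic topology. -/
structure IsSplittingSequence (I J : Ideal A) (ε : ℕ → A) : Prop where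
  one_sub_mem : ∀ N, 1 - ε N ∈ I ^ N
  mem : ∀ N, ε N ∈ J ^ N

theorem exists_isSplittingSequence {I J : Ideal A} (hIJ : IsCoprime I J) :
    ∃ ε, IsSplittingSequence I J ε := by
  have h : ∀ N, ∃ c : A, 1 - c ∈ I ^ N ∧ c ∈ J ^ N := fun N => by
    obtain ⟨i, hi, j, hj, h⟩ := Ideal.isCoprime_iff_exists.1 (hIJ.pow (m := N) (n := N))
    exact ⟨j, by rwa [← h, add_sub_cancel_right], hj⟩
  choose ε h h' using h
  exact ⟨ε, h, h'⟩

namespace IsSplittingSequence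

variable {I J : Ideal A} {ε : ℕ → A}

theorem isAdicCauchy (hε : IsSplittingSequence I J ε) (hIJ : IsCoprime I J) :
    IsAdicCauchy (I ⊓ J) ε := by
  intro n N M hN hM
  refine inf_pow_mem hIJ ?_ ?_
  · rw [← sub_sub_sub_cancel_left _ _ 1]
    exact sub_mem (Ideal.pow_le_pow_right hM (hε.one_sub_mem M))
      (Ideal.pow_le_pow_right hN (hε.one_sub_mem N))
  · exact sub_mem (Ideal.pow_le_pow_right hN (hε.mem N)) (Ideal.pow_le_pow_right hM (hε.mem M))

theorem mul_self_sub_mem (hε : IsSplittingSequence I J ε) (hIJ : IsCoprime I J) (N : ℕ) :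
    ε N * ε N - ε N ∈ (I ⊓ J) ^ N := by
  rw [show ε N * ε N - ε N = -(ε N * (1 - ε N)) by ring]
  exact neg_mem (inf_pow_mem hIJ ((I ^ N).mul_mem_left _ (hε.one_sub_mem N))
    ((J ^ N).mul_mem_right _ (hε.mem N)))

end IsSplittingSequence

end Ideals

open Filter in
theorem eq_of_eventually_eq {X : Type*} {f : ℕ → X} {y y' : X} (h : ∀ᶠ N in atTop, f N = y)
    (h' : ∀ᶠ N in atTop, f N = y') : y = y' := by
  obtain ⟨N, hN, hN'⟩ := (h.and h').exists
  exact hN.symm.trans hN'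

section Splitting

open LieAlgebra LieModule Filter

variable {l : ℕ} {H : Type*} [AddCommGroup H] [Module ℂ H] {D : Datum l H} {C : Complement D}
variable {A : Type*} [CommRing A] [Algebra ℂ A]

variable {V : Type*} [AddCommGroup V] [Module ℂ V] [LieRingModule (Loop C A) V]

variable (C V) in
/-- Every vector is killed by `x ⊗ K ^ N` for every `x ∈ 𝔤'` and large `N`. -/
def IsLocallyNilpotentOn (K : Ideal A) : Prop :=
  ∀ (w : V) (x : derived D), ∃ N, ∀ a ∈ K ^ N, ⁅Loop.of C A a x, w⁆ = 0

theorem IsLocallyNilpotentOn.exists_smul [LieModule ℂ (Loop C A) V] {K : Ideal A}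
    (hK : IsLocallyNilpotentOn C V K) (z : A ⊗[ℂ] derived D) (w : V) :
    ∃ N, ∀ c ∈ K ^ N, ⁅SemiDirectSum.inl (C.action A) (c • z), w⁆ = 0 := by
  induction z using TensorProduct.induction_on with
  | zero => exact ⟨0, fun c _ => by rw [smul_zero, map_zero, zero_lie]⟩
  | tmul a x =>
    obtain ⟨N, hN⟩ := hK w x
    refine ⟨N, fun c hc => ?_⟩
    rw [TensorProduct.smul_tmul', smul_eq_mul]
    exact hN _ ((K ^ N).mul_mem_right a hc)
  | add y z hy hz =>
    obtain ⟨N, hN⟩ := hy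
    obtain ⟨N', hN'⟩ := hz
    refine ⟨max N N', fun c hc => ?_⟩
    rw [smul_add, map_add, add_lie, hN c (Ideal.pow_le_pow_right (le_max_left _ _) hc),
      hN' c (Ideal.pow_le_pow_right (le_max_right _ _) hc), add_zero]

/-- A module generated by a highest weight vector on which the `f_i` are nilpotent is locally
nilpotent along every ideal on which the weight vanishes: this is so for the generator, since `𝔤'` is
generated by the `e_i` and `f_i`. -/
theorem IsHighestWeight.isLocallyNilpotentOn [LieModule ℂ (Loop C A) V]
    {ψ : LoopCartan C A →ₗ[ℂ] ℂ} {v : V}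
    (hv : IsHighestWeight ψ v) (hgen : LieSubmodule.lieSpan ℂ (Loop C A) {v} = ⊤) {K : Ideal A}
    (hψ : VanishesOn ψ K) {n : Fin l → ℕ}
    (hk : ∀ i, (toEnd ℂ (Loop C A) V (Loop.of C A 1 (f' D i)) ^ (n i + 1)) v = 0) :
    IsLocallyNilpotentOn C V K := by
  have hle : ∀ {M N : ℕ}, M ≤ N → ∀ {a}, a ∈ K ^ N → a ∈ K ^ M := fun h _ ha =>
    Ideal.pow_le_pow_right h ha
  refine cyclic_induction hgen (fun x => ?_) (fun x => ⟨0, fun a _ => lie_zero _⟩)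
    (fun w w' hw hw' x => ?_) (fun c w hw x => ?_) (fun y w hw => ?_)
  · induction x using derived_induction with
    | he i => exact ⟨0, fun a _ => hv.lie_e' i a⟩
    | hf i => exact ⟨n i, fun a ha => hv.lie_f'_eq_zero hψ (hk i) ha⟩
    | zero => exact ⟨0, fun a _ => by rw [Loop.of_zero, zero_lie]⟩
    | add x y hx hy =>
      obtain ⟨N, hN⟩ := hx
      obtain ⟨N', hN'⟩ := hy
      refine ⟨max N N', fun a ha => ?_⟩
      rw [Loop.of_add, add_lie, hN a (hle (le_max_left _ _) ha),
        hN' a (hle (le_max_right _ _) ha), add_zero]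
    | smul c x hx =>
      obtain ⟨N, hN⟩ := hx
      exact ⟨N, fun a ha => by rw [Loop.of_smul, smul_lie, hN a ha, smul_zero]⟩
    | lie x y hx hy =>
      obtain ⟨N, hN⟩ := hx
      obtain ⟨N', hN'⟩ := hy
      refine ⟨N + N', fun a ha => ?_⟩
      rw [pow_add] at ha
      induction ha using Submodule.mul_induction_on' with
      | mem_mul_mem b hb c hc =>
        rw [← lie_of_of, lie_lie, hN b hb, hN' c hc, lie_zero, lie_zero, sub_zero]
      | add b _ c _ hb hc =>
        rw [← loopOf_apply, map_add, add_lie, loopOf_apply, loopOf_apply, hb, hc, add_zero]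
  · obtain ⟨N, hN⟩ := hw x
    obtain ⟨N', hN'⟩ := hw' x
    refine ⟨max N N', fun a ha => ?_⟩
    rw [lie_add, hN a (hle (le_max_left _ _) ha), hN' a (hle (le_max_right _ _) ha), add_zero]
  · obtain ⟨N, hN⟩ := hw x
    exact ⟨N, fun a ha => by rw [lie_smul, hN a ha, smul_zero]⟩
  · induction y using loop_induction with
    | of b y =>
      intro x
      obtain ⟨N, hN⟩ := hw x
      obtain ⟨N', hN'⟩ := hw ⁅x, y⁆
      refine ⟨max N N', fun a ha => ?_⟩
      rw [leibniz_lie, lie_of_of, hN a (hle (le_max_left _ _) ha),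
        hN' _ ((K ^ N').mul_mem_right b (hle (le_max_right _ _) ha)), lie_zero, add_zero]
    | inr h =>
      intro x
      obtain ⟨N, hN⟩ := hw x
      obtain ⟨N', hN'⟩ := hw ⁅(h : Alg D), x⁆
      refine ⟨max N N', fun a ha => ?_⟩
      rw [leibniz_lie, ← lie_skew, lie_inr_of, neg_lie, hN a (hle (le_max_left _ _) ha),
        hN' _ (hle (le_max_right _ _) ha), lie_zero, add_zero, neg_zero]
    | add y z hy hz =>
      intro x
      obtain ⟨N, hN⟩ := hy x
      obtain ⟨N', hN'⟩ := hz x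
      refine ⟨max N N', fun a ha => ?_⟩
      rw [add_lie, lie_add, hN a (hle (le_max_left _ _) ha),
        hN' a (hle (le_max_right _ _) ha), add_zero]

variable [LieModule ℂ (Loop C A) V]

theorem IsAdicCauchy.exists_eventually_eq {K : Ideal A} {ε : ℕ → A} (hε : IsAdicCauchy K ε)
    (hK : IsLocallyNilpotentOn C V K) (z : A ⊗[ℂ] derived D) (w : V) :
    ∃ y, ∀ᶠ N in atTop, ⁅SemiDirectSum.inl (C.action A) (ε N • z), w⁆ = y := by
  obtain ⟨n, hn⟩ := hK.exists_smul z w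
  refine ⟨⁅SemiDirectSum.inl (C.action A) (ε n • z), w⁆, eventually_atTop.2 ⟨n, fun N hN => ?_⟩⟩
  rw [← sub_eq_zero, ← sub_lie, ← map_sub, ← sub_smul]
  exact hn _ (hε n N n hN le_rfl)

/-- The action of `ε z`, for `z ∈ 𝔤' ⊗ A` and an adic limit `ε` of elements of `A`, on a locally
nilpotent module. -/
noncomputable def limitAction {K : Ideal A} {ε : ℕ → A} (hε : IsAdicCauchy K ε)
    (hK : IsLocallyNilpotentOn C V K) : A ⊗[ℂ] derived D →ₗ[ℂ] Module.End ℂ V :=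
  LinearMap.mk₂ ℂ (fun z w => (hε.exists_eventually_eq hK z w).choose)
    (fun z z' w => by
      refine eq_of_eventually_eq (hε.exists_eventually_eq hK _ w).choose_spec ?_
      filter_upwards [(hε.exists_eventually_eq hK z w).choose_spec,
        (hε.exists_eventually_eq hK z' w).choose_spec] with N h h'
      rw [smul_add, map_add, add_lie, h, h'])
    (fun c z w => by
      refine eq_of_eventually_eq (hε.exists_eventually_eq hK _ w).choose_spec ?_
      filter_upwards [(hε.exists_eventually_eq hK z w).choose_spec] with N h
      rw [smul_comm, map_smul, smul_lie, h])
    (fun z w w' => by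
      refine eq_of_eventually_eq (hε.exists_eventually_eq hK z _).choose_spec ?_
      filter_upwards [(hε.exists_eventually_eq hK z w).choose_spec,
        (hε.exists_eventually_eq hK z w').choose_spec] with N h h'
      rw [lie_add, h, h'])
    (fun c z w => by
      refine eq_of_eventually_eq (hε.exists_eventually_eq hK z _).choose_spec ?_
      filter_upwards [(hε.exists_eventually_eq hK z w).choose_spec] with N h
      rw [lie_smul, h])

section Limit

variable {K : Ideal A} {ε δ η : ℕ → A} (hε : IsAdicCauchy K ε) (hδ : IsAdicCauchy K δ)
  (hη : IsAdicCauchy K η) (hK : IsLocallyNilpotentOn C V K)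

theorem limitAction_spec (z : A ⊗[ℂ] derived D) (w : V) :
    ∀ᶠ N in atTop, ⁅SemiDirectSum.inl (C.action A) (ε N • z), w⁆ = limitAction hε hK z w :=
  (hε.exists_eventually_eq hK z w).choose_spec

theorem limitAction_eq {z : A ⊗[ℂ] derived D} {w y : V}
    (h : ∀ᶠ N in atTop, ⁅SemiDirectSum.inl (C.action A) (ε N • z), w⁆ = y) :
    limitAction hε hK z w = y :=
  eq_of_eventually_eq (limitAction_spec hε hK z w) h

theorem eventually_lie_eq_zero (hK : IsLocallyNilpotentOn C V K) {c : ℕ → A}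
    (hc : ∀ N, c N ∈ K ^ N) (z : A ⊗[ℂ] derived D) (w : V) :
    ∀ᶠ N in atTop, ⁅SemiDirectSum.inl (C.action A) (c N • z), w⁆ = 0 := by
  obtain ⟨n, hn⟩ := hK.exists_smul z w
  exact eventually_atTop.2 ⟨n, fun N hN => hn _ (Ideal.pow_le_pow_right hN (hc N))⟩

/-- The commutator of the actions of two adic limits. -/
theorem limitAction_commutator (h : ∀ N, ε N * δ N - η N ∈ K ^ N) (z z' : A ⊗[ℂ] derived D)
    (w : V) : limitAction hε hK z (limitAction hδ hK z' w) =
      limitAction hδ hK z' (limitAction hε hK z w) + limitAction hη hK ⁅z, z'⁆ w := by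
  rw [← sub_eq_iff_eq_add']
  symm
  refine limitAction_eq hη hK ?_
  filter_upwards [limitAction_spec hε hK z w, limitAction_spec hδ hK z' w,
    limitAction_spec hε hK z (limitAction hδ hK z' w),
    limitAction_spec hδ hK z' (limitAction hε hK z w),
    eventually_lie_eq_zero hK h ⁅z, z'⁆ w] with N h1 h2 h3 h4 h5
  rw [sub_smul, map_sub, sub_lie, sub_eq_zero] at h5
  rw [← h3, ← h4, ← h5, ← h1, ← h2, mul_smul, ← lie_smul (δ N) z z', ← smul_lie, LieHom.map_lie,
    lie_lie]

theorem lie_inl_limitAction (z z' : A ⊗[ℂ] derived D) (w : V) :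
    ⁅SemiDirectSum.inl (C.action A) z, limitAction hε hK z' w⁆ =
      limitAction hε hK z' ⁅SemiDirectSum.inl (C.action A) z, w⁆ +
        limitAction hε hK ⁅z, z'⁆ w := by
  rw [← sub_eq_iff_eq_add']
  symm
  refine limitAction_eq hε hK ?_
  filter_upwards [limitAction_spec hε hK z' w,
    limitAction_spec hε hK z' ⁅SemiDirectSum.inl (C.action A) z, w⁆] with N h1 h2
  rw [← h1, ← h2, ← lie_smul, LieHom.map_lie, lie_lie]

theorem action_smul (h : C.subalgebra) (a : A) (z : A ⊗[ℂ] derived D) :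
    C.action A h (a • z) = a • C.action A h z := by
  induction z using TensorProduct.induction_on with
  | zero => simp
  | tmul b x => rfl
  | add y z hy hz => rw [smul_add, map_add, hy, hz, map_add, smul_add]

theorem lie_inr_limitAction (h : C.subalgebra) (z : A ⊗[ℂ] derived D) (w : V) :
    ⁅SemiDirectSum.inr (C.action A) h, limitAction hε hK z w⁆ =
      limitAction hε hK z ⁅SemiDirectSum.inr (C.action A) h, w⁆ +
        limitAction hε hK (C.action A h z) w := by
  rw [← sub_eq_iff_eq_add']
  symm
  refine limitAction_eq hε hK ?_
  filter_upwards [limitAction_spec hε hK z w,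
    limitAction_spec hε hK z ⁅SemiDirectSum.inr (C.action A) h, w⁆] with N h1 h2
  rw [← h1, ← h2, ← action_smul, ← lie_inr_inl, lie_lie]

theorem lie_limitAction (y : Loop C A) (z : A ⊗[ℂ] derived D) (w : V) :
    ⁅y, limitAction hε hK z w⁆ = limitAction hε hK z ⁅y, w⁆ +
      limitAction hε hK (⁅y.left, z⁆ + C.action A y.right z) w := by
  conv_lhs => rw [← inl_add_inr y]
  conv_rhs => enter [1]; rw [← inl_add_inr y]
  rw [add_lie, lie_inl_limitAction, lie_inr_limitAction, add_lie, map_add, map_add,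
    LinearMap.add_apply]
  abel

/-- For an idempotent limit `ε`, the elements `ε_N z` act through the limit like `z`, once `N` is
large. -/
theorem eventually_limitAction_smul (h : ∀ N, ε N * ε N - ε N ∈ K ^ N) (z : A ⊗[ℂ] derived D)
    (w : V) : ∀ᶠ N in atTop, limitAction hε hK (ε N • z) w = limitAction hε hK z w := by
  obtain ⟨n, hn⟩ := hK.exists_smul z w
  filter_upwards [eventually_ge_atTop n, limitAction_spec hε hK z w] with N hN hz
  refine limitAction_eq hε hK ?_
  filter_upwards [eventually_ge_atTop n] with M hM
  rw [← hz, ← sub_eq_zero, ← sub_lie, ← map_sub, smul_smul, ← sub_smul]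
  refine hn _ ?_
  rw [show ε M * ε N - ε N = ε N * (ε M - ε N) + (ε N * ε N - ε N) by ring]
  exact add_mem ((K ^ n).mul_mem_left _ (hε n M N hM hN)) (Ideal.pow_le_pow_right hN (h N))

end Limit

theorem eventually_toEnd_pow_eq {T : Module.End ℂ V} {y : ℕ → Loop C A}
    (h : ∀ w, ∀ᶠ N in atTop, ⁅y N, w⁆ = T w) (k : ℕ) (w : V) :
    ∀ᶠ N in atTop, (toEnd ℂ (Loop C A) V (y N) ^ k) w = (T ^ k) w := by
  induction k with
  | zero => exact .of_forall fun _ => rfl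
  | succ k ih =>
    filter_upwards [ih, h ((T ^ k) w)] with N h1 h2
    rw [pow_succ', pow_succ', Module.End.mul_apply, Module.End.mul_apply, h1, toEnd_apply_apply, h2]

/-- If `f_i` is nilpotent on a highest weight vector, then so is `f_i ⊗ a` for every `a`. -/
theorem IsHighestWeight.toEnd_pow_eq_zero {ψ : LoopCartan C A →ₗ[ℂ] ℂ} {v : V}
    (hv : IsHighestWeight ψ v) {i : Fin l} {k : ℕ}
    (hk : (toEnd ℂ (Loop C A) V (Loop.of C A 1 (f' D i)) ^ k) v = 0) (a : A) :
    (toEnd ℂ (Loop C A) V (Loop.of C A a (f' D i)) ^ k) v = 0 := by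
  have := (isCurrentAction (V := V) i).prod_eq_zero (hv.lie_h' i) hk (List.replicate k a) (by simp)
  rw [List.map_replicate, List.prod_replicate] at this
  exact this

end Splitting

/-! ### The two commuting actions -/

section Halves

open LieAlgebra LieModule Filter

variable {l : ℕ} {H : Type*} [AddCommGroup H] [Module ℂ H] {D : Datum l H} {C : Complement D}
variable {A : Type*} [CommRing A] [Algebra ℂ A]

theorem lie_mem_nPlus {h x : Alg D} (hh : h ∈ cartan D) (hx : x ∈ nPlus D) : ⁅h, x⁆ ∈ nPlus D := by
  obtain ⟨y, rfl⟩ := hh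
  have hle : nPlus D ≤ (nPlus D).comap (toEnd ℂ (Alg D) (Alg D) (hElt D y)) := by
    refine iSup₂_le fun m hm x hx => ?_
    rw [Submodule.mem_comap, toEnd_apply_apply, hx y]
    exact (nPlus D).smul_mem _ ((le_iSup₂_of_le
      (f := fun m (_ : IsPosRoot D m) => rootSpace D (weight D m)) m hm le_rfl) hx)
  exact hle hx

theorem Complement.coe_mem_cartan (h : C.subalgebra) : (h : Alg D) ∈ cartan D :=
  (C.sup_eq ▸ le_sup_right : C.space ≤ cartan D) h.2

theorem action_tmul (h : C.subalgebra) (a : A) (x : derived D) :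
    C.action A h (a ⊗ₜ[ℂ] x) = a ⊗ₜ[ℂ] ⁅(h : Alg D), x⁆ := rfl

theorem action_cartan (h : C.subalgebra) (t : A ⊗[ℂ] cartanDerived D) :
    C.action A h ((cartanIncl D).lTensor A t) = 0 := by
  induction t using TensorProduct.induction_on with
  | zero => rw [map_zero, map_zero]
  | tmul a x =>
    have h0 : ⁅(h : Alg D), cartanIncl D x⁆ = 0 :=
      Subtype.ext (lie_eq_zero_of_mem_cartan (Complement.coe_mem_cartan h) x.2.2)
    rw [LinearMap.lTensor_tmul, action_tmul, h0, TensorProduct.tmul_zero]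
  | add s t hs ht => rw [map_add, map_add, hs, ht, add_zero]

theorem lie_complement (h h' : C.subalgebra) : ⁅h, h'⁆ = 0 :=
  Subtype.ext (lie_eq_zero_of_mem_cartan (Complement.coe_mem_cartan h)
    (Complement.coe_mem_cartan h'))

theorem action_comm (h h' : C.subalgebra) (z : A ⊗[ℂ] derived D) :
    C.action A h (C.action A h' z) = C.action A h' (C.action A h z) := by
  have := LieDerivation.congr_fun ((C.action A).map_lie h h') z
  rw [lie_complement, map_zero, LieDerivation.commutator_apply] at this
  exact sub_eq_zero.1 this.symm

theorem lie_left (x y : Loop C A) : ⁅x, y⁆.left =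
    ⁅x.left, y.left⁆ + C.action A x.right y.left - C.action A y.right x.left := rfl

theorem lie_right (x y : Loop C A) : ⁅x, y⁆.right = 0 := lie_complement x.right y.right

variable {V : Type*} [AddCommGroup V] [Module ℂ V] [LieRingModule (Loop C A) V]
  [LieModule ℂ (Loop C A) V]

/-- Operators `d h`, for `h ∈ 𝔥''`, with `[d h, x ⊗ a] = [h, x] ⊗ ε a` for an adic limit `ε`, that act
on the vector `v` by the linear form `χ`. Linearity in `h` is automatic when `v` generates the
module; see `IsPartialDerivation.toLinearMap`. -/
structure IsPartialDerivation {K : Ideal A} {ε : ℕ → A} (hε : IsAdicCauchy K ε)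
    (hK : IsLocallyNilpotentOn C V K) (v : V) (χ : C.subalgebra →ₗ[ℂ] ℂ)
    (d : C.subalgebra → V →ₗ[ℂ] V) : Prop where
  apply_vec : ∀ h, d h v = χ h • v
  apply_lie : ∀ h (y : Loop C A) w,
    d h ⁅y, w⁆ = ⁅y, d h w⁆ + limitAction hε hK (C.action A h y.left) w

namespace IsPartialDerivation

variable {K : Ideal A} {ε : ℕ → A} {hε : IsAdicCauchy K ε} {hK : IsLocallyNilpotentOn C V K}
  {v : V} {χ : C.subalgebra →ₗ[ℂ] ℂ} {d : C.subalgebra → V →ₗ[ℂ] V}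

theorem apply_limitAction (hd : IsPartialDerivation hε hK v χ d)
    (h : ∀ N, ε N * ε N - ε N ∈ K ^ N) (x : C.subalgebra) (z : A ⊗[ℂ] derived D) (w : V) :
    d x (limitAction hε hK z w) =
      limitAction hε hK z (d x w) + limitAction hε hK (C.action A x z) w := by
  obtain ⟨N, h1, h2, h3⟩ := ((limitAction_spec hε hK z w).and
    ((limitAction_spec hε hK z (d x w)).and
      (eventually_limitAction_smul hε hK h (C.action A x z) w))).exists
  rw [← h1, ← h2, ← h3, hd.apply_lie, ← action_smul]
  rfl

/-- The `𝔥''`-part of the action is determined by its value on a generator, hence is linear. -/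
noncomputable def toLinearMap (hd : IsPartialDerivation hε hK v χ d)
    (hgen : LieSubmodule.lieSpan ℂ (Loop C A) {v} = ⊤) : C.subalgebra →ₗ[ℂ] Module.End ℂ V where
  toFun := d
  map_add' x y := LinearMap.ext fun w => by
    induction w using cyclic_induction hgen with
    | mem => simp [hd.apply_vec, add_smul]
    | zero => simp
    | add w w' h h' => rw [map_add, h, h', map_add]
    | smul c w h => rw [map_smul, h, map_smul]
    | lie y' w h =>
      rw [LinearMap.add_apply, hd.apply_lie, hd.apply_lie, hd.apply_lie, h, map_add,
        LinearMap.add_apply, LieDerivation.add_apply, map_add, LinearMap.add_apply, lie_add]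
      abel
  map_smul' c x := LinearMap.ext fun w => by
    induction w using cyclic_induction hgen with
    | mem => simp [hd.apply_vec, smul_smul]
    | zero => simp
    | add w w' h h' => rw [map_add, h, h', map_add]
    | smul c w h => rw [map_smul, h, map_smul]
    | lie y' w h =>
      rw [RingHom.id_apply, LinearMap.smul_apply, hd.apply_lie, hd.apply_lie, h, map_smul,
        LieDerivation.smul_apply, map_smul, LinearMap.smul_apply, RingHom.id_apply,
        LinearMap.smul_apply, lie_smul, smul_add]

theorem comm (hd : IsPartialDerivation hε hK v χ d)
    (hgen : LieSubmodule.lieSpan ℂ (Loop C A) {v} = ⊤) (h : ∀ N, ε N * ε N - ε N ∈ K ^ N)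
    (x y : C.subalgebra) (w : V) : d x (d y w) = d y (d x w) := by
  induction w using cyclic_induction hgen with
  | mem => rw [hd.apply_vec, hd.apply_vec, map_smul, map_smul, hd.apply_vec, hd.apply_vec,
      smul_comm]
  | zero => simp
  | add w w' h h' => rw [map_add, map_add, h, h', map_add, map_add]
  | smul c w h => rw [map_smul, map_smul, h, map_smul, map_smul]
  | lie z w hw =>
    rw [hd.apply_lie, map_add, hd.apply_lie, hd.apply_limitAction h, hd.apply_lie x, map_add,
      hd.apply_lie, hd.apply_limitAction h, action_comm x y, hw]
    abel

/-- The action of `𝔤' ⊗ A ⊕ 𝔥''` through the part of `A` singled out by `ε`. -/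
noncomputable def half (hd : IsPartialDerivation hε hK v χ d)
    (hgen : LieSubmodule.lieSpan ℂ (Loop C A) {v} = ⊤) : Loop C A →ₗ[ℂ] Module.End ℂ V :=
  limitAction hε hK ∘ₗ SemiDirectSum.projl (C.action A) +
    hd.toLinearMap hgen ∘ₗ (SemiDirectSum.projr (C.action A) : Loop C A →ₗ[ℂ] C.subalgebra)

variable (hd : IsPartialDerivation hε hK v χ d)
  (hgen : LieSubmodule.lieSpan ℂ (Loop C A) {v} = ⊤)

theorem half_apply (y : Loop C A) (w : V) :
    hd.half hgen y w = limitAction hε hK y.left w + d y.right w := rfl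

/-- The linear map `half` is equivariant for the original action. -/
theorem lie_half (x y : Loop C A) (w : V) :
    ⁅x, hd.half hgen y w⁆ = hd.half hgen y ⁅x, w⁆ + hd.half hgen ⁅x, y⁆ w := by
  have h0 : d (0 : C.subalgebra) = 0 := (hd.toLinearMap hgen).map_zero
  rw [half_apply, half_apply, half_apply, lie_add, lie_limitAction, hd.apply_lie, lie_left,
    lie_right, h0, map_sub, LinearMap.sub_apply, LinearMap.zero_apply]
  abel

theorem half_lie (h : ∀ N, ε N * ε N - ε N ∈ K ^ N) (x y : Loop C A) (w : V) :
    hd.half hgen ⁅x, y⁆ w =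
      hd.half hgen x (hd.half hgen y w) - hd.half hgen y (hd.half hgen x w) := by
  have h0 : d (0 : C.subalgebra) = 0 := (hd.toLinearMap hgen).map_zero
  rw [half_apply, half_apply, half_apply, half_apply, half_apply, lie_left,
    lie_right, h0, map_sub, map_add, LinearMap.sub_apply, LinearMap.add_apply,
    LinearMap.zero_apply, map_add, map_add, map_add, map_add, hd.apply_limitAction h,
    hd.apply_limitAction h, hd.comm hgen h x.right y.right,
    limitAction_commutator hε hε hε hK h x.left y.left]
  abel

/-- The complementary action, through the part of `A` singled out by `1 - ε`. -/
noncomputable def coHalf : Loop C A →ₗ[ℂ] Module.End ℂ V :=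
  (toEnd ℂ (Loop C A) V : Loop C A →ₗ[ℂ] Module.End ℂ V) - hd.half hgen

theorem coHalf_apply (y : Loop C A) (w : V) :
    hd.coHalf hgen y w = ⁅y, w⁆ - hd.half hgen y w := rfl

/-- The two actions commute, because `half` is equivariant and a representation. -/
theorem coHalf_half_comm (h : ∀ N, ε N * ε N - ε N ∈ K ^ N) (x y : Loop C A) (w : V) :
    hd.coHalf hgen x (hd.half hgen y w) = hd.half hgen y (hd.coHalf hgen x w) := by
  rw [coHalf_apply, coHalf_apply, lie_half, map_sub, hd.half_lie hgen h]
  abel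

theorem coHalf_lie (h : ∀ N, ε N * ε N - ε N ∈ K ^ N) (x y : Loop C A) (w : V) :
    hd.coHalf hgen ⁅x, y⁆ w =
      hd.coHalf hgen x (hd.coHalf hgen y w) - hd.coHalf hgen y (hd.coHalf hgen x w) := by
  have h1 : hd.coHalf hgen x (hd.coHalf hgen y w) =
      hd.coHalf hgen x ⁅y, w⁆ - hd.half hgen y (hd.coHalf hgen x w) := by
    rw [hd.coHalf_apply hgen y, map_sub, hd.coHalf_half_comm hgen h]
  rw [h1, hd.coHalf_apply hgen y, hd.coHalf_apply hgen ⁅x, y⁆, hd.coHalf_apply hgen x,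
    hd.coHalf_apply hgen x, lie_sub, lie_half, lie_lie, ← lie_skew x y, map_neg,
    LinearMap.neg_apply]
  abel

end IsPartialDerivation

end Halves

/-! ### Tensor products of Weyl modules -/

section Main

open LieAlgebra LieModule Filter

variable {l : ℕ} {H : Type*} [AddCommGroup H] [Module ℂ H] {D : Datum l H} {C : Complement D}
variable {A : Type*} [CommRing A] [Algebra ℂ A]

variable {V : Type*} [AddCommGroup V] [Module ℂ V] [LieRingModule (Loop C A) V]

/-- The vector `v` generates the module, is a highest weight vector of weight `ψ`, and the `f_i` are
nilpotent on it. -/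
structure IsIntegrableGenerator [LieModule ℂ (Loop C A) V] (ψ : LoopCartan C A →ₗ[ℂ] ℂ) (v : V) :
    Prop where
  isHighestWeight : IsHighestWeight ψ v
  lieSpan_eq_top : LieSubmodule.lieSpan ℂ (Loop C A) {v} = ⊤
  exists_f_pow_eq_zero :
    ∀ i, ∃ k, (toEnd ℂ (Loop C A) V (Loop.of C A 1 (f' D i)) ^ k) v = 0

/-- The universal property of the generator of a Weyl module with respect to representations on a
fixed vector space `W`. The representation is a linear map `σ` that respects brackets, and not an
instance, so that one space can carry several of them. -/
def HasLift (ψ : LoopCartan C A →ₗ[ℂ] ℂ) (v : V) (W : Type*) [AddCommGroup W] [Module ℂ W] : Prop :=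
  ∀ (σ : Loop C A →ₗ[ℂ] Module.End ℂ W) (u : W),
    (∀ x y w, σ ⁅x, y⁆ w = σ x (σ y w) - σ y (σ x w)) →
    (∀ (a : A) (x : derived D), (x : Alg D) ∈ nPlus D → σ (Loop.of C A a x) u = 0) →
    (∀ t, σ (loopCartanIncl C A t) u = ψ t • u) →
    (∀ i, ∃ k, (σ (Loop.of C A 1 (f' D i)) ^ k) u = 0) →
    ∃ Φ : V →ₗ[ℂ] W, Φ v = u ∧ ∀ x w, Φ ⁅x, w⁆ = σ x (Φ w)

theorem Weyl.isIntegrableGenerator {ψ : LoopCartan C A →ₗ[ℂ] ℂ} (I : Ideal A)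
    (hd : IsDominantIntegral ψ) : IsIntegrableGenerator ψ (Weyl.vec ψ I) :=
  ⟨Weyl.isHighestWeight_vec ψ I, Weyl.lieSpan_vec ψ I, Weyl.exists_f_pow_eq_zero I hd⟩

theorem Weyl.hasLift {ψ : LoopCartan C A →ₗ[ℂ] ℂ} {I : Ideal A} (hψ : VanishesOn ψ I)
    (hd : IsDominantIntegral ψ) (W : Type*) [AddCommGroup W] [Module ℂ W] :
    HasLift ψ (Weyl.vec ψ I) W :=
  fun σ _ hσ hN hC hf => Weyl.exists_lift hψ hd σ hσ hN hC hf

variable [LieModule ℂ (Loop C A) V]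

theorem IsIntegrableGenerator.isIntegrable {ψ : LoopCartan C A →ₗ[ℂ] ℂ} {v : V}
    (hv : IsIntegrableGenerator ψ v) : IsIntegrable C A V :=
  hv.isHighestWeight.isIntegrable hv.lieSpan_eq_top hv.exists_f_pow_eq_zero

theorem IsIntegrableGenerator.isLocallyNilpotentOn {ψ : LoopCartan C A →ₗ[ℂ] ℂ} {v : V}
    (hv : IsIntegrableGenerator ψ v) {K : Ideal A} (hψ : VanishesOn ψ K) :
    IsLocallyNilpotentOn C V K := by
  choose n hn using hv.exists_f_pow_eq_zero
  refine hv.isHighestWeight.isLocallyNilpotentOn hv.lieSpan_eq_top hψ (n := n) fun i => ?_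
  rw [pow_succ', Module.End.mul_apply, hn, map_zero]

section Deformation

variable {K : Ideal A} {ε : ℕ → A} (hε : IsAdicCauchy K ε) (hK : IsLocallyNilpotentOn C V K)
  (h : C.subalgebra)

/-- The action of `𝔤' ⊗ A ⊕ 𝔥''` on `V × V = V ⊕ η V`, where `η² = 0`, obtained from the action on
`V` by the infinitesimal automorphism `z ↦ z + η [h, z]`, in which `[h, z]` acts through the adic
limit `ε`. -/
noncomputable def deformation : Loop C A →ₗ[ℂ] Module.End ℂ (V × V) :=
  LinearMap.mk₂ ℂ
    (fun y m => (⁅y, m.1⁆, ⁅y, m.2⁆ + limitAction hε hK (C.action A h y.left) m.1))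
    (fun y y' m => by
      have h1 : (y + y').left = y.left + y'.left := rfl
      refine Prod.ext (add_lie _ _ _) ?_
      change ⁅y + y', m.2⁆ + _ = (⁅y, m.2⁆ + _) + (⁅y', m.2⁆ + _)
      rw [h1, map_add, map_add, add_lie, LinearMap.add_apply]
      abel)
    (fun c y m => by
      have h1 : (c • y).left = c • y.left := rfl
      refine Prod.ext (smul_lie _ _ _) ?_
      change ⁅c • y, m.2⁆ + _ = c • (⁅y, m.2⁆ + _)
      rw [h1, map_smul, map_smul, smul_lie, LinearMap.smul_apply, smul_add])
    (fun y m m' => by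
      refine Prod.ext (lie_add _ _ _) ?_
      change ⁅y, m.2 + m'.2⁆ + limitAction hε hK _ (m.1 + m'.1) =
        (⁅y, m.2⁆ + _) + (⁅y, m'.2⁆ + _)
      rw [lie_add, map_add]
      abel)
    (fun c y m => by
      refine Prod.ext (lie_smul _ _ _) ?_
      change ⁅y, c • m.2⁆ + limitAction hε hK _ (c • m.1) = c • (⁅y, m.2⁆ + _)
      rw [lie_smul, map_smul, smul_add])

theorem deformation_apply (y : Loop C A) (m : V × V) :
    deformation hε hK h y m =
      (⁅y, m.1⁆, ⁅y, m.2⁆ + limitAction hε hK (C.action A h y.left) m.1) := rfl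

theorem action_lie_left (x y : Loop C A) : C.action A h ⁅x, y⁆.left =
    ⁅x.left, C.action A h y.left⁆ - ⁅y.left, C.action A h x.left⁆ +
      C.action A x.right (C.action A h y.left) - C.action A y.right (C.action A h x.left) := by
  have hadd : ∀ p q, C.action A h (p + q) = C.action A h p + C.action A h q :=
    (C.action A h).toLinearMap.map_add
  rw [lie_left, LieDerivation.map_sub, hadd, LieDerivation.apply_lie_eq_sub,
    action_comm h x.right, action_comm h y.right]

theorem limitAction_sub_add_sub (a b c d : A ⊗[ℂ] derived D) (p : V) :
    limitAction hε hK (a - b + c - d) p =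
      limitAction hε hK (a + c) p - limitAction hε hK (b + d) p := by
  rw [← LinearMap.sub_apply, ← map_sub, sub_add_eq_add_sub, sub_sub]

theorem limitAction_action_lie (x y : Loop C A) (p : V) :
    limitAction hε hK (C.action A h ⁅x, y⁆.left) p =
      ⁅x, limitAction hε hK (C.action A h y.left) p⁆ -
          limitAction hε hK (C.action A h y.left) ⁅x, p⁆ -
        (⁅y, limitAction hε hK (C.action A h x.left) p⁆ -
          limitAction hε hK (C.action A h x.left) ⁅y, p⁆) := by
  rw [action_lie_left, limitAction_sub_add_sub, lie_limitAction hε hK x, lie_limitAction hε hK y,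
    add_sub_cancel_left, add_sub_cancel_left]

theorem deformation_lie (x y : Loop C A) (m : V × V) :
    deformation hε hK h ⁅x, y⁆ m =
      deformation hε hK h x (deformation hε hK h y m) -
        deformation hε hK h y (deformation hε hK h x m) := by
  obtain ⟨p, q⟩ := m
  simp only [deformation_apply, Prod.mk_sub_mk, Prod.mk.injEq]
  refine ⟨lie_lie x y p, ?_⟩
  rw [limitAction_action_lie, lie_lie, lie_add, lie_add]
  abel

theorem deformation_pow_fst (y : Loop C A) (k : ℕ) (m : V × V) :
    ((deformation hε hK h y ^ k) m).1 = (toEnd ℂ (Loop C A) V y ^ k) m.1 := by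
  induction k with
  | zero => rfl
  | succ k ih =>
    rw [pow_succ', pow_succ', Module.End.mul_apply, Module.End.mul_apply, deformation_apply, ih,
      toEnd_apply_apply]

theorem deformation_pow_zero_mk (y : Loop C A) (k : ℕ) (w : V) :
    (deformation hε hK h y ^ k) (0, w) = (0, (toEnd ℂ (Loop C A) V y ^ k) w) := by
  induction k with
  | zero => rfl
  | succ k ih =>
    rw [pow_succ', pow_succ', Module.End.mul_apply, Module.End.mul_apply, ih, deformation_apply,
      lie_zero, map_zero, add_zero, toEnd_apply_apply]

variable {hε hK h}

theorem IsIntegrableGenerator.deformation_pow_eq_zero {ψ : LoopCartan C A →ₗ[ℂ] ℂ} {v : V}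
    (hgen : IsIntegrableGenerator ψ v) (i : Fin l) (w : V) :
    ∃ k, (deformation hε hK h (Loop.of C A 1 (f' D i)) ^ k) (v, w) = 0 := by
  obtain ⟨k, hk⟩ := hgen.exists_f_pow_eq_zero i
  obtain ⟨q, hq⟩ : ∃ q, (deformation hε hK h (Loop.of C A 1 (f' D i)) ^ k) (v, w) = (0, q) :=
    ⟨_, Prod.ext ((deformation_pow_fst hε hK h _ _ _).trans hk) rfl⟩
  obtain ⟨j, hj⟩ := (hgen.isIntegrable.2 i q).2
  refine ⟨j + k, ?_⟩
  rw [pow_add, Module.End.mul_apply, hq, deformation_pow_zero_mk, hj]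
  rfl

theorem IsHighestWeight.deformation_nPlus {ψ : LoopCartan C A →ₗ[ℂ] ℂ} {v : V}
    (hv : IsHighestWeight ψ v) (c : ℂ) (a : A) (x : derived D) (hx : (x : Alg D) ∈ KacMoody.nPlus D) :
    deformation hε hK h (Loop.of C A a x) (v, c • v) = 0 := by
  have h0 : limitAction hε hK (C.action A h (Loop.of C A a x).left) v = 0 :=
    limitAction_eq hε hK (.of_forall fun N =>
      hv.nPlus (ε N * a) ⁅(h : Alg D), x⁆ (lie_mem_nPlus (Complement.coe_mem_cartan h) hx))
  rw [deformation_apply, h0, lie_smul, hv.nPlus a x hx, smul_zero, add_zero]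
  rfl

theorem IsHighestWeight.deformation_cartan {ψ : LoopCartan C A →ₗ[ℂ] ℂ} {v : V}
    (hv : IsHighestWeight ψ v) (c : ℂ) (t : LoopCartan C A) :
    deformation hε hK h (loopCartanIncl C A t) (v, c • v) = ψ t • (v, c • v) := by
  have h0 : C.action A h (loopCartanIncl C A t).left = 0 := by
    have h1 : (loopCartanIncl C A t).left = (cartanIncl D).lTensor A t.1 + 0 := rfl
    rw [h1, add_zero, action_cartan]
  rw [deformation_apply, h0, map_zero, LinearMap.zero_apply, add_zero, lie_smul, hv.cartan,
    smul_comm]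
  rfl

end Deformation

/-- The partial actions of `𝔥''` on a Weyl module exist: the universal property gives a map
`w ↦ (w, d w)` into the deformed module. -/
theorem HasLift.exists_isPartialDerivation {ψ : LoopCartan C A →ₗ[ℂ] ℂ} {v : V}
    (hlift : HasLift ψ v (V × V)) (hgen : IsIntegrableGenerator ψ v) {K : Ideal A} {ε : ℕ → A}
    (hε : IsAdicCauchy K ε) (hK : IsLocallyNilpotentOn C V K) (χ : C.subalgebra →ₗ[ℂ] ℂ) :
    ∃ d, IsPartialDerivation hε hK v χ d := by
  have key : ∀ h : C.subalgebra, ∃ d : V →ₗ[ℂ] V,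
      d v = χ h • v ∧ ∀ (y : Loop C A) w,
        d ⁅y, w⁆ = ⁅y, d w⁆ + limitAction hε hK (C.action A h y.left) w := by
    intro h
    obtain ⟨Φ, hΦ, hΦ'⟩ := hlift (deformation hε hK h) (v, χ h • v) (deformation_lie hε hK h)
      (hgen.isHighestWeight.deformation_nPlus _) (hgen.isHighestWeight.deformation_cartan _)
      (fun i => hgen.deformation_pow_eq_zero i _)
    have hfst : ∀ w, (Φ w).1 = w := fun w => by
      induction w using cyclic_induction (hgen.lieSpan_eq_top) with
      | mem => rw [hΦ]
      | zero => rw [map_zero]; rfl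
      | add w w' h h' => rw [map_add, Prod.fst_add, h, h']
      | smul c w h => rw [map_smul, Prod.smul_fst, h]
      | lie y w h => rw [hΦ', deformation_apply, h]
    refine ⟨LinearMap.snd ℂ _ _ ∘ₗ Φ, ?_, fun y w => ?_⟩
    · rw [LinearMap.comp_apply, hΦ]
      rfl
    · rw [LinearMap.comp_apply, LinearMap.comp_apply, hΦ', deformation_apply, hfst]
      rfl
  choose d h1 h2 using key
  exact ⟨d, h1, h2⟩

section Tensor

variable {W : Type*} [AddCommGroup W] [Module ℂ W] [LieRingModule (Loop C A) W]
  [LieModule ℂ (Loop C A) W]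

/-- Nilpotency on both factors implies nilpotency on the tensor product; the bound `a + b` is not
optimal. -/
theorem toEnd_pow_tmul_eq_zero (y : Loop C A) (s : ℕ) : ∀ (a b : ℕ) (w : V) (w' : W), a + b ≤ s →
    (toEnd ℂ (Loop C A) V y ^ a) w = 0 → (toEnd ℂ (Loop C A) W y ^ b) w' = 0 →
    (toEnd ℂ (Loop C A) (V ⊗[ℂ] W) y ^ s) (w ⊗ₜ w') = 0 := by
  induction s with
  | zero =>
    intro a b w w' hab ha _
    obtain rfl : a = 0 := by omega
    rw [show w = 0 from ha, TensorProduct.zero_tmul, map_zero]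
  | succ s ih =>
    intro a b w w' hab ha hb
    cases a with
    | zero => rw [show w = 0 from ha, TensorProduct.zero_tmul, map_zero]
    | succ a =>
      cases b with
      | zero => rw [show w' = 0 from hb, TensorProduct.tmul_zero, map_zero]
      | succ b =>
        rw [pow_succ, Module.End.mul_apply, toEnd_apply_apply, TensorProduct.LieModule.lie_tmul_right,
          map_add, ih a (b + 1) _ _ (by omega) ?_ hb, ih (a + 1) b _ _ (by omega) ha ?_, add_zero]
        · rwa [pow_succ, Module.End.mul_apply] at hb
        · rwa [pow_succ, Module.End.mul_apply] at ha

theorem IsHighestWeight.tmul {ψ₁ ψ₂ : LoopCartan C A →ₗ[ℂ] ℂ} {v : V} {w : W}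
    (hv : IsHighestWeight ψ₁ v) (hw : IsHighestWeight ψ₂ w) :
    IsHighestWeight (ψ₁ + ψ₂) (v ⊗ₜ[ℂ] w) where
  nPlus a x hx := by
    rw [TensorProduct.LieModule.lie_tmul_right, hv.nPlus a x hx, hw.nPlus a x hx,
      TensorProduct.zero_tmul, TensorProduct.tmul_zero, add_zero]
  cartan t := by
    rw [TensorProduct.LieModule.lie_tmul_right, hv.cartan, hw.cartan, TensorProduct.tmul_smul,
      ← TensorProduct.smul_tmul', ← add_smul]
    rfl

/-- The tensor product of cyclic modules that are locally nilpotent along coprime ideals is cyclic: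
an element of `𝔤' ⊗ A` can be changed so that it acts on one factor as before and on the other one
as zero. -/
theorem lieSpan_tmul_eq_top {I J : Ideal A} (hIJ : IsCoprime I J)
    (hV : IsLocallyNilpotentOn C V I) (hW : IsLocallyNilpotentOn C W J)
    {ψ₂ : LoopCartan C A →ₗ[ℂ] ℂ} {v : V} {w : W} (hw : IsHighestWeight ψ₂ w)
    (hgv : LieSubmodule.lieSpan ℂ (Loop C A) {v} = ⊤)
    (hgw : LieSubmodule.lieSpan ℂ (Loop C A) {w} = ⊤) :
    LieSubmodule.lieSpan ℂ (Loop C A) {v ⊗ₜ[ℂ] w} = ⊤ := by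
  obtain ⟨ε, hε⟩ := exists_isSplittingSequence hIJ
  set P := LieSubmodule.lieSpan ℂ (Loop C A) {v ⊗ₜ[ℂ] w}
  have hinl : ∀ (z : A ⊗[ℂ] derived D) (x : V) (y : W), x ⊗ₜ[ℂ] y ∈ P →
      ⁅SemiDirectSum.inl (C.action A) z, x⁆ ⊗ₜ[ℂ] y ∈ P := by
    intro z x y hxy
    obtain ⟨N, h1, h2⟩ := ((eventually_lie_eq_zero hV hε.one_sub_mem z x).and
      (eventually_lie_eq_zero hW hε.mem z y)).exists
    rw [sub_smul, one_smul, map_sub, sub_lie, sub_eq_zero] at h1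
    have := P.lie_mem (x := SemiDirectSum.inl (C.action A) (ε N • z)) hxy
    rwa [TensorProduct.LieModule.lie_tmul_right, h2, TensorProduct.tmul_zero, add_zero, ← h1] at this
  have hv : ∀ x : V, x ⊗ₜ[ℂ] w ∈ P := by
    intro x
    induction x using cyclic_induction hgv with
    | mem => exact LieSubmodule.subset_lieSpan (Set.mem_singleton _)
    | zero => rw [TensorProduct.zero_tmul]; exact P.zero_mem
    | add x x' h h' => rw [TensorProduct.add_tmul]; exact P.add_mem h h'
    | smul c x h => rw [← TensorProduct.smul_tmul']; exact P.smul_mem c h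
    | lie y x h =>
      rw [← inl_add_inr y, add_lie, TensorProduct.add_tmul]
      refine P.add_mem (hinl _ _ _ h) ?_
      have := P.lie_mem (x := SemiDirectSum.inr (C.action A) y.right) h
      rw [TensorProduct.LieModule.lie_tmul_right, hw.lie_inr, TensorProduct.tmul_smul] at this
      exact (P.toSubmodule.add_mem_iff_left (P.smul_mem _ h)).1 this
  have hvw : ∀ (y : W) (x : V), x ⊗ₜ[ℂ] y ∈ P := by
    intro y
    induction y using cyclic_induction hgw with
    | mem => exact hv
    | zero => intro x; rw [TensorProduct.tmul_zero]; exact P.zero_mem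
    | add y y' h h' => intro x; rw [TensorProduct.tmul_add]; exact P.add_mem (h x) (h' x)
    | smul c y h => intro x; rw [TensorProduct.tmul_smul]; exact P.smul_mem c (h x)
    | lie z y h =>
      intro x
      have := P.lie_mem (x := z) (h x)
      rw [TensorProduct.LieModule.lie_tmul_right] at this
      exact (P.toSubmodule.add_mem_iff_right (h _)).1 this
  rw [eq_top_iff]
  intro u _
  induction u using TensorProduct.induction_on with
  | zero => exact P.zero_mem
  | tmul x y => exact hvw y x
  | add u u' h h' => exact P.add_mem (h trivial) (h' trivial)

end Tensor

section Halves

variable {I J : Ideal A} {ε : ℕ → A} {hε : IsAdicCauchy (I ⊓ J) ε}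
  {hK : IsLocallyNilpotentOn C V (I ⊓ J)} {ψ₁ ψ₂ : LoopCartan C A →ₗ[ℂ] ℂ} {v : V}
  {d : C.subalgebra → V →ₗ[ℂ] V}
  (hd : IsPartialDerivation hε hK v (ψ₁ ∘ₗ LinearMap.inr ℂ _ _) d)
  (hgen : LieSubmodule.lieSpan ℂ (Loop C A) {v} = ⊤) (hv : IsHighestWeight (ψ₁ + ψ₂) v)
  (hs : IsSplittingSequence I J ε) (h₁ : VanishesOn ψ₁ I) (h₂ : VanishesOn ψ₂ J)

include hgen in
theorem IsPartialDerivation.half_of (a : A) (x : derived D) (w : V) :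
    hd.half hgen (Loop.of C A a x) w = limitAction hε hK (a ⊗ₜ x) w := by
  have h0 : d (0 : C.subalgebra) = 0 := (hd.toLinearMap hgen).map_zero
  have h1 : d (Loop.of C A a x).right w = 0 := by
    rw [show (Loop.of C A a x).right = 0 from rfl, h0, LinearMap.zero_apply]
  rw [hd.half_apply, h1, add_zero]
  rfl

include hv in
theorem IsPartialDerivation.half_nPlus (a : A) (x : derived D) (hx : (x : Alg D) ∈ nPlus D) :
    hd.half hgen (Loop.of C A a x) v = 0 := by
  rw [hd.half_of]
  exact limitAction_eq hε hK (.of_forall fun N => hv.nPlus (ε N * a) x hx)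

include hv hs h₁ h₂ in
/-- The part of the weight `ψ₁ + ψ₂` seen by `half` is `ψ₁`: on `ε_N A` the form `ψ₂` vanishes, as
`ε_N ∈ J`, and `ψ₁(x ⊗ ε_N a) = ψ₁(x ⊗ a)`, as `1 - ε_N ∈ I`. -/
theorem IsPartialDerivation.half_cartan (t : LoopCartan C A) :
    hd.half hgen (loopCartanIncl C A t) v = ψ₁ t • v := by
  have h1 : ∀ τ : A ⊗[ℂ] cartanDerived D,
      limitAction hε hK ((cartanIncl D).lTensor A τ) v = ψ₁ (τ, 0) • v := by
    intro τ
    induction τ using TensorProduct.induction_on with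
    | zero => rw [map_zero, map_zero, Prod.mk_zero_zero, map_zero, zero_smul, LinearMap.zero_apply]
    | tmul b x =>
      refine limitAction_eq hε hK ?_
      filter_upwards [eventually_ge_atTop 1] with N hN
      have e1 : ψ₁ ((ε N * b) ⊗ₜ[ℂ] x, 0) = ψ₁ (b ⊗ₜ[ℂ] x, 0) := by
        have hI : b * (1 - ε N) ∈ I :=
          I.mul_mem_left b (Ideal.pow_le_self (by omega) (hs.one_sub_mem N))
        rw [eq_comm, ← sub_eq_zero, ← map_sub, Prod.mk_sub_mk, ← TensorProduct.sub_tmul, sub_zero,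
          show b - ε N * b = b * (1 - ε N) by ring]
        exact h₁ _ hI x
      have e2 : ψ₂ ((ε N * b) ⊗ₜ[ℂ] x, 0) = 0 :=
        h₂ _ (J.mul_mem_right b (Ideal.pow_le_self (by omega) (hs.mem N))) x
      have := hv.cartan ((ε N * b) ⊗ₜ[ℂ] x, 0)
      rw [LinearMap.add_apply, e1, e2, add_zero, loopCartanIncl_tmul] at this
      exact this
    | add σ τ h h' =>
      have : ((σ + τ, 0) : LoopCartan C A) = (σ, 0) + (τ, 0) := by simp
      rw [map_add, map_add, LinearMap.add_apply, h, h', this, map_add, add_smul]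
  have h2 : (loopCartanIncl C A t).left = (cartanIncl D).lTensor A t.1 + 0 := rfl
  have h3 : (loopCartanIncl C A t).right = 0 + t.2 := rfl
  rw [hd.half_apply, h2, h3, add_zero, zero_add, h1, hd.apply_vec, ← add_smul,
    LinearMap.comp_apply, ← map_add]
  congr 2
  simp

include hv in
/-- On finitely many vectors the limit `ε` is attained by some `ε_N`, and all `f_i ⊗ a` have the
nilpotency of `f_i` on the generator. -/
theorem IsPartialDerivation.half_pow {i : Fin l} {k : ℕ}
    (hk : (toEnd ℂ (Loop C A) V (Loop.of C A 1 (f' D i)) ^ k) v = 0) :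
    (hd.half hgen (Loop.of C A 1 (f' D i)) ^ k) v = 0 := by
  obtain ⟨N, hN⟩ := (eventually_toEnd_pow_eq (T := hd.half hgen (Loop.of C A 1 (f' D i)))
    (y := fun N => Loop.of C A (ε N * 1) (f' D i)) (fun w => by
      rw [hd.half_of]
      exact limitAction_spec hε hK (1 ⊗ₜ f' D i) w) k v).exists
  rw [← hN]
  exact hv.toEnd_pow_eq_zero hk _

include hv in
theorem IsPartialDerivation.coHalf_pow {i : Fin l} {k : ℕ}
    (hk : (toEnd ℂ (Loop C A) V (Loop.of C A 1 (f' D i)) ^ k) v = 0) :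
    (hd.coHalf hgen (Loop.of C A 1 (f' D i)) ^ k) v = 0 := by
  obtain ⟨N, hN⟩ := (eventually_toEnd_pow_eq (T := hd.coHalf hgen (Loop.of C A 1 (f' D i)))
    (y := fun N => Loop.of C A (1 - ε N) (f' D i)) (fun w => by
      filter_upwards [limitAction_spec hε hK (1 ⊗ₜ f' D i) w] with N hN
      rw [hd.coHalf_apply, hd.half_of, ← hN, ← loopOf_apply, map_sub, sub_lie]
      congr 2
      change loopOf C A (f' D i) (ε N) = loopOf C A (f' D i) (ε N * 1)
      rw [mul_one]) k v).exists
  rw [← hN]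
  exact hv.toEnd_pow_eq_zero hk _

end Halves

/-- The multiplicativity of Weyl modules, for modules given by their universal properties. -/
theorem nonempty_equiv_tensor {I J : Ideal A} (hIJ : IsCoprime I J)
    {ψ₁ ψ₂ : LoopCartan C A →ₗ[ℂ] ℂ} (h₁ : VanishesOn ψ₁ I) (h₂ : VanishesOn ψ₂ J)
    (hψ : VanishesOn (ψ₁ + ψ₂) (I ⊓ J))
    {V₁ V₂ : Type*} [AddCommGroup V₁] [Module ℂ V₁] [LieRingModule (Loop C A) V₁]
    [LieModule ℂ (Loop C A) V₁] [AddCommGroup V₂] [Module ℂ V₂] [LieRingModule (Loop C A) V₂]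
    [LieModule ℂ (Loop C A) V₂] {v : V} {v₁ : V₁} {v₂ : V₂}
    (hv : IsIntegrableGenerator (ψ₁ + ψ₂) v) (hv₁ : IsIntegrableGenerator ψ₁ v₁)
    (hv₂ : IsIntegrableGenerator ψ₂ v₂)
    (hl : HasLift (ψ₁ + ψ₂) v (V × V)) (hl' : HasLift (ψ₁ + ψ₂) v (V₁ ⊗[ℂ] V₂))
    (hl₁ : HasLift ψ₁ v₁ V) (hl₂ : HasLift ψ₂ v₂ (V₁ →ₗ[ℂ] V)) :
    Nonempty (V ≃ₗ⁅ℂ, Loop C A⁆ (V₁ ⊗[ℂ] V₂)) := by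
  obtain ⟨ε, hs⟩ := exists_isSplittingSequence hIJ
  have hε := hs.isAdicCauchy hIJ
  have hidem := hs.mul_self_sub_mem hIJ
  have hK := hv.isLocallyNilpotentOn (K := I ⊓ J) hψ
  obtain ⟨d, hd⟩ := hl.exists_isPartialDerivation hv hε hK (ψ₁ ∘ₗ LinearMap.inr ℂ _ _)
  have hgen := hv.lieSpan_eq_top
  have hgen₁ := hv₁.lieSpan_eq_top
  have hgen₂ := hv₂.lieSpan_eq_top
  have hw := hv₁.isHighestWeight.tmul hv₂.isHighestWeight
  -- the homomorphism from `V` to the tensor product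
  obtain ⟨Φ, hΦ, hΦ'⟩ := hl'
    (toEnd ℂ (Loop C A) (V₁ ⊗[ℂ] V₂) : Loop C A →ₗ[ℂ] Module.End ℂ (V₁ ⊗[ℂ] V₂)) (v₁ ⊗ₜ v₂)
    (fun x y w => lie_lie x y w) (fun a x hx => hw.nPlus a x hx) (fun t => hw.cartan t) (fun i => by
      obtain ⟨a, ha⟩ := hv₁.exists_f_pow_eq_zero i
      obtain ⟨b, hb⟩ := hv₂.exists_f_pow_eq_zero i
      exact ⟨a + b, toEnd_pow_tmul_eq_zero _ _ a b _ _ le_rfl ha hb⟩)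
  -- the first factor maps to `V` with the action through `ε`
  obtain ⟨φ, hφ, hφ'⟩ := hl₁ (hd.half hgen) v (hd.half_lie hgen hidem)
    (hd.half_nPlus hgen hv.isHighestWeight) (hd.half_cartan hgen hv.isHighestWeight hs h₁ h₂)
    (fun i => by
      obtain ⟨k, hk⟩ := hv.exists_f_pow_eq_zero i
      exact ⟨k, hd.half_pow hgen hv.isHighestWeight hk⟩)
  -- Schur-type statement: an operator commuting with the action through `ε` is determined on the
  -- image of `φ` by its value on the generator
  have hcomm : ∀ (g : Module.End ℂ V) (c : ℂ),
      (∀ y w, g (hd.half hgen y w) = hd.half hgen y (g w)) →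
      g v = c • v →
      g ∘ₗ φ = c • φ := by
    intro g c hg hgv
    refine LinearMap.ext fun w => ?_
    rw [LinearMap.comp_apply, LinearMap.smul_apply]
    induction w using cyclic_induction hgen₁ with
    | mem => rw [hφ, hgv]
    | zero => rw [map_zero, map_zero, smul_zero]
    | add w w' h h' => rw [map_add, map_add, h, h', smul_add]
    | smul b w h => rw [map_smul, map_smul, h, smul_comm]
    | lie y w h => rw [hφ', hg, h, map_smul]
  -- the second factor maps to the linear maps `V₁ → V`, on which the complementary action operates
  -- by composition
  let τ : Loop C A →ₗ[ℂ] Module.End ℂ (V₁ →ₗ[ℂ] V) :=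
    LinearMap.mk₂ ℂ (fun y θ => hd.coHalf hgen y ∘ₗ θ)
      (fun y y' θ => by rw [map_add, LinearMap.add_comp])
      (fun c y θ => by rw [map_smul, LinearMap.smul_comp])
      (fun y θ θ' => LinearMap.comp_add _ _ _)
      (fun c y θ => LinearMap.comp_smul _ _ _)
  have hτ : ∀ y θ, τ y θ = hd.coHalf hgen y ∘ₗ θ := fun _ _ => rfl
  have hτpow : ∀ y k θ, (τ y ^ k) θ = (hd.coHalf hgen y ^ k) ∘ₗ θ := by
    intro y k θ
    induction k with
    | zero => rfl
    | succ k ih => rw [pow_succ', pow_succ', Module.End.mul_apply, hτ, ih]; rfl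
  obtain ⟨Ψ, hΨ, hΨ'⟩ := hl₂ τ φ
    (fun x y θ => LinearMap.ext fun w => hd.coHalf_lie hgen hidem x y (θ w))
    (fun a x hx => by
      rw [hτ, hcomm _ 0 (hd.coHalf_half_comm hgen hidem _), zero_smul]
      rw [hd.coHalf_apply, hv.isHighestWeight.nPlus a x hx,
        hd.half_nPlus hgen hv.isHighestWeight a x hx, sub_zero, zero_smul])
    (fun t => by
      rw [hτ, hcomm _ (ψ₂ t) (hd.coHalf_half_comm hgen hidem _)]
      rw [hd.coHalf_apply, hv.isHighestWeight.cartan,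
        hd.half_cartan hgen hv.isHighestWeight hs h₁ h₂, ← sub_smul, LinearMap.add_apply, add_sub_cancel_left])
    (fun i => by
      obtain ⟨k, hk⟩ := hv.exists_f_pow_eq_zero i
      refine ⟨k, ?_⟩
      rw [hτpow, hcomm _ 0 (fun y w => ?_), zero_smul]
      · rw [hd.coHalf_pow hgen hv.isHighestWeight hk, zero_smul]
      · have h : Commute (hd.coHalf hgen (Loop.of C A 1 (f' D i))) (hd.half hgen y) :=
          LinearMap.ext fun w => hd.coHalf_half_comm hgen hidem _ y w
        exact LinearMap.congr_fun (h.pow_left k).eq w)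
  have hΨhalf : ∀ w₂ y w₁, Ψ w₂ ⁅y, w₁⁆ = hd.half hgen y (Ψ w₂ w₁) := by
    intro w₂
    induction w₂ using cyclic_induction hgen₂ with
    | mem => rw [hΨ]; exact hφ'
    | zero => intro y w₁; simp
    | add w w' h h' => intro y w₁; rw [map_add, LinearMap.add_apply, h, h', LinearMap.add_apply,
        map_add]
    | smul c w h => intro y w₁; rw [map_smul, LinearMap.smul_apply, h, LinearMap.smul_apply, map_smul]
    | lie z w h =>
      intro y w₁
      rw [hΨ', hτ, LinearMap.comp_apply, LinearMap.comp_apply, h,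
        hd.coHalf_half_comm hgen hidem]
  let Θ : V₁ ⊗[ℂ] V₂ →ₗ[ℂ] V := TensorProduct.lift Ψ.flip
  have hΘ : ∀ w₁ w₂, Θ (w₁ ⊗ₜ w₂) = Ψ w₂ w₁ := fun w₁ w₂ => TensorProduct.lift.tmul _ _
  have hΘ' : ∀ (y : Loop C A) t, Θ ⁅y, t⁆ = ⁅y, Θ t⁆ := by
    intro y t
    induction t using TensorProduct.induction_on with
    | zero => rw [lie_zero, map_zero, lie_zero]
    | tmul w₁ w₂ =>
      rw [TensorProduct.LieModule.lie_tmul_right, map_add, hΘ, hΘ, hΘ, hΨhalf, hΨ', hτ,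
        LinearMap.comp_apply, hd.coHalf_apply, add_sub_cancel]
    | add t t' h h' => rw [lie_add, map_add, h, h', map_add, lie_add]
  have hgen₁₂ := lieSpan_tmul_eq_top hIJ (hv₁.isLocallyNilpotentOn h₁)
    (hv₂.isLocallyNilpotentOn h₂) hv₂.isHighestWeight hgen₁ hgen₂
  refine ⟨{ Φ with
    map_lie' := fun {y w} => hΦ' y w
    invFun := Θ
    left_inv := fun w => ?_
    right_inv := fun t => ?_ }⟩
  · change Θ (Φ w) = w
    induction w using cyclic_induction hgen with
    | mem => rw [hΦ, hΘ, hΨ, hφ]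
    | zero => rw [map_zero, map_zero]
    | add w w' h h' => rw [map_add, map_add, h, h']
    | smul c w h => rw [map_smul, map_smul, h]
    | lie y w h => rw [hΦ']; exact (hΘ' y _).trans (by rw [h])
  · change Φ (Θ t) = t
    induction t using cyclic_induction hgen₁₂ with
    | mem => rw [hΘ, hΨ, hφ, hΦ]
    | zero => rw [map_zero, map_zero]
    | add w w' h h' => rw [map_add, map_add, h, h']
    | smul c w h => rw [map_smul, map_smul, h]
    | lie y w h =>
      rw [hΘ', hΦ', h]
      rfl

end Main

end KacMoody

open KacMoody in
theorem mainTheorem1 {l : ℕ} {H : Type*} [AddCommGroup H] [Module ℂ H]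
    (D : KacMoody.Datum l H) (C : KacMoody.Complement D)
    {A : Type*} [CommRing A] [Algebra ℂ A] [Algebra.FiniteType ℂ A]
    (I J : Ideal A) (hI : FiniteDimensional ℂ (A ⧸ I)) (hJ : FiniteDimensional ℂ (A ⧸ J))
    (hIJ : IsCoprime I J)
    (ψ₁ ψ₂ : KacMoody.LoopCartan C A →ₗ[ℂ] ℂ)
    (h₁ : KacMoody.VanishesOn ψ₁ I) (h₂ : KacMoody.VanishesOn ψ₂ J)
    (hd₁ : KacMoody.IsDominantIntegral ψ₁) (hd₂ : KacMoody.IsDominantIntegral ψ₂) :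
    Nonempty (KacMoody.Weyl (ψ₁ + ψ₂) (I ⊓ J) ≃ₗ⁅ℂ, KacMoody.Loop C A⁆
      (KacMoody.Weyl ψ₁ I ⊗[ℂ] KacMoody.Weyl ψ₂ J)) := by
  have hψ : VanishesOn (ψ₁ + ψ₂) (I ⊓ J) := fun a ha x => by
    rw [LinearMap.add_apply, h₁ a ha.1 x, h₂ a ha.2 x, add_zero]
  have hdom : IsDominantIntegral (ψ₁ + ψ₂) := fun i => by
    obtain ⟨n₁, hn₁⟩ := hd₁ i
    obtain ⟨n₂, hn₂⟩ := hd₂ i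
    refine ⟨n₁ + n₂, ?_⟩
    rw [Nat.cast_add, ← hn₁, ← hn₂]
    rfl
  exact nonempty_equiv_tensor hIJ h₁ h₂ hψ (Weyl.isIntegrableGenerator _ hdom)
    (Weyl.isIntegrableGenerator _ hd₁) (Weyl.isIntegrableGenerator _ hd₂) (Weyl.hasLift hψ hdom _)
    (Weyl.hasLift hψ hdom _) (Weyl.hasLift h₁ hd₁ _) (Weyl.hasLift h₂ hd₂ _)
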